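/- **Setting.** Let $n\ge 1$, $m\ge 2$, let $\Omega\subset\mathbb R^n$ be a bounded open set of class $C^1$ with outward unit normal $\eta$, and let $a,b,c>0$ satisfy $\cos\frac{\pi}{m+1}<\frac{a}{b+c}$. Put $$\lambda_\ell=a+2\sqrt{bc}\,\cos\Big(\frac{(m+1-\ell)\pi}{m+1}\Big),\qquad \ell=1,\dots,m .$$ Let $\digamma=(\digamma_1,\dots,\digamma_m):\mathbb R^m\to\mathbb R^m$, $\alpha\in[0,1]$, $\Lambda\in\mathbb R^m$, where $0<\alpha<1$ (Robin), or $\alpha=0$ and $\Lambda=0$ (homogeneous Neumann), or $\alpha=1$ and $\Lambda=0$ (homogeneous Dirichlet). Let either $\kappa_\ell=1$ for all $\ell$ or $\kappa_\ell=\lambda_\ell$ for all $\ell$, and consider the system $$\partial_t w_\ell-\lambda_\ell\Delta w_\ell=\digamma_\ell(W)\ \text{ in }\Omega\times(0,T_{\max}),\qquad \alpha w_\ell+(1-\alpha)\kappa_\ell\,\partial_\eta w_\ell=\Lambda_\ell\ \text{ on }\partial\Omega\times(0,T_{\max}),$$ $\ell=1,\dots,m$, $W=(w_1,\dots,w_m)$.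 Let $p_m\ge 1$ be an integer, let $\theta_1,\dots,\theta_{m-1}>0$, and let $$H_{p_m}(w_1,\dots,w_m)=\sum_{p_{m-1}=0}^{p_m}\cdots\sum_{p_1=0}^{p_2}\binom{p_m}{p_{m-1}}\cdots\binom{p_2}{p_1}\,\theta_1^{p_1^2}\cdots\theta_{m-1}^{p_{m-1}^2}\;w_1^{p_1}w_2^{p_2-p_1}\cdots w_m^{p_m-p_{m-1}} .$$ A *nonnegative classical solution* on $[0,T_{\max})$, $T_{\max}\in(0,\infty]$, is a $W$ with $w_\ell\ge0$ in $\Omega\times(0,T_{\max})$ such that $\partial_tw_\ell,\nabla w_\ell,D^2w_\ell$ exist and are continuous in $\Omega\times(0,T_{\max})$, $w_\ell$ and $\nabla w_\ell$ extend continuously to $\overline\Omega\times(0,T_{\max})$, the equations and the boundary conditions hold pointwise, and $W(t,\cdot)\to W(0,\cdot)\in L^{p_m}(\Omega)^m$ in $L^{p_m}(\Omega)^m$ as $t\downarrow0$. For such a solution let $L(t)=\int_\Omega H_{p_m}(W(t,x))\,dx$. **Assumptions.** 1. (Polynomial growth) There are $C_1>0$ and $N\in\mathbb N$ with $|\digamma_\ell(W)|\le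 C_1(1+\sum_iw_i)^N$ for all $W\in(0,\infty)^m$ and all $\ell$. 2. (One-sided bound) There are $\bar d_1,\dots,\bar d_{m-1}>0$ such that for every $S=(d_1,\dots,d_{m-1},1)$ with $d_\ell\ge\bar d_\ell$ for all $\ell$ there is $C_2>0$ with $\langle S,\digamma(W)\rangle\le C_2(1+\sum_iw_i)$ for all $W\in[0,\infty)^m$. The weights are large enough that $\theta_\ell\theta_{\ell+1}\cdots\theta_{m-1}\ge\bar d_\ell$ for $\ell=1,\dots,m-1$. 3. (Positivity) For all integers $0\le p_1\le\dots\le p_{m-1}\le p_m-2$ and all $l=2,\dots,m$ one has $K_l^l>0$. Here, with the symmetric matrix given for $\ell\le\kappa$ by $$a_{\ell\kappa}=\frac{\lambda_\ell+\lambda_\kappa}{2}\prod_{k<\ell}\theta_k^{p_k^2}\prod_{\ell\le k<\kappa}\theta_k^{(p_k+1)^2}\prod_{\kappa\le k\le m-1}\theta_k^{(p_k+2)^2}$$ and its leading principal minors $\det[k]$, $$K_l^2=a_{11}a_{ll}-a_{1l}^2,\qquad H_l^2=a_{11}a_{2l}-a_{12}a_{1l},\qquad K_l^r=K_{r-1}^{r-1}K_l^{r-1}-\big[H_l^{r-1}\big]^2\quad(3\le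 r\le l),$$ $$H_l^r=D_l^r\prod_{k=1}^{r-2}(\det[k])^{2^{\,r-k-2}}\quad(3\le r\le l-1),$$ where $D_l^r$ is the minor of $(a_{\ell\kappa})$ with rows $1,\dots,r$ and columns $1,\dots,r-1,l$. **Theorem.** $L$ is uniformly bounded on $[0,T^*]$ for every finite $T^*<T_{\max}$, and the bound does not degenerate as $T^*\uparrow T_{\max}$ if $T_{\max}<\infty$. Precisely: for all $T,R\in\mathbb R$ there is a constant $M$ such that, for every nonnegative classical solution $W$ on some $[0,T_{\max})$ with $L(0)\le R$, every real $T^*\le T$ with $T^*<T_{\max}$ and every $t\in[0,T^*]$, the function $H_{p_m}(W(t,\cdot))$ is integrable over $\Omega$ and $|L(t)|\le M$. -/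

import Mathlib

open MeasureTheory Filter Topology
open scoped BigOperators

noncomputable section

namespace ToeplitzRD

/-! ### The diffusion coefficients and the weighted polynomial -/

/-- The `ℓ`-th eigenvalue (`ℓ = 1, …, m`, in increasing order) of the `m × m` tri-diagonal Toeplitz
matrix with diagonal `a`, upper diagonal `b` and lower diagonal `c`. -/
def eigenvalue (a b c : ℝ) (m ℓ : ℕ) : ℝ :=
  a + 2 * Real.sqrt (b * c) * Real.cos (((m : ℝ) + 1 - (ℓ : ℝ)) * Real.pi / ((m : ℝ) + 1))

/-- The weighted homogeneous polynomial `H_q (w_1, …, w_m)`, that is, the nested sum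
`∑_{p_{m-1} = 0}^{q} ⋯ ∑_{p_1 = 0}^{p_2} C(q, p_{m-1}) ⋯ C(p_2, p_1)
  θ_1 ^ (p_1 ^ 2) ⋯ θ_{m-1} ^ (p_{m-1} ^ 2) w_1 ^ p_1 w_2 ^ (p_2 - p_1) ⋯ w_m ^ (q - p_{m-1})`,
written with the outermost sum first.  The weights `θ_1, θ_2, …` are numbered from one, and `w_ℓ` is
the value of `w : Fin m → ℝ` at the index `ℓ - 1`. -/
def weightedPoly (θ : ℕ → ℝ) : (m : ℕ) → (Fin m → ℝ) → ℕ → ℝ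
  | 0, _, _ => 1
  | 1, w, q => w 0 ^ q
  | (j + 2), w, q =>
      ∑ s ∈ Finset.range (q + 1), (q.choose s : ℝ) * θ (j + 1) ^ (s ^ 2) *
        weightedPoly θ (j + 1) (Fin.init w) s * w (Fin.last (j + 1)) ^ (q - s)

/-! ### The matrix `a_{ℓκ}` and the determinant-type quantities -/

/-- The symmetric matrix `a_{ℓκ}`, `1 ≤ ℓ, κ ≤ m`:  for `ℓ ≤ κ` it is `(λ_ℓ + λ_κ) / 2` times
`∏_{k < ℓ} θ_k ^ (p_k ^ 2) ∏_{ℓ ≤ k < κ} θ_k ^ ((p_k + 1) ^ 2) ∏_{κ ≤ k < m} θ_k ^ ((p_k + 2) ^ 2)`. -/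
def entry (m : ℕ) (lam θ : ℕ → ℝ) (p : ℕ → ℕ) (ℓ κ : ℕ) : ℝ :=
  (lam ℓ + lam κ) / 2 *
    ((∏ k ∈ Finset.Ico 1 (min ℓ κ), θ k ^ (p k ^ 2)) *
     (∏ k ∈ Finset.Ico (min ℓ κ) (max ℓ κ), θ k ^ ((p k + 1) ^ 2)) *
     (∏ k ∈ Finset.Ico (max ℓ κ) m, θ k ^ ((p k + 2) ^ 2)))

/-- `det[k]`: the leading principal `k × k` minor of a matrix whose rows and columns are numbered
from one. -/
def leadingMinor (A : ℕ → ℕ → ℝ) (k : ℕ) : ℝ :=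
  (Matrix.of fun i j : Fin k => A ((i : ℕ) + 1) ((j : ℕ) + 1)).det

/-- The `r × r` minor with rows `1, …, r` and columns `1, …, r - 1, l`. -/
def mixedMinor (A : ℕ → ℕ → ℝ) (l r : ℕ) : ℝ :=
  (Matrix.of fun i j : Fin r =>
    A ((i : ℕ) + 1) (if (j : ℕ) + 1 = r then l else (j : ℕ) + 1)).det

/-- The quantity `H_l^r`, `r ≥ 2`. For `r = 2` it is `a_{11} a_{2l} - a_{12} a_{1l}`. -/
def Hdet (A : ℕ → ℕ → ℝ) (l r : ℕ) : ℝ :=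
  if r = 2 then A 1 1 * A 2 l - A 1 2 * A 1 l
  else mixedMinor A l r *
    ∏ k ∈ Finset.Icc 1 (r - 2), leadingMinor A k ^ (2 ^ (r - k - 2))

/-- The quantity `K_l^r`, `r ≥ 2` (first argument `r`, second argument `l`; values at `r = 0, 1` are
never used): `K_l^2 = a_{11} a_{ll} - a_{1l} ^ 2` and
`K_l^r = K_{r-1}^{r-1} K_l^{r-1} - (H_l^{r-1}) ^ 2`. -/
def Kdet (A : ℕ → ℕ → ℝ) : ℕ → ℕ → ℝ
  | 0, _ => 0
  | 1, _ => 0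
  | 2, l => A 1 1 * A l l - A 1 l ^ 2
  | (r + 3), l => Kdet A (r + 2) (r + 2) * Kdet A (r + 2) l - Hdet A l (r + 2) ^ 2

/-! ### Domains of class `C¹` -/

variable {n : ℕ}

/-- `ρ` is a `C¹` defining function of `Ω` near `x`: on a neighbourhood of `x`, `Ω` is the set where
`ρ` is negative, and the gradient of `ρ` at `x` does not vanish. -/
def IsC1DefiningAt (Ω : Set (EuclideanSpace ℝ (Fin n))) (x : EuclideanSpace ℝ (Fin n))
    (ρ : EuclideanSpace ℝ (Fin n) → ℝ) : Prop :=
  ∃ U : Set (EuclideanSpace ℝ (Fin n)), IsOpen U ∧ x ∈ U ∧ ContDiffOn ℝ 1 ρ U ∧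
    gradient ρ x ≠ 0 ∧ ∀ y ∈ U, (y ∈ Ω ↔ ρ y < 0)

/-- A bounded open set with boundary of class `C¹`, lying locally on one side of its boundary. -/
structure IsBoundedC1Domain (Ω : Set (EuclideanSpace ℝ (Fin n))) : Prop where
  isOpen : IsOpen Ω
  bounded : Bornology.IsBounded Ω
  boundary : ∀ x ∈ frontier Ω, ∃ ρ, IsC1DefiningAt Ω x ρ

/-- `η` is the outward unit normal vector of `Ω` at the boundary point `x`. -/
def IsOutwardUnitNormal (Ω : Set (EuclideanSpace ℝ (Fin n))) (x η : EuclideanSpace ℝ (Fin n)) :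
    Prop :=
  ∃ ρ, IsC1DefiningAt Ω x ρ ∧ η = ‖gradient ρ x‖⁻¹ • gradient ρ x

/-! ### Hypotheses on the reaction terms -/

/-- Polynomial growth on the open positive orthant. -/
def PolynomialGrowth {m : ℕ} (F : (Fin m → ℝ) → Fin m → ℝ) : Prop :=
  ∃ C : ℝ, 0 < C ∧ ∃ N : ℕ, ∀ W : Fin m → ℝ, (∀ i, 0 < W i) →
    ∀ i, |F W i| ≤ C * (1 + ∑ j, W j) ^ N

/-- The vector `S = (d_1, …, d_{m-1}, 1)`. -/
def Svec (m : ℕ) (d : ℕ → ℝ) (i : Fin m) : ℝ :=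
  if (i : ℕ) + 1 < m then d ((i : ℕ) + 1) else 1

/-- The one-sided bound `⟨S, F(W)⟩ ≤ C (1 + ∑ w_ℓ)` on the closed orthant, for every
`S = (d_1, …, d_{m-1}, 1)` with `d_ℓ ≥ dbar_ℓ`; the constant may depend on `S`. -/
def OneSidedBound {m : ℕ} (F : (Fin m → ℝ) → Fin m → ℝ) (dbar : ℕ → ℝ) : Prop :=
  ∀ d : ℕ → ℝ, (∀ ℓ ∈ Finset.Ico 1 m, dbar ℓ ≤ d ℓ) →
    ∃ C : ℝ, 0 < C ∧ ∀ W : Fin m → ℝ, (∀ i, 0 ≤ W i) →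
      ∑ i, Svec m d i * F W i ≤ C * (1 + ∑ i, W i)

/-! ### Classical solutions -/

/-- The cylinder `(0, T) × X`, with `T ∈ (0, ∞]`. -/
def cylinder (T : EReal) (X : Set (EuclideanSpace ℝ (Fin n))) :
    Set (ℝ × EuclideanSpace ℝ (Fin n)) :=
  {q | 0 < q.1 ∧ (q.1 : EReal) < T ∧ q.2 ∈ X}

/-- `w = (w_1, …, w_m)` (`w t x i` is the value of the component number `i + 1`) is a nonnegative
classical solution on `[0, T)` of
`∂_t w_ℓ - λ_ℓ Δ w_ℓ = F_ℓ(w)` in `Ω × (0, T)`,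
`α w_ℓ + (1 - α) κ_ℓ ∂_η w_ℓ = Λ_ℓ` on `∂Ω × (0, T)`,
with initial value `w 0`, which is attained in `L^q(Ω)`. -/
structure IsClassicalSolution {m : ℕ} (Ω : Set (EuclideanSpace ℝ (Fin n))) (lam : Fin m → ℝ)
    (F : (Fin m → ℝ) → Fin m → ℝ) (α : ℝ) (κ Λ : Fin m → ℝ) (q : ℕ) (T : EReal)
    (w : ℝ → EuclideanSpace ℝ (Fin n) → Fin m → ℝ) : Prop where
  /-- regularity inside: `∂_t w`, `D_x w`, `D_x² w` exist and are continuous in `Ω × (0, T)` -/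
  time_differentiable : ∀ i, ∀ z ∈ cylinder T Ω,
    DifferentiableAt ℝ (fun s => w s z.2 i) z.1
  time_deriv_continuous : ∀ i,
    ContinuousOn (fun z : ℝ × EuclideanSpace ℝ (Fin n) => deriv (fun s => w s z.2 i) z.1)
      (cylinder T Ω)
  space_contDiff : ∀ i, ∀ t : ℝ, 0 < t → (t : EReal) < T → ContDiffOn ℝ 2 (fun x => w t x i) Ω
  space_deriv_continuous : ∀ i,
    ContinuousOn (fun z : ℝ × EuclideanSpace ℝ (Fin n) =>
      fderiv ℝ (fderiv ℝ (fun x => w z.1 x i)) z.2) (cylinder T Ω)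
  /-- `w` is continuous up to the boundary for positive times -/
  continuous_closure : ∀ i,
    ContinuousOn (fun z : ℝ × EuclideanSpace ℝ (Fin n) => w z.1 z.2 i) (cylinder T (closure Ω))
  /-- the system of equations -/
  equation : ∀ i, ∀ t : ℝ, 0 < t → (t : EReal) < T → ∀ x ∈ Ω,
    deriv (fun s => w s x i) t - lam i * Laplacian.laplacian (fun y => w t y i) x = F (w t x) i
  /-- the spatial gradient extends continuously up to the boundary for positive times, and the
  boundary condition holds, the normal derivative being the normal component of this extension -/
  boundary_condition : ∀ i, ∃ G : ℝ × EuclideanSpace ℝ (Fin n) → EuclideanSpace ℝ (Fin n),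
    ContinuousOn G (cylinder T (closure Ω)) ∧
    (∀ z ∈ cylinder T Ω, G z = gradient (fun x => w z.1 x i) z.2) ∧
    ∀ z ∈ cylinder T (frontier Ω), ∀ η, IsOutwardUnitNormal Ω z.2 η →
      α * w z.1 z.2 i + (1 - α) * (κ i * inner ℝ (G z) η) = Λ i
  /-- the initial value lies in `L^q(Ω)` and is attained there -/
  initial_memLp : ∀ i, MemLp (fun x => w 0 x i) (q : ENNReal) (volume.restrict Ω)
  initial_limit : ∀ i,
    Tendsto (fun t : ℝ => eLpNorm (fun x => w t x i - w 0 x i) (q : ENNReal) (volume.restrict Ω))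
      (𝓝[>] 0) (𝓝 0)
  /-- nonnegativity -/
  nonneg : ∀ t : ℝ, 0 < t → (t : EReal) < T → ∀ x ∈ Ω, ∀ i, 0 ≤ w t x i

/-- The Lyapunov functional `L(t) = ∫_Ω H_q(w_1(t, x), …, w_m(t, x)) dx`. -/
def lyapunov {m : ℕ} (Ω : Set (EuclideanSpace ℝ (Fin n))) (θ : ℕ → ℝ) (q : ℕ)
    (w : ℝ → EuclideanSpace ℝ (Fin n) → Fin m → ℝ) (t : ℝ) : ℝ :=
  ∫ x in Ω, weightedPoly θ m (w t x) q

end ToeplitzRD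

end

/-! Differentiate `∫ H(W)` and integrate the diffusion term by parts. Three quantities appear: a
quadratic form in the gradients, a reaction term and a boundary flux. The form has a sign, the other
two are bounded above in terms of `H` and the data, and Gronwall's inequality concludes.

All derivatives of `H` come from one rule: `∂_ℓ` lowers the degree from `q` to `q - 1`, brings out
the factor `q`, and raises `p_ℓ, …, p_{m-1}` by one in the coefficient (`hasFDerivAt_nestedSum`).

Diffusion: two such shifts turn `θ_k ^ (p_k ^ 2)` into the exponents in `a_{ℓκ}`, with monomials
that do not depend on `ℓ, κ`. The form `∑ λ_i ∂_i∂_k H ∇w_i · ∇w_k` is thus a nonnegative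
combination of the forms with matrix `(a_{ℓκ})`. By the Desnanot–Jacobi identity the recursion for
`K_l^r` computes minors: `K_l^l` is `det[l]` times powers of smaller leading minors. Positivity of
all `K_l^l` is therefore Sylvester's criterion (`Kdet_eq`, `quadraticForm_nonneg_of_Kdet`,
`polyHess_form_nonneg`).

Reaction: one shift multiplies the coefficient by `∏_{k ≥ ℓ} θ_k ^ (2 p_k + 1)`. For each `p` these
numbers form an admissible vector `S`: they dominate `∏ θ_k`, because positivity of the matrix
forces `θ_k ≥ 1` when `p_m ≥ 2`, while `p = 0` when `p_m = 1`. Since `H` is comparable to `(∑ w_i) ^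
p_m`, the reaction term is at most `K (1 + H)` (`exists_reaction_bound`).

Boundary: the flux vanishes for Neumann conditions, is nonpositive for Dirichlet ones by
`normal_derivative_nonpos`, and for Robin ones is bounded by a polynomial in the boundary values
with negative leading part (`exists_flux_bound`).

Second derivatives need not extend to `∂Ω`, so Green's formula is used only with compactly supported
cut-offs `φ_k ↑ 1` as test weights. The measures `-∇φ_k dx` imitate the outward normal times surface
measure, in the one-sided sense needed for an upper bound (`exists_cutoff`). Gronwall runs from a
small time `s > 0`, where `L(s)` is controlled by `L(0)` through the `L^{p_m}` convergence
(`exists_bound_near_initial`). None of the constants involves the solution or `T_max`. -/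

namespace ToeplitzRD

/-! ### Bordered minors and Schur complements -/

section LinearAlgebra

variable (A : ℕ → ℕ → ℝ)

/-- The leading `k × k` block of a matrix whose rows and columns are numbered from one. -/
def leadingBlock (k : ℕ) : Matrix (Fin k) (Fin k) ℝ :=
  Matrix.of fun i j => A ((i : ℕ) + 1) ((j : ℕ) + 1)

/-- The minor with rows `1, …, k, u` and columns `1, …, k, v`. -/
def borderedMinor (k : ℕ) {r : ℕ} (u v : Fin r → ℕ) : ℝ :=
  (Matrix.of fun i j : Fin k ⊕ Fin r =>
    A (Sum.elim (fun a : Fin k => (a : ℕ) + 1) u i)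
      (Sum.elim (fun a : Fin k => (a : ℕ) + 1) v j)).det

/-- The entries of the Schur complement of the leading `k × k` block. -/
noncomputable def schurEntry (k i j : ℕ) : ℝ :=
  A i j - ∑ b : Fin k, (∑ a : Fin k, A i ((a : ℕ) + 1) * (leadingBlock A k)⁻¹ a b) *
    A ((b : ℕ) + 1) j

variable {A}

/-- The determinant formula for block matrices. It reduces identities between bordered minors to
identities between `1 × 1` and `2 × 2` determinants of Schur complement entries. -/
lemma borderedMinor_eq {k r : ℕ} (h : leadingMinor A k ≠ 0) (u v : Fin r → ℕ) :
    borderedMinor A k u v =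
      leadingMinor A k * (Matrix.of fun i j => schurEntry A k (u i) (v j)).det := by
  have hu : IsUnit (leadingBlock A k).det := isUnit_iff_ne_zero.2 h
  let _ := Matrix.invertibleOfIsUnitDet _ hu
  have : (Matrix.of fun i j : Fin k ⊕ Fin r =>
      A (Sum.elim (fun a : Fin k => (a : ℕ) + 1) u i)
        (Sum.elim (fun a : Fin k => (a : ℕ) + 1) v j)) =
      Matrix.fromBlocks (leadingBlock A k) (Matrix.of fun i j => A ((i : ℕ) + 1) (v j))
        (Matrix.of fun i j => A (u i) ((j : ℕ) + 1)) (Matrix.of fun i j => A (u i) (v j)) := by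
    ext (i | i) (j | j) <;> rfl
  rw [borderedMinor, this, Matrix.det_fromBlocks₁₁]
  congr 2

lemma leadingMinor_succ (k : ℕ) :
    leadingMinor A (k + 1) = borderedMinor A k (r := 1) (fun _ => k + 1) (fun _ => k + 1) := by
  rw [leadingMinor, borderedMinor,
    ← Matrix.det_submatrix_equiv_self (finSumFinEquiv (m := k) (n := 1))]
  congr 1
  ext (i | i) (j | j) <;> simp

lemma mixedMinor_succ (l k : ℕ) :
    mixedMinor A l (k + 1) = borderedMinor A k (r := 1) (fun _ => k + 1) (fun _ => l) := by
  rw [mixedMinor, borderedMinor,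
    ← Matrix.det_submatrix_equiv_self (finSumFinEquiv (m := k) (n := 1))]
  congr 1
  ext (i | i) (j | j) <;> simp [Nat.ne_of_lt]

/-- Only the grouping of the indices changes: the row and column `k + 1` move from the leading block
into the border. -/
lemma borderedMinor_succ (k l l' : ℕ) :
    borderedMinor A (k + 1) (r := 1) (fun _ => l) (fun _ => l') =
      borderedMinor A k (r := 2) ![k + 1, l] ![k + 1, l'] := by
  rw [borderedMinor, borderedMinor,
    ← Matrix.det_submatrix_equiv_self ((finSumFinEquiv (m := k + 1) (n := 1)).symm),
    ← Matrix.det_submatrix_equiv_self ((finSumFinEquiv (m := k) (n := 2)).symm)]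
  have key : ∀ (b : ℕ) (i : Fin (k + 2)),
      Sum.elim (fun a : Fin (k + 1) => (a : ℕ) + 1) (fun _ : Fin 1 => b)
        ((finSumFinEquiv (m := k + 1) (n := 1)).symm i) =
      Sum.elim (fun a : Fin k => (a : ℕ) + 1) ![k + 1, b]
        ((finSumFinEquiv (m := k) (n := 2)).symm i) := by
    intro b i
    obtain ⟨i, rfl⟩ := (finSumFinEquiv (m := k) (n := 2)).surjective i
    rw [Equiv.symm_apply_apply]
    rcases i with i | i
    · have : (finSumFinEquiv (m := k) (n := 2)) (Sum.inl i) =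
          (finSumFinEquiv (m := k + 1) (n := 1)) (Sum.inl i.castSucc) := by ext; simp
      rw [this, Equiv.symm_apply_apply]; simp
    · fin_cases i
      · have : (finSumFinEquiv (m := k) (n := 2)) (Sum.inr 0) =
            (finSumFinEquiv (m := k + 1) (n := 1)) (Sum.inl (Fin.last k)) := by ext; simp
        simp only [Fin.zero_eta, this, Equiv.symm_apply_apply]; simp
      · have : (finSumFinEquiv (m := k) (n := 2)) (Sum.inr 1) =
            (finSumFinEquiv (m := k + 1) (n := 1)) (Sum.inr 0) := by ext; simp
        simp only [Fin.mk_one, this, Equiv.symm_apply_apply]; simp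
  congr 1
  ext i j
  simp [key]

/-- The **Desnanot–Jacobi identity** for bordered minors. -/
lemma leadingMinor_mul_borderedMinor_succ {k : ℕ} (h : leadingMinor A k ≠ 0) (l l' : ℕ) :
    leadingMinor A k * borderedMinor A (k + 1) (r := 1) (fun _ => l) (fun _ => l') =
      leadingMinor A (k + 1) * borderedMinor A k (r := 1) (fun _ => l) (fun _ => l') -
        borderedMinor A k (r := 1) (fun _ => k + 1) (fun _ => l') *
          borderedMinor A k (r := 1) (fun _ => l) (fun _ => k + 1) := by
  rw [borderedMinor_succ, leadingMinor_succ, borderedMinor_eq h, borderedMinor_eq h,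
    borderedMinor_eq h, borderedMinor_eq h, borderedMinor_eq h]
  simp [Matrix.det_fin_two]
  ring

lemma borderedMinor_symm (hA : ∀ i j, A i j = A j i) (k l l' : ℕ) :
    borderedMinor A k (r := 1) (fun _ => l) (fun _ => l') =
      borderedMinor A k (r := 1) (fun _ => l') (fun _ => l) := by
  rw [borderedMinor, borderedMinor, ← Matrix.det_transpose]
  congr 1
  ext i j
  exact hA _ _

lemma leadingMinor_zero : leadingMinor A 0 = 1 := by simp [leadingMinor]

lemma leadingMinor_one : leadingMinor A 1 = A 1 1 := by simp [leadingMinor]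

lemma borderedMinor_one (l l' : ℕ) :
    borderedMinor A 1 (r := 1) (fun _ => l) (fun _ => l') = A 1 1 * A l l' - A 1 l' * A l 1 := by
  have h0 : leadingMinor A 0 ≠ 0 := by simp [leadingMinor_zero]
  have := leadingMinor_mul_borderedMinor_succ h0 l l'
  rw [zero_add, borderedMinor_eq h0 (fun _ => l), borderedMinor_eq h0, borderedMinor_eq h0,
    leadingMinor_zero, leadingMinor_one] at this
  simpa [schurEntry] using this

/-- The weight that relates `Kdet` and `Hdet` to minors. -/
noncomputable def minorWeight (A : ℕ → ℕ → ℝ) (r : ℕ) : ℝ :=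
  ∏ k ∈ Finset.Icc 1 (r - 2), leadingMinor A k ^ (2 ^ (r - k - 2))

/-- Each exponent `2 ^ (r - k - 2)` doubles and one factor is new. This matches the recursion for
`K_l^r`, which is quadratic in the previous quantities. -/
lemma minorWeight_succ {r : ℕ} (hr : 2 ≤ r) :
    minorWeight A (r + 1) = minorWeight A r ^ 2 * leadingMinor A (r - 1) := by
  obtain ⟨s, rfl⟩ := Nat.exists_eq_add_of_le' hr
  rw [minorWeight, minorWeight, show s + 2 + 1 - 2 = s + 1 by omega,
    show s + 2 - 2 = s by omega, Finset.prod_Icc_succ_top (by omega), ← Finset.prod_pow]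
  congr 1
  · refine Finset.prod_congr rfl fun k hk => ?_
    rw [Finset.mem_Icc] at hk
    rw [← pow_mul, show s + 2 + 1 - k - 2 = (s + 2 - k - 2) + 1 by omega, pow_succ]
  · rw [show s + 2 + 1 - (s + 1) - 2 = 0 by omega]
    simp

lemma Hdet_eq (hA : ∀ i j, A i j = A j i) (l s : ℕ) :
    Hdet A l (s + 2) = borderedMinor A (s + 1) (r := 1) (fun _ => s + 2) (fun _ => l) *
      minorWeight A (s + 2) := by
  rcases s with _ | s
  · simp only [Hdet, zero_add, if_true, borderedMinor_one, minorWeight]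
    simp [hA 2 1]
    ring
  · rw [Hdet, if_neg (by omega), mixedMinor_succ, minorWeight]

/-- The recursion is the Desnanot–Jacobi identity multiplied by the square of the weight; the spare
factor `det[s + 1]` is absorbed by `minorWeight_succ`. -/
lemma Kdet_eq (hA : ∀ i j, A i j = A j i)
    (s l : ℕ) (hpos : ∀ k ∈ Finset.Icc 1 s, leadingMinor A k ≠ 0) :
    Kdet A (s + 2) l = borderedMinor A (s + 1) (r := 1) (fun _ => l) (fun _ => l) *
      minorWeight A (s + 2) := by
  induction s generalizing l with
  | zero =>
    rw [Kdet, borderedMinor_one, minorWeight, hA l 1]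
    simp
    ring
  | succ s ih =>
    have ih' := fun l => ih l fun k hk => hpos k (by simp only [Finset.mem_Icc] at hk ⊢; omega)
    rw [Kdet, ih', ih', Hdet_eq hA, show s + 1 + 2 = (s + 2) + 1 by rfl,
      minorWeight_succ (r := s + 2) (by omega)]
    have := leadingMinor_mul_borderedMinor_succ
      (hpos (s + 1) (by simp)) l l
    rw [leadingMinor_succ (A := A) (s + 1), borderedMinor_symm hA _ l (s + 1 + 1)] at this
    rw [show s + 2 - 1 = s + 1 by omega]
    linear_combination (- minorWeight A (s + 2) ^ 2) * this

/-- By `Kdet_eq` with `l = r`, `K_l^l` is `det[l]` times a product of powers of earlier leading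
minors, so positivity passes up by strong induction. -/
lemma leadingMinor_pos_of_Kdet {m : ℕ} (hA : ∀ i j, A i j = A j i) (h1 : 0 < A 1 1)
    (hK : ∀ l ∈ Finset.Icc 2 m, 0 < Kdet A l l) :
    ∀ k ≤ m, 0 < leadingMinor A k := by
  intro k
  induction k using Nat.strong_induction_on with
  | _ k ih =>
    intro hk
    rcases k with _ | _ | s
    · simp [leadingMinor_zero]
    · simpa [leadingMinor_one] using h1
    · have h := hK (s + 2) (by simp; omega)
      have hw : 0 < minorWeight A (s + 2) := by
        refine Finset.prod_pos fun k hk' => pow_pos (ih k ?_ ?_) _ <;>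
        · rw [Finset.mem_Icc] at hk'; omega
      rw [Kdet_eq hA s _
        (fun k hk' => (ih k (by rw [Finset.mem_Icc] at hk'; omega)
          (by rw [Finset.mem_Icc] at hk'; omega)).ne')] at h
      rw [leadingMinor_succ]
      exact (pos_iff_pos_of_mul_pos h).2 hw

/-- **Sylvester's criterion**: a symmetric matrix with positive leading minors is positive
definite. -/
lemma posDef_leadingBlock {m : ℕ} (hA : ∀ i j, A i j = A j i)
    (hpos : ∀ k ≤ m, 0 < leadingMinor A k) : ∀ k ≤ m, (leadingBlock A k).PosDef := by
  intro k
  induction k with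
  | zero =>
    intro _
    exact (Matrix.PosSemidef.posDef_iff_det_ne_zero
      ⟨by ext i; exact i.elim0, fun x => by simp [Subsingleton.elim x 0]⟩).2 (by simp)
  | succ k ih =>
    intro hk
    have hP := ih (by omega)
    have hd := hpos k (by omega)
    have hu : IsUnit (leadingBlock A k).det := isUnit_iff_ne_zero.2 hd.ne'
    let _ := Matrix.invertibleOfIsUnitDet _ hu
    set B : Matrix (Fin k) (Fin 1) ℝ := Matrix.of fun i _ => A ((i : ℕ) + 1) (k + 1) with hB
    set D : Matrix (Fin 1) (Fin 1) ℝ := Matrix.of fun _ _ => A (k + 1) (k + 1) with hD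
    have hS : D - B.conjTranspose * (leadingBlock A k)⁻¹ * B =
        Matrix.of fun _ _ => schurEntry A k (k + 1) (k + 1) := by
      ext i j
      simp [hB, hD, schurEntry, Matrix.mul_apply, hA _ (k + 1)]
    -- The Schur complement is the number `det[k + 1] / det[k]`.
    have hs : 0 < schurEntry A k (k + 1) (k + 1) := by
      have h := hpos (k + 1) hk
      rw [leadingMinor_succ, borderedMinor_eq hd.ne'] at h
      simpa [hd] using h
    have hblock : (leadingBlock A (k + 1)).submatrix (finSumFinEquiv (m := k) (n := 1))
        (finSumFinEquiv (m := k) (n := 1)) =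
        Matrix.fromBlocks (leadingBlock A k) B B.conjTranspose D := by
      ext (i | i) (j | j) <;> simp [leadingBlock, hB, hD, hA _ (k + 1)]
    have hsemi : (leadingBlock A (k + 1)).PosSemidef := by
      rw [← Matrix.posSemidef_submatrix_equiv (finSumFinEquiv (m := k) (n := 1)), hblock,
        Matrix.PosDef.fromBlocks₁₁ _ _ hP, hS, Matrix.posSemidef_iff_dotProduct_mulVec]
      refine ⟨by ext i j; simp, fun x => ?_⟩
      simp [dotProduct, Matrix.mulVec]
      nlinarith [mul_self_nonneg (x 0)]
    exact (Matrix.PosSemidef.posDef_iff_det_ne_zero hsemi).2 (hpos (k + 1) hk).ne'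

lemma quadraticForm_nonneg_of_Kdet {m : ℕ} (hA : ∀ i j, A i j = A j i) (h1 : 0 < A 1 1)
    (hK : ∀ l ∈ Finset.Icc 2 m, 0 < Kdet A l l) (x : Fin m → ℝ) :
    0 ≤ ∑ i : Fin m, ∑ j : Fin m, A ((i : ℕ) + 1) ((j : ℕ) + 1) * (x i * x j) := by
  have h := (posDef_leadingBlock hA (leadingMinor_pos_of_Kdet hA h1 hK) m
    le_rfl).posSemidef.dotProduct_mulVec_nonneg x
  simp only [dotProduct, Matrix.mulVec, leadingBlock, Matrix.of_apply, Finset.mul_sum] at h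
  refine h.trans_eq (Finset.sum_congr rfl fun i _ => Finset.sum_congr rfl fun j _ => ?_)
  simp
  ring

end LinearAlgebra

/-! ### Nested sums with arbitrary coefficients -/

section NestedSum

/-- The nested sum `∑_{p_{m-1} ≤ q} ⋯ ∑_{p_1 ≤ p_2} C(q, p_{m-1}) ⋯ C(p_2, p_1) c(p)
w_1 ^ p_1 w_2 ^ (p_2 - p_1) ⋯ w_m ^ (q - p_{m-1})` with an arbitrary coefficient function `c`. -/
noncomputable def nestedSum : ((ℕ → ℕ) → ℝ) → (m : ℕ) → (Fin m → ℝ) → ℕ → ℝ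
  | c, 0, _, _ => c 0
  | c, 1, w, q => c 0 * w 0 ^ q
  | c, (j + 2), w, q =>
      ∑ s ∈ Finset.range (q + 1), (q.choose s : ℝ) *
        nestedSum (fun p => c (Function.update p (j + 1) s)) (j + 1) (Fin.init w) s *
          w (Fin.last (j + 1)) ^ (q - s)

/-- Raise the indices `p_ℓ, …, p_{m-1}` by one. -/
def shiftCoeff (m ℓ : ℕ) (c : (ℕ → ℕ) → ℝ) (p : ℕ → ℕ) : ℝ :=
  c fun k => if ℓ ≤ k ∧ k < m then p k + 1 else p k

lemma nestedSum_sum {ι : Type*} (S : Finset ι) (x : ι → ℝ) (c : ι → (ℕ → ℕ) → ℝ) (m : ℕ)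
    (w : Fin m → ℝ) (q : ℕ) :
    nestedSum (fun p => ∑ i ∈ S, x i * c i p) m w q = ∑ i ∈ S, x i * nestedSum (c i) m w q := by
  induction m using Nat.twoStepInduction generalizing c q with
  | zero => simp [nestedSum]
  | one => simp [nestedSum, Finset.sum_mul, mul_assoc]
  | more j _ ih =>
    simp only [nestedSum, ih, Finset.mul_sum, Finset.sum_mul]
    rw [Finset.sum_comm]
    refine Finset.sum_congr rfl fun i _ => Finset.sum_congr rfl fun s _ => ?_
    ring

lemma nestedSum_const_mul (a : ℝ) (c : (ℕ → ℕ) → ℝ) (m : ℕ) (w : Fin m → ℝ) (q : ℕ) :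
    nestedSum (fun p => a * c p) m w q = a * nestedSum c m w q := by
  simpa using nestedSum_sum ({()} : Finset Unit) (fun _ => a) (fun _ => c) m w q

/-- Iterated binomial theorem. Bounding coefficients above or below by constants thus compares every
nested sum with a power of `∑ w_i`. -/
lemma nestedSum_one (j : ℕ) (w : Fin (j + 1) → ℝ) (q : ℕ) :
    nestedSum (fun _ => 1) (j + 1) w q = (∑ i, w i) ^ q := by
  induction j generalizing q with
  | zero => simp [nestedSum]
  | succ j ih =>
    rw [nestedSum, Fin.sum_univ_castSucc, add_pow]
    refine Finset.sum_congr rfl fun s _ => ?_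
    rw [ih]
    simp only [Fin.init]
    ring

/-- The admissible indices `p_1 ≤ ⋯ ≤ p_j ≤ q`. -/
def AdmissibleIndex (j q : ℕ) (p : ℕ → ℕ) : Prop :=
  (∀ k ∈ Finset.Ico 1 j, p k ≤ p (k + 1)) ∧ (1 ≤ j → p j ≤ q)

lemma AdmissibleIndex.update {j q s : ℕ} {p : ℕ → ℕ} (h : AdmissibleIndex j s p) (hs : s ≤ q) :
    AdmissibleIndex (j + 1) q (Function.update p (j + 1) s) := by
  refine ⟨fun k hk => ?_, fun _ => by simpa using hs⟩
  rw [Finset.mem_Ico] at hk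
  rcases Nat.lt_or_ge k j with hkj | hkj
  · have h1 : k ≠ j + 1 := by omega
    have h2 : k + 1 ≠ j + 1 := by omega
    simpa [Function.update_of_ne, h1, h2, hkj.ne] using h.1 k (by simp; omega)
  · obtain rfl : k = j := by omega
    simpa using h.2 hk.1

/-- The comparison is required only at admissible indices, since the assumptions on the weights and
on the reaction are available only there. -/
lemma nestedSum_mono {c c' : (ℕ → ℕ) → ℝ} (j : ℕ) {w : Fin (j + 1) → ℝ} (hw : ∀ i, 0 ≤ w i)
    (q : ℕ) (h : ∀ p, AdmissibleIndex j q p → c p ≤ c' p) :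
    nestedSum c (j + 1) w q ≤ nestedSum c' (j + 1) w q := by
  induction j generalizing c c' q with
  | zero =>
    simp only [nestedSum]
    exact mul_le_mul_of_nonneg_right (h 0 ⟨by simp, by simp⟩) (pow_nonneg (hw 0) _)
  | succ j ih =>
    simp only [nestedSum]
    refine Finset.sum_le_sum fun s hs => ?_
    have hs' : s ≤ q := by rw [Finset.mem_range] at hs; omega
    refine mul_le_mul_of_nonneg_right (mul_le_mul_of_nonneg_left
      (ih (fun i => hw _) s fun p hp => h _ (hp.update hs')) (Nat.cast_nonneg _))
      (pow_nonneg (hw _) _)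

lemma nestedSum_nonneg {c : (ℕ → ℕ) → ℝ} (j : ℕ) {w : Fin (j + 1) → ℝ} (hw : ∀ i, 0 ≤ w i)
    (q : ℕ) (h : ∀ p, AdmissibleIndex j q p → 0 ≤ c p) :
    0 ≤ nestedSum c (j + 1) w q := by
  have := nestedSum_mono j hw q (c := fun p => 0 * c p) (c' := c) (by simpa using h)
  rwa [nestedSum_const_mul, zero_mul] at this

/-- Only finitely many values of `c` enter the sum, so `c` may be arbitrary; in particular it may
contain constants depending on `p` without any uniformity. -/
lemma exists_nestedSum_le (c : (ℕ → ℕ) → ℝ) (j q : ℕ) :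
    ∃ B : ℝ, 0 ≤ B ∧ ∀ w : Fin (j + 1) → ℝ, (∀ i, 0 ≤ w i) →
      nestedSum c (j + 1) w q ≤ B * (∑ i, w i) ^ q := by
  induction j generalizing c q with
  | zero =>
    refine ⟨|c 0|, abs_nonneg _, fun w hw => ?_⟩
    simp only [nestedSum, Fin.sum_univ_succ, Fin.sum_univ_zero, add_zero]
    exact mul_le_mul_of_nonneg_right (le_abs_self _) (pow_nonneg (hw 0) _)
  | succ j ih =>
    choose B hB0 hB using fun s => ih (fun p => c (Function.update p (j + 1) s)) s
    refine ⟨∑ s ∈ Finset.range (q + 1), B s, Finset.sum_nonneg fun s _ => hB0 s, fun w hw => ?_⟩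
    rw [← nestedSum_one, ← nestedSum_const_mul]
    simp only [nestedSum]
    refine Finset.sum_le_sum fun s hs => ?_
    refine mul_le_mul_of_nonneg_right (mul_le_mul_of_nonneg_left ?_ (Nat.cast_nonneg _))
      (pow_nonneg (hw _) _)
    refine (hB s _ fun i => hw _).trans ?_
    rw [nestedSum_const_mul, nestedSum_one]
    exact mul_le_mul_of_nonneg_right (Finset.single_le_sum (fun s _ => hB0 s) hs)
      (pow_nonneg (Finset.sum_nonneg fun i _ => hw _) _)

lemma exists_le_nestedSum {c : (ℕ → ℕ) → ℝ} (hc : ∀ p, 0 < c p) (j q : ℕ) :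
    ∃ b : ℝ, 0 < b ∧ ∀ w : Fin (j + 1) → ℝ, (∀ i, 0 ≤ w i) →
      b * (∑ i, w i) ^ q ≤ nestedSum c (j + 1) w q := by
  induction j generalizing c q with
  | zero =>
    refine ⟨c 0, hc 0, fun w hw => ?_⟩
    simp [nestedSum]
  | succ j ih =>
    choose b hb0 hb using fun s => ih (c := fun p => c (Function.update p (j + 1) s))
      (fun p => hc _) s
    obtain ⟨s₀, -, hs₀⟩ := Finset.exists_min_image (Finset.range (q + 1)) b (by simp)
    refine ⟨b s₀, hb0 s₀, fun w hw => ?_⟩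
    rw [← nestedSum_one, ← nestedSum_const_mul]
    simp only [nestedSum]
    refine Finset.sum_le_sum fun s hs => ?_
    refine mul_le_mul_of_nonneg_right (mul_le_mul_of_nonneg_left ?_ (Nat.cast_nonneg _))
      (pow_nonneg (hw _) _)
    refine le_trans ?_ (hb s _ fun i => hw _)
    rw [nestedSum_const_mul, nestedSum_one]
    exact mul_le_mul_of_nonneg_right (hs₀ s hs) (pow_nonneg (Finset.sum_nonneg fun i _ => hw _) _)

/-- The shift also raises the outermost index `p_{j+1}`. Freezing it at `s + 1` before the shift
amounts to freezing it at `s` after it, which is the reindexing that differentiation produces. -/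
lemma shiftCoeff_update {j ℓ s : ℕ} (hℓ : ℓ ≤ j + 1) (c : (ℕ → ℕ) → ℝ) :
    shiftCoeff (j + 1) ℓ (fun p => c (Function.update p (j + 1) (s + 1))) =
      fun p => shiftCoeff (j + 2) ℓ c (Function.update p (j + 1) s) := by
  ext p
  simp only [shiftCoeff]
  congr 1
  ext k
  by_cases hk : k = j + 1
  · subst hk; simp [hℓ]
  · simp only [Function.update_of_ne hk]
    congr 1
    simp only [eq_iff_iff, and_congr_right_iff]
    intro _; omega

/-- The range `m ≤ k < m` is empty: differentiation in the last variable acts on `w_m ^ (q - s)`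
alone. -/
lemma shiftCoeff_self (m : ℕ) (c : (ℕ → ℕ) → ℝ) : shiftCoeff m m c = c := by
  ext p
  simp only [shiftCoeff]
  congr 1
  ext k
  rw [if_neg (by omega)]

/-- `s C(q, s) = q C(q - 1, s - 1)`; used for the derivatives in the inner variables. -/
lemma sum_choose_mul_pred (q : ℕ) (X : ℕ → ℝ) (y : ℝ) :
    ∑ s ∈ Finset.range (q + 1), (q.choose s : ℝ) * (s * X (s - 1)) * y ^ (q - s) =
      q * ∑ s ∈ Finset.range (q - 1 + 1), ((q - 1).choose s : ℝ) * X s * y ^ (q - 1 - s) := by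
  rcases q with _ | q
  · simp
  · rw [Finset.sum_range_succ', Finset.mul_sum]
    simp only [Nat.cast_zero, zero_mul, mul_zero, add_zero, Nat.add_sub_cancel]
    refine Finset.sum_congr rfl fun s _ => ?_
    have : ((q + 1 : ℕ) : ℝ) * (q.choose s) = ((q + 1).choose (s + 1)) * ((s + 1 : ℕ) : ℝ) := by
      exact_mod_cast Nat.add_one_mul_choose_eq q s
    rw [Nat.add_sub_add_right]
    linear_combination (-(X s * y ^ (q - s))) * this

/-- `(q - s) C(q, s) = q C(q - 1, s)`; used for the derivative in the last variable. -/
lemma sum_choose_mul_compl (q : ℕ) (Y : ℕ → ℝ) (y : ℝ) :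
    ∑ s ∈ Finset.range (q + 1), (q.choose s : ℝ) * Y s * (((q - s : ℕ) : ℝ) * y ^ (q - s - 1)) =
      q * ∑ s ∈ Finset.range (q - 1 + 1), ((q - 1).choose s : ℝ) * Y s * y ^ (q - 1 - s) := by
  rcases q with _ | q
  · simp
  · rw [Finset.sum_range_succ, Finset.mul_sum]
    simp only [Nat.sub_self, Nat.cast_zero, zero_mul, mul_zero, add_zero, Nat.add_sub_cancel]
    refine Finset.sum_congr rfl fun s _ => ?_
    have : ((q.choose s : ℕ) : ℝ) * ((q + 1 : ℕ) : ℝ) =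
        ((q + 1).choose s) * ((q + 1 - s : ℕ) : ℝ) := by
      exact_mod_cast Nat.choose_mul_succ_eq q s
    rw [show q + 1 - s - 1 = q - s by omega]
    linear_combination (-(Y s * y ^ (q - s))) * this

/-- The partial derivatives of a nested sum are nested sums with shifted coefficients. -/
lemma hasFDerivAt_nestedSum (c : (ℕ → ℕ) → ℝ) (j : ℕ) (w : Fin (j + 1) → ℝ) (q : ℕ) :
    HasFDerivAt (fun w => nestedSum c (j + 1) w q)
      (∑ i : Fin (j + 1), ((q : ℝ) * nestedSum (shiftCoeff (j + 1) (i + 1) c) (j + 1) w (q - 1)) •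
        (ContinuousLinearMap.proj i : (Fin (j + 1) → ℝ) →L[ℝ] ℝ)) w := by
  induction j generalizing c q with
  | zero =>
    have h := (((ContinuousLinearMap.proj (R := ℝ) (φ := fun _ : Fin 1 => ℝ) 0).hasFDerivAt
      (x := w)).pow q).const_mul (c 0)
    simp only [nestedSum]
    refine h.congr_fderiv ?_
    ext v
    simp [shiftCoeff_self]
    ring
  | succ j ih =>
    simp only [nestedSum]
    let I : (Fin (j + 2) → ℝ) →L[ℝ] (Fin (j + 1) → ℝ) :=
      ContinuousLinearMap.pi fun i => ContinuousLinearMap.proj i.castSucc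
    have hI : ∀ w, Fin.init w = I w := fun w => by ext i; simp [I, Fin.init]
    have h : ∀ s ∈ Finset.range (q + 1), HasFDerivAt (fun w : Fin (j + 2) → ℝ =>
        (q.choose s : ℝ) *
        nestedSum (fun p => c (Function.update p (j + 1) s)) (j + 1) (Fin.init w) s *
          w (Fin.last (j + 1)) ^ (q - s)) _ w := fun s _ =>
      ((((ih (fun p => c (Function.update p (j + 1) s)) (Fin.init w) s).comp w
        (I.hasFDerivAt (x := w)))).const_mul (q.choose s : ℝ)).mul
        (((ContinuousLinearMap.proj (R := ℝ) (φ := fun _ : Fin (j + 2) => ℝ)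
          (Fin.last (j + 1))).hasFDerivAt (x := w)).pow (q - s))
    refine (HasFDerivAt.fun_sum h).congr_fderiv ?_
    ext v
    rw [Fin.sum_univ_castSucc]
    have h1 : ∀ i : Fin (j + 1), ∑ s ∈ Finset.range (q + 1), (q.choose s : ℝ) *
        (s * nestedSum (shiftCoeff (j + 1) (i + 1) fun p => c (Function.update p (j + 1) s))
          (j + 1) (Fin.init w) (s - 1)) * w (Fin.last (j + 1)) ^ (q - s) =
        q * ∑ s ∈ Finset.range (q - 1 + 1), ((q - 1).choose s : ℝ) *
          nestedSum (fun p => shiftCoeff (j + 2) (i + 1) c (Function.update p (j + 1) s))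
          (j + 1) (Fin.init w) s * w (Fin.last (j + 1)) ^ (q - 1 - s) := by
      intro i
      rw [← sum_choose_mul_pred q (fun s =>
        nestedSum (fun p => shiftCoeff (j + 2) (i + 1) c (Function.update p (j + 1) s))
          (j + 1) (Fin.init w) s)]
      refine Finset.sum_congr rfl fun s _ => ?_
      rcases s with _ | s
      · simp
      · rw [shiftCoeff_update (by omega)]; simp
    have h2 := sum_choose_mul_compl q (fun s =>
        nestedSum (fun p => c (Function.update p (j + 1) s)) (j + 1) (Fin.init w) s)
        (w (Fin.last (j + 1)))
    simp only [_root_.add_apply, _root_.sum_apply,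
      _root_.smul_apply, ContinuousLinearMap.proj_apply, smul_eq_mul,
      Fin.val_castSucc, Fin.val_last, shiftCoeff_self, ← h1, ← h2]
    simp only [Finset.sum_mul, Finset.sum_add_distrib, ContinuousLinearMap.comp_apply,
      Function.comp_apply, ← hI, _root_.sum_apply, _root_.smul_apply,
      ContinuousLinearMap.proj_apply, Finset.mul_sum, Fin.init, smul_eq_mul]
    rw [add_comm]
    congr 1
    · rw [Finset.sum_comm]
      refine Finset.sum_congr rfl fun i _ => Finset.sum_congr rfl fun s _ => ?_
      ring
    · refine Finset.sum_congr rfl fun s _ => ?_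
      simp
      ring

end NestedSum

/-! ### The weighted polynomial and its derivatives -/

section WeightedPolynomial

/-- The coefficient `θ_1 ^ (p_1 ^ 2) ⋯ θ_{m-1} ^ (p_{m-1} ^ 2)`. -/
noncomputable def weightCoeff (θ : ℕ → ℝ) (m : ℕ) (p : ℕ → ℕ) : ℝ :=
  ∏ k ∈ Finset.Ico 1 m, θ k ^ (p k ^ 2)

/-- The first partial derivatives of the weighted polynomial. -/
noncomputable def polyGrad (θ : ℕ → ℝ) (m q : ℕ) (i : Fin m) (w : Fin m → ℝ) : ℝ :=
  q * nestedSum (shiftCoeff m (i + 1) (weightCoeff θ m)) m w (q - 1)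

/-- The second partial derivatives of the weighted polynomial. -/
noncomputable def polyHess (θ : ℕ → ℝ) (m q : ℕ) (i k : Fin m) (w : Fin m → ℝ) : ℝ :=
  q * (((q - 1 : ℕ) : ℝ) *
    nestedSum (shiftCoeff m (k + 1) (shiftCoeff m (i + 1) (weightCoeff θ m))) m w (q - 1 - 1))

lemma weightedPoly_eq_nestedSum (θ : ℕ → ℝ) (j : ℕ) (w : Fin (j + 1) → ℝ) (q : ℕ) :
    weightedPoly θ (j + 1) w q = nestedSum (weightCoeff θ (j + 1)) (j + 1) w q := by
  induction j generalizing q with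
  | zero => simp [weightedPoly, nestedSum, weightCoeff]
  | succ j ih =>
    rw [weightedPoly, nestedSum]
    refine Finset.sum_congr rfl fun s _ => ?_
    have : (fun p => weightCoeff θ (j + 1 + 1) (Function.update p (j + 1) s)) =
        fun p => θ (j + 1) ^ (s ^ 2) * weightCoeff θ (j + 1) p := by
      ext p
      rw [weightCoeff, Finset.prod_Ico_succ_top (by omega), mul_comm, weightCoeff]
      congr 1
      · simp
      · refine Finset.prod_congr rfl fun k hk => ?_
        rw [Finset.mem_Ico] at hk
        rw [Function.update_of_ne (by omega)]
    rw [ih, this, nestedSum_const_mul]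
    ring

lemma hasFDerivAt_weightedPoly (θ : ℕ → ℝ) (j q : ℕ) (w : Fin (j + 1) → ℝ) :
    HasFDerivAt (fun w => weightedPoly θ (j + 1) w q)
      (∑ i, polyGrad θ (j + 1) q i w •
        (ContinuousLinearMap.proj i : (Fin (j + 1) → ℝ) →L[ℝ] ℝ)) w := by
  simp only [weightedPoly_eq_nestedSum]
  exact hasFDerivAt_nestedSum _ _ _ _

lemma hasFDerivAt_polyGrad (θ : ℕ → ℝ) (j q : ℕ) (i : Fin (j + 1)) (w : Fin (j + 1) → ℝ) :
    HasFDerivAt (polyGrad θ (j + 1) q i)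
      (∑ k, polyHess θ (j + 1) q i k w •
        (ContinuousLinearMap.proj k : (Fin (j + 1) → ℝ) →L[ℝ] ℝ)) w := by
  refine ((hasFDerivAt_nestedSum (shiftCoeff (j + 1) (i + 1) (weightCoeff θ (j + 1))) j w
    (q - 1)).const_mul (q : ℝ)).congr_fderiv ?_
  simp only [Finset.smul_sum, smul_smul, polyHess]

lemma continuous_nestedSum (c : (ℕ → ℕ) → ℝ) (j q : ℕ) :
    Continuous fun w => nestedSum c (j + 1) w q :=
  continuous_iff_continuousAt.2 fun w => (hasFDerivAt_nestedSum c j w q).continuousAt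

lemma continuous_polyHess (θ : ℕ → ℝ) (j q : ℕ) (i k : Fin (j + 1)) :
    Continuous (polyHess θ (j + 1) q i k) :=
  ((continuous_nestedSum _ _ _).const_mul _).const_mul _

variable {θ : ℕ → ℝ} {j : ℕ}

lemma weightCoeff_pos (hθ : ∀ k ∈ Finset.Ico 1 (j + 1), 0 < θ k) (p : ℕ → ℕ) :
    0 < weightCoeff θ (j + 1) p :=
  Finset.prod_pos fun k hk => pow_pos (hθ k hk) _

lemma polyGrad_nonneg (hθ : ∀ k ∈ Finset.Ico 1 (j + 1), 0 < θ k) (q : ℕ) (i : Fin (j + 1))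
    {w : Fin (j + 1) → ℝ} (hw : ∀ i, 0 ≤ w i) : 0 ≤ polyGrad θ (j + 1) q i w :=
  mul_nonneg (Nat.cast_nonneg _)
    (nestedSum_nonneg j hw _ fun _ _ => (weightCoeff_pos hθ _).le)

/-- `(p + 1) ^ 2 = p ^ 2 + (2 p + 1)`. The quotient of the two coefficients supplies the entries
`d_ℓ` of the vector `S` for the reaction term. -/
lemma shiftCoeff_weightCoeff {m ℓ : ℕ} (hℓ : 1 ≤ ℓ) (hm : ℓ ≤ m) (p : ℕ → ℕ) :
    shiftCoeff m ℓ (weightCoeff θ m) p =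
      weightCoeff θ m p * ∏ k ∈ Finset.Ico ℓ m, θ k ^ (2 * p k + 1) := by
  rw [shiftCoeff, weightCoeff, weightCoeff, ← Finset.prod_Ico_consecutive _ hℓ hm,
    ← Finset.prod_Ico_consecutive _ hℓ hm, mul_assoc, ← Finset.prod_mul_distrib]
  congr 1
  · refine Finset.prod_congr rfl fun k hk => ?_
    rw [Finset.mem_Ico] at hk
    rw [if_neg (by omega)]
  · refine Finset.prod_congr rfl fun k hk => ?_
    rw [Finset.mem_Ico] at hk
    rw [if_pos (by omega), ← pow_add]
    congr 1
    ring

lemma entry_symm (m : ℕ) (lam θ : ℕ → ℝ) (p : ℕ → ℕ) (i k : ℕ) :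
    entry m lam θ p i k = entry m lam θ p k i := by
  simp only [entry, min_comm i k, max_comm i k, add_comm (lam i)]

/-- This identifies `a_{ℓκ}` as the coefficient of the Hessian of `H` at index `p`, times the
symmetrized diffusion coefficient. -/
lemma entry_eq_shiftCoeff {m i k : ℕ} (lam : ℕ → ℝ) (p : ℕ → ℕ) (hi : 1 ≤ i) (hk : 1 ≤ k)
    (him : i ≤ m) (hkm : k ≤ m) :
    entry m lam θ p i k =
      (lam i + lam k) / 2 * shiftCoeff m k (shiftCoeff m i (weightCoeff θ m)) p := by
  rw [entry, shiftCoeff, shiftCoeff, weightCoeff,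
    ← Finset.prod_Ico_consecutive _ (show 1 ≤ min i k by omega) (show min i k ≤ m by omega),
    ← Finset.prod_Ico_consecutive _ (show min i k ≤ max i k by omega) (show max i k ≤ m by omega),
    mul_assoc (∏ k ∈ Finset.Ico 1 (min i k), θ k ^ (p k ^ 2))]
  congr 2
  · refine Finset.prod_congr rfl fun l hl => ?_
    rw [Finset.mem_Ico] at hl
    rw [if_neg (by omega), if_neg (by omega)]
  · congr 1
    · refine Finset.prod_congr rfl fun l hl => ?_
      rw [Finset.mem_Ico] at hl
      congr 2
      split_ifs <;> omega
    · refine Finset.prod_congr rfl fun l hl => ?_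
      rw [Finset.mem_Ico] at hl
      rw [if_pos (by omega), if_pos (by omega)]

/-- The diffusion part of the derivative of the Lyapunov functional has a sign. -/
lemma polyHess_form_nonneg {pm : ℕ} {lam : ℕ → ℝ} (hj : 1 ≤ j)
    (hform : ∀ p : ℕ → ℕ, (∀ k ∈ Finset.Ico 1 j, p k ≤ p (k + 1)) → p j + 2 ≤ pm →
      ∀ x : Fin (j + 1) → ℝ, 0 ≤ ∑ i : Fin (j + 1), ∑ k : Fin (j + 1),
        entry (j + 1) lam θ p ((i : ℕ) + 1) ((k : ℕ) + 1) * (x i * x k))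
    {w : Fin (j + 1) → ℝ} (hw : ∀ i, 0 ≤ w i) (x : Fin (j + 1) → ℝ) :
    0 ≤ ∑ i : Fin (j + 1), ∑ k : Fin (j + 1),
      lam (i + 1) * polyHess θ (j + 1) pm i k w * (x i * x k) := by
  -- For degree less than two the Hessian vanishes through its factor `pm - 1`.
  rcases lt_or_ge pm 2 with h | h
  · have : pm - 1 = 0 := by omega
    simp [polyHess, this]
  obtain ⟨s, rfl⟩ := Nat.exists_eq_add_of_le' h
  let c : Fin (j + 1) → Fin (j + 1) → (ℕ → ℕ) → ℝ := fun i k =>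
    shiftCoeff (j + 1) (k + 1) (shiftCoeff (j + 1) (i + 1) (weightCoeff θ (j + 1)))
  have key : 0 ≤ nestedSum (fun p => ∑ ik ∈ (Finset.univ : Finset (Fin (j + 1))) ×ˢ
      (Finset.univ : Finset (Fin (j + 1))),
      (lam (ik.1 + 1) * (x ik.1 * x ik.2)) * c ik.1 ik.2 p) (j + 1) w s := by
    refine nestedSum_nonneg j hw s fun p hp => ?_
    have h0 := hform p hp.1 (by have := hp.2 hj; omega) x
    have hsymm : ∀ i k, c i k p = c k i p := by
      intro i k
      simp only [c, shiftCoeff]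
      congr 1
      ext l
      split_ifs <;> rfl
    rw [Finset.sum_product]
    simp only [entry_eq_shiftCoeff (θ := θ) lam p (Nat.le_add_left 1 _) (Nat.le_add_left 1 _)
      (Nat.succ_le_of_lt (Fin.is_lt _)) (Nat.succ_le_of_lt (Fin.is_lt _))] at h0
    -- The Hessian coefficients are symmetric, so replacing `λ_i` by `(λ_i + λ_k) / 2` does not
    -- change the form.
    have h1 : ∑ i : Fin (j + 1), ∑ k : Fin (j + 1), lam (i + 1) * (x i * x k) * c i k p =
        ∑ i : Fin (j + 1), ∑ k : Fin (j + 1), lam (k + 1) * (x i * x k) * c i k p := by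
      rw [Finset.sum_comm]
      refine Finset.sum_congr rfl fun i _ => Finset.sum_congr rfl fun k _ => ?_
      rw [hsymm, mul_comm (x k)]
    have h2 : ∑ i : Fin (j + 1), ∑ k : Fin (j + 1), (lam (i + 1) + lam (k + 1)) / 2 * c i k p *
        (x i * x k) = (∑ i : Fin (j + 1), ∑ k : Fin (j + 1), lam (i + 1) * (x i * x k) * c i k p +
        ∑ i : Fin (j + 1), ∑ k : Fin (j + 1), lam (k + 1) * (x i * x k) * c i k p) / 2 := by
      simp only [← Finset.sum_add_distrib, Finset.sum_div]
      refine Finset.sum_congr rfl fun i _ => Finset.sum_congr rfl fun k _ => ?_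
      ring
    change 0 ≤ ∑ i : Fin (j + 1), ∑ k : Fin (j + 1), (lam (i + 1) + lam (k + 1)) / 2 * c i k p *
        (x i * x k) at h0
    rw [h2, ← h1, add_self_div_two] at h0
    exact h0
  rw [nestedSum_sum, Finset.sum_product] at key
  have : ∑ i : Fin (j + 1), ∑ k : Fin (j + 1),
      lam (i + 1) * polyHess θ (j + 1) (s + 2) i k w * (x i * x k) =
      ((s + 2 : ℕ) : ℝ) * ((s + 1 : ℕ) : ℝ) * ∑ i : Fin (j + 1), ∑ k : Fin (j + 1),
        (lam (i + 1) * (x i * x k)) * nestedSum (c i k) (j + 1) w s := by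
    simp only [Finset.mul_sum]
    refine Finset.sum_congr rfl fun i _ => Finset.sum_congr rfl fun k _ => ?_
    simp only [polyHess, c, show s + 2 - 1 = s + 1 by omega, show s + 1 - 1 = s by omega]
    ring
  rw [this]
  positivity

/-- Positive semidefiniteness of the matrix `a_{ℓκ}` forces `θ_ℓ ≥ 1`. -/
lemma one_le_weight {lam : ℕ → ℝ} (hθ : ∀ k ∈ Finset.Ico 1 (j + 1), 0 < θ k)
    (hlam : ∀ k ∈ Finset.Icc 1 (j + 1), 0 < lam k)
    (hform : ∀ x : Fin (j + 1) → ℝ, 0 ≤ ∑ i : Fin (j + 1), ∑ k : Fin (j + 1),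
        entry (j + 1) lam θ 0 ((i : ℕ) + 1) ((k : ℕ) + 1) * (x i * x k))
    {ℓ : ℕ} (hℓ : ℓ ∈ Finset.Ico 1 (j + 1)) : 1 ≤ θ ℓ := by
  have hmem := hℓ
  rw [Finset.mem_Ico] at hℓ
  set P : ℝ := ∏ k ∈ Finset.Ico (ℓ + 1) (j + 1), θ k ^ 4 with hP
  have hPpos : 0 < P := Finset.prod_pos fun k hk => pow_pos (hθ k (by
    rw [Finset.mem_Ico] at hk ⊢; omega)) _
  have e11 : entry (j + 1) lam θ 0 ℓ ℓ = lam ℓ * (θ ℓ ^ 4 * P) := by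
    have : ∏ k ∈ Finset.Ico ℓ (j + 1), θ k ^ 4 = θ ℓ ^ 4 * P := by
      rw [Finset.prod_eq_prod_Ico_succ_bot hℓ.2]
    simp [entry, this]
  have e22 : entry (j + 1) lam θ 0 (ℓ + 1) (ℓ + 1) = lam (ℓ + 1) * P := by
    simp [entry, hP]
  have e12 : entry (j + 1) lam θ 0 ℓ (ℓ + 1) = (lam ℓ + lam (ℓ + 1)) / 2 * (θ ℓ * P) := by
    simp [entry, hP]
  have hl1 := hlam ℓ (by simp; omega)
  have hl2 := hlam (ℓ + 1) (by simp; omega)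
  have hθℓ := hθ ℓ hmem
  -- The form is tested on vectors supported at the two neighbouring indices `ℓ` and `ℓ + 1`.
  have hquad : ∀ s t : ℝ, 0 ≤ entry (j + 1) lam θ 0 ℓ ℓ * s ^ 2 +
      2 * entry (j + 1) lam θ 0 ℓ (ℓ + 1) * (s * t) +
      entry (j + 1) lam θ 0 (ℓ + 1) (ℓ + 1) * t ^ 2 := by
    intro s t
    let i₀ : Fin (j + 1) := ⟨ℓ - 1, by omega⟩
    let i₁ : Fin (j + 1) := ⟨ℓ, hℓ.2⟩
    have hne : i₀ ≠ i₁ := by simp [i₀, i₁]; omega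
    have h := hform (Pi.single i₀ s + Pi.single i₁ t)
    have hsum : ∀ f : Fin (j + 1) → ℝ,
        ∑ i, f i * (Pi.single i₀ s + Pi.single i₁ t : Fin (j + 1) → ℝ) i = f i₀ * s + f i₁ * t := by
      intro f
      simp [mul_add, Finset.sum_add_distrib, Pi.single_apply]
    have hre : ∀ x : Fin (j + 1) → ℝ, ∑ i : Fin (j + 1), ∑ k : Fin (j + 1),
        entry (j + 1) lam θ 0 ((i : ℕ) + 1) ((k : ℕ) + 1) * (x i * x k) =
        ∑ i : Fin (j + 1), (∑ k : Fin (j + 1),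
        entry (j + 1) lam θ 0 ((i : ℕ) + 1) ((k : ℕ) + 1) * x k) * x i := by
      intro x
      refine Finset.sum_congr rfl fun i _ => ?_
      rw [Finset.sum_mul]
      exact Finset.sum_congr rfl fun k _ => by ring
    rw [hre, hsum, hsum, hsum] at h
    simp only [i₀, i₁, Nat.sub_add_cancel hℓ.1, entry_symm _ _ _ _ (ℓ + 1) ℓ] at h
    linarith
  -- This choice of `(s, t)` gives `a_{ℓℓ}` times the `2 × 2` principal minor.
  have h1 := hquad (entry (j + 1) lam θ 0 ℓ (ℓ + 1)) (-entry (j + 1) lam θ 0 ℓ ℓ)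
  have hapos : 0 < entry (j + 1) lam θ 0 ℓ ℓ := by rw [e11]; positivity
  have h2 : entry (j + 1) lam θ 0 ℓ (ℓ + 1) ^ 2 ≤
      entry (j + 1) lam θ 0 ℓ ℓ * entry (j + 1) lam θ 0 (ℓ + 1) (ℓ + 1) := by
    by_contra hcon
    push Not at hcon
    nlinarith
  rw [e11, e12, e22] at h2
  -- `((λ + λ') / 2) ^ 2 ≥ λ λ'`, so the minor can be nonnegative only if `θ_ℓ ^ 2 ≥ 1`.
  have h3 : lam ℓ * lam (ℓ + 1) * (θ ℓ * P) ^ 2 ≤ lam ℓ * lam (ℓ + 1) * (θ ℓ * P) ^ 2 * θ ℓ ^ 2 := by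
    have : 0 ≤ (lam ℓ - lam (ℓ + 1)) ^ 2 * (θ ℓ * P) ^ 2 := by positivity
    nlinarith
  have h4 : 1 ≤ θ ℓ ^ 2 := by
    have hpos : 0 < lam ℓ * lam (ℓ + 1) * (θ ℓ * P) ^ 2 := by positivity
    exact le_of_mul_le_mul_left (by simpa using h3) hpos
  nlinarith

lemma exists_le_weightedPoly (hθ : ∀ k ∈ Finset.Ico 1 (j + 1), 0 < θ k) (q : ℕ) :
    ∃ b : ℝ, 0 < b ∧ ∀ w : Fin (j + 1) → ℝ, (∀ i, 0 ≤ w i) →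
      b * (∑ i, w i) ^ q ≤ weightedPoly θ (j + 1) w q := by
  simp only [weightedPoly_eq_nestedSum]
  exact exists_le_nestedSum (weightCoeff_pos hθ) j q

lemma exists_weightedPoly_le (θ : ℕ → ℝ) (j q : ℕ) :
    ∃ B : ℝ, 0 ≤ B ∧ ∀ w : Fin (j + 1) → ℝ, (∀ i, 0 ≤ w i) →
      weightedPoly θ (j + 1) w q ≤ B * (∑ i, w i) ^ q := by
  simp only [weightedPoly_eq_nestedSum]
  exact exists_nestedSum_le _ j q

lemma weightedPoly_nonneg (hθ : ∀ k ∈ Finset.Ico 1 (j + 1), 0 < θ k) (q : ℕ)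
    {w : Fin (j + 1) → ℝ} (hw : ∀ i, 0 ≤ w i) : 0 ≤ weightedPoly θ (j + 1) w q := by
  rw [weightedPoly_eq_nestedSum]
  exact nestedSum_nonneg j hw q fun p _ => (weightCoeff_pos hθ p).le

/-- The reaction part of the derivative of the Lyapunov functional is controlled by the
functional itself. -/
lemma exists_reaction_bound {F : (Fin (j + 1) → ℝ) → Fin (j + 1) → ℝ} {dbar : ℕ → ℝ}
    (hS : OneSidedBound F dbar) (hθ : ∀ k ∈ Finset.Ico 1 (j + 1), 0 < θ k)
    (hθd : ∀ ℓ ∈ Finset.Ico 1 (j + 1), dbar ℓ ≤ ∏ k ∈ Finset.Ico ℓ (j + 1), θ k)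
    {pm : ℕ} (hpm : 1 ≤ pm) (hone : 2 ≤ pm → ∀ k ∈ Finset.Ico 1 (j + 1), 1 ≤ θ k) :
    ∃ K : ℝ, 0 ≤ K ∧ ∀ w : Fin (j + 1) → ℝ, (∀ i, 0 ≤ w i) →
      ∑ i, polyGrad θ (j + 1) pm i w * F w i ≤ K * (1 + weightedPoly θ (j + 1) w pm) := by
  classical
  let d : (ℕ → ℕ) → ℕ → ℝ := fun p ℓ => ∏ k ∈ Finset.Ico ℓ (j + 1), θ k ^ (2 * p k + 1)
  have hd : ∀ p, AdmissibleIndex j (pm - 1) p → ∀ ℓ ∈ Finset.Ico 1 (j + 1), dbar ℓ ≤ d p ℓ := by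
    intro p hp ℓ hℓ
    refine (hθd ℓ hℓ).trans ?_
    rw [Finset.mem_Ico] at hℓ
    -- If `pm = 1`, admissibility forces `p = 0` and `d_ℓ` is exactly `∏ θ_k`. Otherwise `θ_k ≥ 1`
    -- and the odd powers only increase the product.
    rcases lt_or_ge pm 2 with h | h
    · have hp0 : ∀ i, ∀ k, k + i = j → 1 ≤ k → p k = 0 := by
        intro i
        induction i with
        | zero =>
          intro k hk hk1
          have := hp.2 (by omega)
          rw [add_zero] at hk
          subst hk
          omega
        | succ i ih =>
          intro k hk hk1
          have := ih (k + 1) (by omega) (by omega)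
          have := hp.1 k (by rw [Finset.mem_Ico]; omega)
          omega
      refine (Finset.prod_congr rfl fun k hk => ?_).le
      rw [Finset.mem_Ico] at hk
      rw [hp0 (j - k) k (by omega) (by omega)]
      simp
    · refine Finset.prod_le_prod (fun k hk => (hθ k ?_).le) fun k hk => ?_
      · rw [Finset.mem_Ico] at hk ⊢; omega
      · exact le_self_pow₀ (hone h k (by rw [Finset.mem_Ico] at hk ⊢; omega)) (by omega)
  -- The vector `S`, and with it the constant of the one-sided bound, depends on `p`; `C p`
  -- therefore becomes part of the coefficient of a nested sum.
  have hC : ∀ p, ∃ C : ℝ, AdmissibleIndex j (pm - 1) p → ∀ W : Fin (j + 1) → ℝ, (∀ i, 0 ≤ W i) →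
      ∑ i, Svec (j + 1) (d p) i * F W i ≤ C * (1 + ∑ i, W i) := by
    intro p
    by_cases hp : AdmissibleIndex j (pm - 1) p
    · obtain ⟨C, -, hC⟩ := hS (d p) (hd p hp)
      exact ⟨C, fun _ => hC⟩
    · exact ⟨0, fun h => absurd h hp⟩
  choose C hC using hC
  obtain ⟨B, hB0, hB⟩ :=
    exists_nestedSum_le (fun p => weightCoeff θ (j + 1) p * C p) j (pm - 1)
  obtain ⟨b, hb0, hb⟩ := exists_le_weightedPoly hθ pm
  refine ⟨pm * B * (1 + 2 / b), by positivity, fun w hw => ?_⟩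
  set r := ∑ i, w i with hr
  have hr0 : 0 ≤ r := Finset.sum_nonneg fun i _ => hw i
  have h1 : ∑ i, polyGrad θ (j + 1) pm i w * F w i = pm * nestedSum (fun p => ∑ i : Fin (j + 1),
      F w i * shiftCoeff (j + 1) (i + 1) (weightCoeff θ (j + 1)) p) (j + 1) w (pm - 1) := by
    rw [nestedSum_sum, Finset.mul_sum]
    refine Finset.sum_congr rfl fun i _ => ?_
    rw [polyGrad]
    ring
  have h2 : nestedSum (fun p => ∑ i : Fin (j + 1),
      F w i * shiftCoeff (j + 1) (i + 1) (weightCoeff θ (j + 1)) p) (j + 1) w (pm - 1) ≤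
      nestedSum (fun p => (1 + r) * (weightCoeff θ (j + 1) p * C p)) (j + 1) w (pm - 1) := by
    refine nestedSum_mono j hw _ fun p hp => ?_
    have : ∑ i : Fin (j + 1), F w i * shiftCoeff (j + 1) (i + 1) (weightCoeff θ (j + 1)) p =
        weightCoeff θ (j + 1) p * ∑ i, Svec (j + 1) (d p) i * F w i := by
      rw [Finset.mul_sum]
      refine Finset.sum_congr rfl fun i _ => ?_
      rw [shiftCoeff_weightCoeff (by omega) (by omega)]
      have : Svec (j + 1) (d p) i = d p (i + 1) := by
        rw [Svec]
        split_ifs with h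
        · rfl
        -- For the last component the product defining `d p (j + 1)` is empty, which is the entry
        -- `1` of `S`.
        · have : (i : ℕ) = j := by omega
          simp [d, this]
      rw [this]
      ring
    rw [this]
    have := mul_le_mul_of_nonneg_left (hC p hp w hw) (weightCoeff_pos hθ p).le
    rw [← hr] at this
    linarith
  rw [nestedSum_const_mul] at h2
  have h3 := hB w hw
  rw [← hr] at h3
  have h4 : r ^ (pm - 1) ≤ 1 + r ^ pm := by
    rcases le_total r 1 with h | h
    · have := pow_le_one₀ (n := pm - 1) hr0 h
      have := pow_nonneg hr0 pm
      linarith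
    · have := pow_le_pow_right₀ h (show pm - 1 ≤ pm by omega)
      linarith
  have h5 : r ^ (pm - 1) * (1 + r) ≤ 1 + 2 * r ^ pm := by
    have : r ^ (pm - 1) * r = r ^ pm := by
      rw [← pow_succ]; congr 1; omega
    linarith
  have h6 : r ^ pm ≤ weightedPoly θ (j + 1) w pm / b := by
    rw [le_div_iff₀ hb0]
    linarith [hb w hw]
  have hH := weightedPoly_nonneg hθ pm hw
  calc _ ≤ (pm : ℝ) * ((1 + r) * (B * r ^ (pm - 1))) := by
        rw [h1]
        exact mul_le_mul_of_nonneg_left (h2.trans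
          (mul_le_mul_of_nonneg_left h3 (by linarith))) (Nat.cast_nonneg _)
    _ = pm * B * (r ^ (pm - 1) * (1 + r)) := by ring
    _ ≤ pm * B * (1 + 2 * (weightedPoly θ (j + 1) w pm / b)) := by
        refine mul_le_mul_of_nonneg_left (by linarith) (by positivity)
    _ ≤ pm * B * ((1 + 2 / b) * (1 + weightedPoly θ (j + 1) w pm)) := by
        refine mul_le_mul_of_nonneg_left ?_ (by positivity)
        have e : 2 * (weightedPoly θ (j + 1) w pm / b) = 2 / b * weightedPoly θ (j + 1) w pm := by
          ring
        have : 0 ≤ 2 / b := by positivity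
        rw [e]
        nlinarith
    _ = _ := by ring

/-- The boundary term of Robin type is bounded from above. -/
lemma exists_robin_bound (hθ : ∀ k ∈ Finset.Ico 1 (j + 1), 0 < θ k) {pm : ℕ} (hpm : 1 ≤ pm)
    {α : ℝ} (hα : 0 < α) {β : Fin (j + 1) → ℝ} (hβ : ∀ i, 0 < β i) (Λ : Fin (j + 1) → ℝ) :
    ∃ B : ℝ, 0 ≤ B ∧ ∀ w : Fin (j + 1) → ℝ, (∀ i, 0 ≤ w i) →
      ∑ i, β i * polyGrad θ (j + 1) pm i w * (Λ i - α * w i) ≤ B := by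
  have hpm' : (0 : ℝ) < pm := by exact_mod_cast hpm
  choose B hB0 hB using fun i : Fin (j + 1) =>
    exists_nestedSum_le (shiftCoeff (j + 1) (i + 1) (weightCoeff θ (j + 1))) j (pm - 1)
  choose b hb0 hb using fun i : Fin (j + 1) =>
    exists_le_nestedSum (c := shiftCoeff (j + 1) (i + 1) (weightCoeff θ (j + 1)))
      (fun p => weightCoeff_pos hθ _) j (pm - 1)
  obtain ⟨i₀, -, hi₀⟩ := Finset.exists_min_image (Finset.univ : Finset (Fin (j + 1)))
    (fun i => β i * (pm * b i) * α) (by simp)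
  set b₀ := β i₀ * (pm * b i₀) * α with hb₀
  have hb₀pos : 0 < b₀ := by have := hβ i₀; have := hb0 i₀; positivity
  set M := ∑ i, β i * (pm * B i) * |Λ i| with hM
  have hM0 : 0 ≤ M := Finset.sum_nonneg fun i _ => by
    have := hβ i; have := hB0 i; positivity
  -- The sum is at most `r ^ (pm - 1) * (M - b₀ * r)`, which is positive only if `r < M / b₀`.
  refine ⟨M * (M / b₀) ^ (pm - 1), by positivity, fun w hw => ?_⟩
  set r := ∑ i, w i with hr
  have hr0 : 0 ≤ r := Finset.sum_nonneg fun i _ => hw i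
  have h1 : ∑ i, β i * polyGrad θ (j + 1) pm i w * (Λ i - α * w i) ≤
      r ^ (pm - 1) * (M - b₀ * r) := by
    rw [hM, hr, mul_sub, ← hr, Finset.mul_sum, hr, Finset.mul_sum, Finset.mul_sum, ← hr,
      ← Finset.sum_sub_distrib]
    refine Finset.sum_le_sum fun i _ => ?_
    have hg0 := polyGrad_nonneg hθ pm i hw
    have hg1 : polyGrad θ (j + 1) pm i w ≤ pm * (B i * r ^ (pm - 1)) :=
      mul_le_mul_of_nonneg_left (hB i w hw) hpm'.le
    have hg2 : pm * (b i * r ^ (pm - 1)) ≤ polyGrad θ (j + 1) pm i w :=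
      mul_le_mul_of_nonneg_left (hb i w hw) hpm'.le
    have e1 : β i * polyGrad θ (j + 1) pm i w * Λ i ≤
        r ^ (pm - 1) * (β i * (pm * B i) * |Λ i|) := by
      calc _ ≤ β i * polyGrad θ (j + 1) pm i w * |Λ i| :=
            mul_le_mul_of_nonneg_left (le_abs_self _) (mul_nonneg (hβ i).le hg0)
        _ ≤ β i * (pm * (B i * r ^ (pm - 1))) * |Λ i| :=
            mul_le_mul_of_nonneg_right (mul_le_mul_of_nonneg_left hg1 (hβ i).le) (abs_nonneg _)
        _ = _ := by ring
    have e2 : r ^ (pm - 1) * (b₀ * w i) ≤ β i * polyGrad θ (j + 1) pm i w * (α * w i) := by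
      calc _ ≤ r ^ (pm - 1) * ((β i * (pm * b i) * α) * w i) :=
            mul_le_mul_of_nonneg_left (mul_le_mul_of_nonneg_right (hi₀ i (Finset.mem_univ i))
              (hw i)) (pow_nonneg hr0 _)
        _ = β i * (pm * (b i * r ^ (pm - 1))) * (α * w i) := by ring
        _ ≤ _ := mul_le_mul_of_nonneg_right (mul_le_mul_of_nonneg_left hg2 (hβ i).le)
            (mul_nonneg hα.le (hw i))
    rw [mul_sub]
    linarith
  refine h1.trans ?_
  rcases le_total M (b₀ * r) with h | h
  · exact (mul_nonpos_of_nonneg_of_nonpos (pow_nonneg hr0 _) (by linarith)).trans (by positivity)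
  · have h2 : r ≤ M / b₀ := by rw [le_div_iff₀ hb₀pos]; linarith
    calc _ ≤ (M / b₀) ^ (pm - 1) * M :=
          mul_le_mul (pow_le_pow_left₀ hr0 h2 _) (by nlinarith) (by linarith) (by positivity)
      _ = _ := mul_comm _ _

/-- The smallest cosine is `-cos (π / (m + 1))`, and `2 √(bc) ≤ b + c`; the condition on `a / (b +
c)` makes up for both. -/
lemma eigenvalue_pos {a b c : ℝ} {m ℓ : ℕ} (hb : 0 < b) (hc : 0 < c) (hm : 1 ≤ m)
    (hpar : Real.cos (Real.pi / ((m : ℝ) + 1)) < a / (b + c)) (h1 : 1 ≤ ℓ) (h2 : ℓ ≤ m) :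
    0 < eigenvalue a b c m ℓ := by
  have hm' : (1 : ℝ) ≤ m := by exact_mod_cast hm
  have h1' : (1 : ℝ) ≤ ℓ := by exact_mod_cast h1
  have h2' : (ℓ : ℝ) ≤ m := by exact_mod_cast h2
  have hpi := Real.pi_pos
  have hmp : (0 : ℝ) < m + 1 := by linarith
  set x := Real.pi / ((m : ℝ) + 1) with hx
  have hx0 : 0 < x := by positivity
  have hx1 : x ≤ Real.pi / 2 := by
    rw [hx]; exact div_le_div_of_nonneg_left hpi.le (by norm_num) (by linarith)
  have hcos0 : 0 ≤ Real.cos x := Real.cos_nonneg_of_neg_pi_div_two_le_of_le (by linarith) hx1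
  have hcos : -Real.cos x ≤
      Real.cos (((m : ℝ) + 1 - (ℓ : ℝ)) * Real.pi / ((m : ℝ) + 1)) := by
    rw [← Real.cos_pi_sub]
    have e : ((m : ℝ) + 1 - (ℓ : ℝ)) * Real.pi / ((m : ℝ) + 1) = Real.pi - ℓ * x := by
      rw [hx]; field_simp
    have hℓx : (ℓ : ℝ) * x ≤ Real.pi := by
      rw [hx, mul_div_assoc', div_le_iff₀ hmp]; nlinarith
    rw [e]
    exact Real.cos_le_cos_of_nonneg_of_le_pi (by linarith) (by linarith) (by nlinarith)
  have hs0 := Real.sqrt_nonneg (b * c)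
  have hs : 2 * Real.sqrt (b * c) ≤ b + c := by
    have hsq := Real.sq_sqrt (show 0 ≤ b * c by positivity)
    nlinarith [sq_nonneg (b - c)]
  have hpar' : Real.cos x * (b + c) < a := by rwa [lt_div_iff₀ (by linarith)] at hpar
  rw [eigenvalue]
  nlinarith [mul_le_mul_of_nonneg_left hcos (show 0 ≤ 2 * Real.sqrt (b * c) by linarith),
    mul_le_mul_of_nonneg_right hs hcos0]

end WeightedPolynomial

/-! ### Extension by zero and cut-off functions -/

section Cutoff

lemma continuous_of_tsupport_subset {X : Type*} [TopologicalSpace X] {U : Set X} {f : X → ℝ}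
    (hU : IsOpen U) (hf : ContinuousOn f U) (hs : tsupport f ⊆ U) : Continuous f := by
  rw [continuous_iff_continuousAt]
  intro x
  by_cases hx : x ∈ U
  · exact hf.continuousAt (hU.mem_nhds hx)
  · have : f =ᶠ[𝓝 x] fun _ => 0 := notMem_tsupport_iff_eventuallyEq.1 fun h => hx (hs h)
    exact continuousAt_const.congr this.symm

variable {E : Type*} [NormedAddCommGroup E] [NormedSpace ℝ E]

lemma contDiff_of_tsupport_subset {U : Set E} {f : E → ℝ}
    (hU : IsOpen U) (hf : ContDiffOn ℝ 1 f U) (hs : tsupport f ⊆ U) : ContDiff ℝ 1 f := by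
  rw [contDiff_iff_contDiffAt]
  intro x
  by_cases hx : x ∈ U
  · exact hf.contDiffAt (hU.mem_nhds hx)
  · have : f =ᶠ[𝓝 x] fun _ => 0 := notMem_tsupport_iff_eventuallyEq.1 fun h => hx (hs h)
    exact contDiffAt_const.congr_of_eventuallyEq this

lemma tsupport_mul_subset_of_left {X : Type*} [TopologicalSpace X] {U : Set X} {f : X → ℝ}
    (g : X → ℝ) (hf : tsupport f ⊆ U) : tsupport (fun x => f x * g x) ⊆ U :=
  (closure_mono (Function.support_mul_subset_left f g)).trans hf

lemma integral_fderiv_eq_zero [FiniteDimensional ℝ E] [MeasurableSpace E] [BorelSpace E]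
    (μ : Measure E) [μ.IsAddHaarMeasure] {g : E → ℝ} (hg : ContDiff ℝ 1 g)
    (hs : HasCompactSupport g) (v : E) : ∫ x, fderiv ℝ g x v ∂μ = 0 := by
  have h := integral_mul_fderiv_eq_neg_fderiv_mul_of_integrable (μ := μ)
    (f := fun _ : E => (1 : ℝ)) (g := g) (v := v) (by simp) ?_ ?_
    (fun x _ => differentiableAt_const _) (fun x _ => hg.differentiable one_ne_zero x)
  · simpa using h
  · simp only [one_mul]
    exact ((hg.continuous_fderiv one_ne_zero).clm_apply continuous_const).integrable_of_hasCompactSupport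
      ((hs.fderiv (𝕜 := ℝ)).comp_left (g := fun L : E →L[ℝ] ℝ => L v) (by simp))
  · simpa using hg.continuous.integrable_of_hasCompactSupport hs

end Cutoff

/-! ### Boundary charts and the profile of the boundary layer. -/

section LocalCutoff

variable {n : ℕ}

lemma norm_gradient_eq (ρ : EuclideanSpace ℝ (Fin n) → ℝ) (x : EuclideanSpace ℝ (Fin n)) :
    ‖gradient ρ x‖ = ‖fderiv ℝ ρ x‖ := by
  rw [gradient]; exact LinearIsometryEquiv.norm_map _ _

/-- Near a boundary point, some derivative of a defining function controls its gradient. -/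
lemma exists_transversal_direction {Ω : Set (EuclideanSpace ℝ (Fin n))}
    {x₀ : EuclideanSpace ℝ (Fin n)} {ρ : EuclideanSpace ℝ (Fin n) → ℝ}
    (h : IsC1DefiningAt Ω x₀ ρ) :
    ∃ U : Set (EuclideanSpace ℝ (Fin n)), IsOpen U ∧ x₀ ∈ U ∧ Bornology.IsBounded U ∧
      ContDiffOn ℝ 1 ρ U ∧ (∀ y ∈ U, (y ∈ Ω ↔ ρ y < 0)) ∧ (∀ y ∈ U, gradient ρ y ≠ 0) ∧
      ∃ (e : EuclideanSpace ℝ (Fin n)) (c : ℝ), 0 ≤ c ∧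
        ∀ y ∈ U, ‖fderiv ℝ ρ y‖ ≤ c * fderiv ℝ ρ y e := by
  obtain ⟨U, hU, hxU, hρ, hgrad, hiff⟩ := h
  set e := gradient ρ x₀ with he
  have hcont : ContinuousOn (fderiv ℝ ρ) U := hρ.continuousOn_fderiv_of_isOpen hU le_rfl
  have hcx : ContinuousAt (fderiv ℝ ρ) x₀ := hcont.continuousAt (hU.mem_nhds hxU)
  have he0 : 0 < ‖e‖ := norm_pos_iff.2 hgrad
  have hval : fderiv ℝ ρ x₀ e = ‖e‖ ^ 2 := by
    rw [← inner_gradient_left, ← he, real_inner_self_eq_norm_sq]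
  -- At `x₀` the derivative along `e = ∇ρ(x₀)` is `‖e‖ ^ 2` and the norm of the differential is
  -- `‖e‖`. Losing a factor two in each gives the constant `4 / ‖e‖`.
  have h1 : ∀ᶠ y in 𝓝 x₀, ‖e‖ ^ 2 / 2 < fderiv ℝ ρ y e := by
    refine (hcx.clm_apply continuousAt_const).eventually (lt_mem_nhds ?_)
    change _ < fderiv ℝ ρ x₀ e
    rw [hval]; nlinarith
  have h2 : ∀ᶠ y in 𝓝 x₀, ‖fderiv ℝ ρ y‖ < 2 * ‖e‖ := by
    refine hcx.norm.eventually (gt_mem_nhds ?_)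
    change ‖fderiv ℝ ρ x₀‖ < _
    rw [← norm_gradient_eq]; linarith
  obtain ⟨r, hr0, hr⟩ := Metric.eventually_nhds_iff_ball.1
    ((h1.and h2).and (hU.mem_nhds hxU))
  refine ⟨Metric.ball x₀ r, Metric.isOpen_ball, Metric.mem_ball_self hr0, Metric.isBounded_ball,
    hρ.mono fun y hy => (hr y hy).2, fun y hy => hiff y (hr y hy).2, fun y hy h0 => ?_,
    e, 4 / ‖e‖, by positivity, fun y hy => ?_⟩
  · have := (hr y hy).1.1
    rw [← inner_gradient_left, h0, inner_zero_left] at this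
    nlinarith
  · have ha := (hr y hy).1.1
    have hb := (hr y hy).1.2
    calc ‖fderiv ℝ ρ y‖ ≤ 2 * ‖e‖ := hb.le
      _ = 4 / ‖e‖ * (‖e‖ ^ 2 / 2) := by field_simp; norm_num
      _ ≤ _ := mul_le_mul_of_nonneg_left ha.le (by positivity)

/-- The cut-off profile `x ↦ σ(-k ρ(x) - 1)`, which is `1` where `ρ ≤ -2 / k` and `0` where
`ρ ≥ -1 / k`. -/
noncomputable def layer (ρ : EuclideanSpace ℝ (Fin n) → ℝ) (k : ℕ)
    (x : EuclideanSpace ℝ (Fin n)) : ℝ :=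
  Real.smoothTransition (-(k : ℝ) * ρ x - 1)

/-- The density of the boundary layer of `layer ρ k`. -/
noncomputable def layerDensity (ρ : EuclideanSpace ℝ (Fin n) → ℝ) (k : ℕ)
    (x : EuclideanSpace ℝ (Fin n)) : ℝ :=
  k * deriv Real.smoothTransition (-(k : ℝ) * ρ x - 1)

lemma layerDensity_nonneg (ρ : EuclideanSpace ℝ (Fin n) → ℝ) (k : ℕ)
    (x : EuclideanSpace ℝ (Fin n)) : 0 ≤ layerDensity ρ k x :=
  mul_nonneg (Nat.cast_nonneg _) Real.smoothTransition.monotone.deriv_nonneg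

lemma lt_of_layerDensity_ne_zero {ρ : EuclideanSpace ℝ (Fin n) → ℝ} {k : ℕ}
    {x : EuclideanSpace ℝ (Fin n)} (h : layerDensity ρ k x ≠ 0) : -(2 : ℝ) ≤ k * ρ x := by
  by_contra hcon
  push Not at hcon
  refine h ?_
  rw [layerDensity]
  have : Real.smoothTransition =ᶠ[𝓝 (-(k : ℝ) * ρ x - 1)] fun _ => 1 := by
    filter_upwards [lt_mem_nhds (show 1 < -(k : ℝ) * ρ x - 1 by linarith)] with y hy
    exact Real.smoothTransition.one_of_one_le hy.le
  rw [this.deriv_eq]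
  simp

lemma hasFDerivAt_layer {ρ : EuclideanSpace ℝ (Fin n) → ℝ} {x : EuclideanSpace ℝ (Fin n)}
    (h : DifferentiableAt ℝ ρ x) (k : ℕ) :
    HasFDerivAt (layer ρ k) (-(layerDensity ρ k x) • fderiv ℝ ρ x) x := by
  have h1 : HasDerivAt Real.smoothTransition
      (deriv Real.smoothTransition (-(k : ℝ) * ρ x - 1)) (-(k : ℝ) * ρ x - 1) :=
    ((Real.smoothTransition.contDiff (n := 1)).differentiable (by simp) _).hasDerivAt
  have h2 := h1.comp_hasFDerivAt x ((h.hasFDerivAt.const_mul (-(k : ℝ))).sub_const 1)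
  refine h2.congr_fderiv ?_
  rw [layerDensity, smul_smul]
  congr 1
  ring

lemma contDiffOn_layer {ρ : EuclideanSpace ℝ (Fin n) → ℝ} {U : Set (EuclideanSpace ℝ (Fin n))}
    (hρ : ContDiffOn ℝ 1 ρ U) (k : ℕ) : ContDiffOn ℝ 1 (layer ρ k) U :=
  Real.smoothTransition.contDiff.comp_contDiffOn
    ((contDiffOn_const.mul hρ).sub contDiffOn_const)

lemma continuousOn_layerDensity {ρ : EuclideanSpace ℝ (Fin n) → ℝ}
    {U : Set (EuclideanSpace ℝ (Fin n))} (hρ : ContinuousOn ρ U) (k : ℕ) :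
    ContinuousOn (layerDensity ρ k) U := by
  have h : Continuous (deriv Real.smoothTransition) :=
    (Real.smoothTransition.contDiff (n := 1)).continuous_deriv le_rfl
  exact continuousOn_const.mul
    (h.comp_continuousOn ((continuousOn_const.mul hρ).sub continuousOn_const))

end LocalCutoff

/-! ### Cut-offs approximating the indicator of `Ω`, with control of the normal flux. -/

section BoundaryCutoff

variable {n : ℕ}

/-- The normal component of `V` on the boundary of `Ω` is at most `C`. -/
def NormalComponentLE (Ω : Set (EuclideanSpace ℝ (Fin n))) (K : Set ℝ)
    (V : ℝ × EuclideanSpace ℝ (Fin n) → EuclideanSpace ℝ (Fin n)) (C : ℝ) : Prop :=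
  ∀ τ ∈ K, ∀ x ∈ frontier Ω, ∀ η, IsOutwardUnitNormal Ω x η → inner ℝ (V (τ, x)) η ≤ C

lemma integrableOn_of_continuousOn_closure {Ω : Set (EuclideanSpace ℝ (Fin n))}
    (hb : Bornology.IsBounded Ω) {f : EuclideanSpace ℝ (Fin n) → ℝ}
    (hf : ContinuousOn f (closure Ω)) : IntegrableOn f Ω :=
  (hf.integrableOn_compact hb.isCompact_closure).mono_set subset_closure

/-- Inside the boundary layer of a chart, the normal component of a vector field is almost bounded
by its supremum on the boundary. -/
lemma exists_layer_normal_bound {Ω : Set (EuclideanSpace ℝ (Fin n))}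
    (hb : Bornology.IsBounded Ω) {ρ : EuclideanSpace ℝ (Fin n) → ℝ}
    {U : Set (EuclideanSpace ℝ (Fin n))} (hU : IsOpen U) (hρ : ContDiffOn ℝ 1 ρ U)
    (hiff : ∀ y ∈ U, (y ∈ Ω ↔ ρ y < 0)) (hgrad : ∀ y ∈ U, gradient ρ y ≠ 0)
    {S : Set (EuclideanSpace ℝ (Fin n))} (hS : IsClosed S) (hSU : S ⊆ U)
    {K : Set ℝ} (hK : IsCompact K)
    {V : ℝ × EuclideanSpace ℝ (Fin n) → EuclideanSpace ℝ (Fin n)}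
    (hV : ContinuousOn V (K ×ˢ closure Ω)) {C : ℝ} (hbd : NormalComponentLE Ω K V C)
    {δ : ℝ} (hδ : 0 < δ) :
    ∃ ε : ℝ, 0 < ε ∧ ∀ τ ∈ K, ∀ y ∈ S ∩ closure Ω, -ε < ρ y →
      fderiv ℝ ρ y (V (τ, y)) ≤ (C + δ) * ‖fderiv ℝ ρ y‖ := by
  have hfd : ContinuousOn (fderiv ℝ ρ) U := hρ.continuousOn_fderiv_of_isOpen hU le_rfl
  have hQ : IsCompact (K ×ˢ (S ∩ closure Ω)) := hK.prod (hb.isCompact_closure.inter_left hS)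
  have hsub : ∀ z ∈ K ×ˢ (S ∩ closure Ω), z.2 ∈ U := fun z hz => hSU hz.2.1
  have hfd' : ContinuousOn (fun z : ℝ × EuclideanSpace ℝ (Fin n) => fderiv ℝ ρ z.2)
      (K ×ˢ (S ∩ closure Ω)) := hfd.comp continuousOn_snd hsub
  have hV' : ContinuousOn V (K ×ˢ (S ∩ closure Ω)) :=
    hV.mono (Set.prod_mono le_rfl Set.inter_subset_right)
  let G : ℝ × EuclideanSpace ℝ (Fin n) → ℝ := fun z =>
    fderiv ℝ ρ z.2 (V z) - (C + δ) * ‖fderiv ℝ ρ z.2‖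
  have hG : ContinuousOn G (K ×ˢ (S ∩ closure Ω)) :=
    (hfd'.clm_apply hV').sub (continuousOn_const.mul hfd'.norm)
  -- The points where the desired inequality fails or is an equality form a compact set. It avoids
  -- `∂Ω`, where `∇ρ / ‖∇ρ‖` is the outward normal, so `ρ` has a negative maximum on it, and `ε` is
  -- minus this maximum.
  have hbad : IsCompact ((K ×ˢ (S ∩ closure Ω)) ∩ G ⁻¹' Set.Ici 0) := by
    refine hQ.of_isClosed_subset ?_ Set.inter_subset_left
    exact hG.preimage_isClosed_of_isClosed hQ.isClosed isClosed_Ici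
  have hneg : ∀ z ∈ (K ×ˢ (S ∩ closure Ω)) ∩ G ⁻¹' Set.Ici 0, ρ z.2 < 0 := by
    rintro ⟨τ, y⟩ ⟨⟨hτ, hyS, hyΩ⟩, hz⟩
    rw [← hiff y (hSU hyS)]
    by_contra hy
    have hyf : y ∈ frontier Ω := ⟨hyΩ, fun h => hy (interior_subset h)⟩
    have hdef : IsC1DefiningAt Ω y ρ := ⟨U, hU, hSU hyS, hρ, hgrad y (hSU hyS), hiff⟩
    have h1 := hbd τ hτ y hyf _ ⟨ρ, hdef, rfl⟩
    have hpos : 0 < ‖gradient ρ y‖ := norm_pos_iff.2 (hgrad y (hSU hyS))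
    rw [inner_smul_right, real_inner_comm, inner_gradient_left, inv_mul_le_iff₀ hpos,
      norm_gradient_eq] at h1
    rw [norm_gradient_eq] at hpos
    have h2 : 0 ≤ fderiv ℝ ρ y (V (τ, y)) - (C + δ) * ‖fderiv ℝ ρ y‖ := hz
    nlinarith
  have hρc : ContinuousOn (fun z : ℝ × EuclideanSpace ℝ (Fin n) => ρ z.2)
      ((K ×ˢ (S ∩ closure Ω)) ∩ G ⁻¹' Set.Ici 0) :=
    hρ.continuousOn.comp continuousOn_snd fun z hz => hsub z hz.1
  rcases ((K ×ˢ (S ∩ closure Ω)) ∩ G ⁻¹' Set.Ici 0).eq_empty_or_nonempty with hemp | hne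
  · refine ⟨1, one_pos, fun τ hτ y hy _ => ?_⟩
    by_contra hcon
    push Not at hcon
    have : ((τ, y) : ℝ × EuclideanSpace ℝ (Fin n)) ∈
        (K ×ˢ (S ∩ closure Ω)) ∩ G ⁻¹' Set.Ici 0 := ⟨⟨hτ, hy⟩, sub_nonneg.2 hcon.le⟩
    rw [hemp] at this
    exact this
  · obtain ⟨z₀, hz₀, hmax⟩ := hbad.exists_isMaxOn hne hρc
    refine ⟨-ρ z₀.2, neg_pos.2 (hneg z₀ hz₀), fun τ hτ y hy hlt => ?_⟩
    by_contra hcon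
    push Not at hcon
    have := hmax (show ((τ, y) : ℝ × EuclideanSpace ℝ (Fin n)) ∈
        (K ×ˢ (S ∩ closure Ω)) ∩ G ⁻¹' Set.Ici 0 from ⟨⟨hτ, hy⟩, sub_nonneg.2 hcon.le⟩)
    simp only [Set.mem_ofPred_eq] at this
    linarith

/-- The mass of the boundary layer is bounded uniformly in its thickness. -/
lemma integral_layer_le {ρ χ : EuclideanSpace ℝ (Fin n) → ℝ}
    {U : Set (EuclideanSpace ℝ (Fin n))} (hU : IsOpen U) (hρ : ContDiffOn ℝ 1 ρ U)
    {e : EuclideanSpace ℝ (Fin n)} {c : ℝ} (hc : 0 ≤ c)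
    (he : ∀ y ∈ U, ‖fderiv ℝ ρ y‖ ≤ c * fderiv ℝ ρ y e)
    (hχ : ContDiff ℝ 1 χ) (hχs : tsupport χ ⊆ U) (hχc : HasCompactSupport χ)
    (hχ0 : ∀ y, 0 ≤ χ y) (k : ℕ) :
    Integrable (fun y => χ y * (layerDensity ρ k y * ‖fderiv ℝ ρ y‖)) ∧
    ∫ y, χ y * (layerDensity ρ k y * ‖fderiv ℝ ρ y‖) ≤ c * ∫ y, |fderiv ℝ χ y e| := by
  have hfd : ContinuousOn (fderiv ℝ ρ) U := hρ.continuousOn_fderiv_of_isOpen hU le_rfl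
  have hdens := continuousOn_layerDensity hρ.continuousOn k
  have int_of : ∀ f : EuclideanSpace ℝ (Fin n) → ℝ, ContinuousOn f U →
      Integrable fun y => χ y * f y := fun f hf =>
    (continuous_of_tsupport_subset hU (hχ.continuous.continuousOn.mul hf)
      (tsupport_mul_subset_of_left f hχs)).integrable_of_hasCompactSupport hχc.mul_right
  have hI1 := int_of _ (hdens.mul hfd.norm)
  have hI2 := int_of _ (hdens.mul (hfd.clm_apply continuousOn_const (g := fun _ => e)))
  refine ⟨hI1, ?_⟩
  set g : EuclideanSpace ℝ (Fin n) → ℝ := fun y => χ y * layer ρ k y with hg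
  have hgC : ContDiff ℝ 1 g := contDiff_of_tsupport_subset hU
    (hχ.contDiffOn.mul (contDiffOn_layer hρ k)) (tsupport_mul_subset_of_left _ hχs)
  have hgc : HasCompactSupport g := hχc.mul_right
  have hdχ : Integrable fun y => fderiv ℝ χ y e :=
    ((hχ.continuous_fderiv one_ne_zero).clm_apply continuous_const).integrable_of_hasCompactSupport
      ((hχc.fderiv (𝕜 := ℝ)).comp_left
        (g := fun L : EuclideanSpace ℝ (Fin n) →L[ℝ] ℝ => L e) (by simp))
  have hdg : Integrable fun y => fderiv ℝ g y e :=
    ((hgC.continuous_fderiv one_ne_zero).clm_apply continuous_const).integrable_of_hasCompactSupport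
      ((hgc.fderiv (𝕜 := ℝ)).comp_left
        (g := fun L : EuclideanSpace ℝ (Fin n) →L[ℝ] ℝ => L e) (by simp))
  -- The derivative of `χ * layer` along `e` is `layer * ∂_e χ - χ * density * ∂_e ρ`, and its
  -- integral vanishes. The layer mass is thus bounded by the mass of `∂_e χ`, for every `k`.
  have hpt : ∀ y, χ y * (layerDensity ρ k y * fderiv ℝ ρ y e) ≤
      |fderiv ℝ χ y e| - fderiv ℝ g y e := by
    intro y
    by_cases hy : y ∈ U
    · have hd := (hχ.differentiable one_ne_zero y).hasFDerivAt.mul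
        (hasFDerivAt_layer ((hρ.differentiableOn one_ne_zero).differentiableAt
          (hU.mem_nhds hy)) k)
      rw [show fderiv ℝ g y = _ from hd.fderiv]
      have hl0 : 0 ≤ layer ρ k y := Real.smoothTransition.nonneg _
      have hl1 : layer ρ k y ≤ 1 := Real.smoothTransition.le_one _
      have : layer ρ k y * fderiv ℝ χ y e ≤ |fderiv ℝ χ y e| := by
        calc _ ≤ layer ρ k y * |fderiv ℝ χ y e| := mul_le_mul_of_nonneg_left (le_abs_self _) hl0
          _ ≤ _ := mul_le_of_le_one_left (abs_nonneg _) hl1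
      simp
      linarith
    · have h1 : χ y = 0 := image_eq_zero_of_notMem_tsupport fun h => hy (hχs h)
      have h2 : fderiv ℝ g y = 0 := image_eq_zero_of_notMem_tsupport fun h =>
        hy (tsupport_mul_subset_of_left _ hχs (tsupport_fderiv_subset ℝ h))
      simp [h1, h2]
  calc ∫ y, χ y * (layerDensity ρ k y * ‖fderiv ℝ ρ y‖)
      ≤ ∫ y, c * (χ y * (layerDensity ρ k y * fderiv ℝ ρ y e)) := by
        refine integral_mono hI1 (hI2.const_mul c) fun y => ?_
        by_cases hy : y ∈ U
        · have := mul_le_mul_of_nonneg_left (mul_le_mul_of_nonneg_left (he y hy)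
            (layerDensity_nonneg ρ k y)) (hχ0 y)
          simp only
          linarith
        · have h1 : χ y = 0 := image_eq_zero_of_notMem_tsupport fun h => hy (hχs h)
          simp [h1]
    _ = c * ∫ y, χ y * (layerDensity ρ k y * fderiv ℝ ρ y e) := integral_const_mul _ _
    _ ≤ c * ∫ y, (|fderiv ℝ χ y e| - fderiv ℝ g y e) :=
        mul_le_mul_of_nonneg_left (integral_mono hI2 (hdχ.abs.sub hdg) hpt) hc
    _ = _ := by
        rw [integral_sub hdχ.abs hdg, integral_fderiv_eq_zero volume hgC hgc, sub_zero]

/-- `g k` are cut-offs of `χ` away from the boundary of `Ω`, with constant `P`. -/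
structure IsCutoffSeq (Ω : Set (EuclideanSpace ℝ (Fin n))) (χ : EuclideanSpace ℝ (Fin n) → ℝ)
    (P : ℝ) (g : ℕ → EuclideanSpace ℝ (Fin n) → ℝ) : Prop where
  const_nonneg : 0 ≤ P
  contDiff : ∀ k, ContDiff ℝ 1 (g k)
  tsupport_subset : ∀ k, tsupport (g k) ⊆ Ω
  nonneg : ∀ k x, 0 ≤ g k x
  le : ∀ k x, g k x ≤ χ x
  tendsto : ∀ x ∈ Ω, Tendsto (fun k => g k x) atTop (𝓝 (χ x))
  integral_le : ∀ (K : Set ℝ) (V : ℝ × EuclideanSpace ℝ (Fin n) → EuclideanSpace ℝ (Fin n))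
    (C : ℝ), IsCompact K → ContinuousOn V (K ×ˢ closure Ω) → 0 ≤ C → NormalComponentLE Ω K V C →
    ∀ δ > 0, ∀ᶠ k in atTop, ∀ τ ∈ K,
      ∫ x in Ω, (fderiv ℝ χ x (V (τ, x)) - fderiv ℝ (g k) x (V (τ, x))) ≤ P * C + δ

/-- With `g_k = χ * layer ρ k` one has `∇χ - ∇g_k = (1 - layer) ∇χ + χ * density * ∇ρ`. The first
part tends to zero in `L¹(Ω)`. The second lives in a thin layer, where the normal component of `V`
is nearly bounded by `C`, and its mass is at most `P`. -/
lemma exists_local_cutoff {Ω : Set (EuclideanSpace ℝ (Fin n))} (ho : IsOpen Ω)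
    (hb : Bornology.IsBounded Ω) {x₀ : EuclideanSpace ℝ (Fin n)}
    {ρ : EuclideanSpace ℝ (Fin n) → ℝ} (h : IsC1DefiningAt Ω x₀ ρ) :
    ∃ U : Set (EuclideanSpace ℝ (Fin n)), IsOpen U ∧ x₀ ∈ U ∧
      ∀ χ : EuclideanSpace ℝ (Fin n) → ℝ, ContDiff ℝ 1 χ → tsupport χ ⊆ U → (∀ y, 0 ≤ χ y) →
        ∃ P g, IsCutoffSeq Ω χ P g := by
  obtain ⟨U, hU, hxU, hUb, hρ, hiff, hgrad, e, c, hc, he⟩ := exists_transversal_direction h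
  refine ⟨U, hU, hxU, fun χ hχ hχs hχ0 => ?_⟩
  have hχc : HasCompactSupport χ :=
    Metric.isCompact_of_isClosed_isBounded (isClosed_tsupport χ) (hUb.subset hχs)
  set P : ℝ := c * ∫ y, |fderiv ℝ χ y e| with hP
  have hP0 : 0 ≤ P := mul_nonneg hc (integral_nonneg fun y => abs_nonneg _)
  have hl0 : ∀ k y, 0 ≤ layer ρ k y := fun k y => Real.smoothTransition.nonneg _
  have hl1 : ∀ k y, layer ρ k y ≤ 1 := fun k y => Real.smoothTransition.le_one _
  have hlev : ∀ y ∈ U, y ∈ Ω → ∀ᶠ k : ℕ in atTop, layer ρ k y = 1 := by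
    intro y hyU hyΩ
    have hneg := (hiff y hyU).1 hyΩ
    obtain ⟨k₀, hk₀⟩ := exists_nat_gt (2 / (-ρ y))
    filter_upwards [eventually_ge_atTop k₀] with k hk
    refine Real.smoothTransition.one_of_one_le ?_
    have hk' : (k₀ : ℝ) ≤ k := by exact_mod_cast hk
    rw [div_lt_iff₀ (by linarith)] at hk₀
    nlinarith
  have hgC : ∀ k, ContDiff ℝ 1 fun y => χ y * layer ρ k y := fun k =>
    contDiff_of_tsupport_subset hU (hχ.contDiffOn.mul (contDiffOn_layer hρ k))
      (tsupport_mul_subset_of_left _ hχs)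
  refine ⟨P, fun k y => χ y * layer ρ k y, hP0, hgC, fun k y hy => ?_,
    fun k x => mul_nonneg (hχ0 x) (hl0 k x), fun k x => mul_le_of_le_one_right (hχ0 x) (hl1 k x),
    fun x hx => ?_, fun K V C hK hV hC hbd δ hδ => ?_⟩
  · have hyU : y ∈ U := tsupport_mul_subset_of_left _ hχs hy
    by_contra hyΩ
    refine notMem_tsupport_iff_eventuallyEq.2 ?_ hy
    -- The shift by `-1` in the profile makes its argument negative near every point with `ρ ≥ 0`,
    -- so the support stays inside `Ω`.
    have hρy : 0 ≤ ρ y := not_lt.1 fun h => hyΩ ((hiff y hyU).2 h)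
    have hcρ : ContinuousAt ρ y := hρ.continuousOn.continuousAt (hU.mem_nhds hyU)
    have hk : ContinuousAt (fun z => -(k : ℝ) * ρ z - 1) y :=
      (continuousAt_const.mul hcρ).sub continuousAt_const
    have hlt : (fun z => -(k : ℝ) * ρ z - 1) y < 0 := by
      have : 0 ≤ (k : ℝ) * ρ y := by positivity
      simp only
      linarith
    filter_upwards [hk.eventually (gt_mem_nhds hlt)] with z hz
    simp only [layer, Real.smoothTransition.zero_of_nonpos hz.le, mul_zero, Pi.zero_apply]
  · by_cases hxU' : x ∈ U
    · refine tendsto_const_nhds.congr' ?_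
      filter_upwards [hlev x hxU' hx] with k hk
      rw [hk, mul_one]
    · have h1 : χ x = 0 := image_eq_zero_of_notMem_tsupport fun h => hxU' (hχs h)
      simp [h1]
  · obtain ⟨M, hM⟩ := (hK.prod hb.isCompact_closure).exists_bound_of_continuousOn hV
    set M' := max M 0 with hM'
    have hM0 : 0 ≤ M' := le_max_right _ _
    -- Half of `δ` pays for the error `δ' * P` in the layer, the other half for the `L¹` remainder;
    -- `P + 1` avoids division by zero.
    set δ' := δ / (2 * (P + 1)) with hδ'
    have hδ'0 : 0 < δ' := by positivity
    have hδ'P : δ' * P ≤ δ / 2 := by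
      rw [hδ', div_mul_eq_mul_div, div_le_div_iff₀ (by positivity) (by norm_num)]
      nlinarith
    obtain ⟨ε, hε, hεb⟩ := exists_layer_normal_bound hb hU hρ hiff hgrad (isClosed_tsupport χ)
      hχs hK hV hbd hδ'0
    have hdχ : Continuous fun y => ‖fderiv ℝ χ y‖ := (hχ.continuous_fderiv one_ne_zero).norm
    have hdχs : tsupport (fun y => ‖fderiv ℝ χ y‖) ⊆ U := by
      refine subset_trans ?_ ((tsupport_fderiv_subset ℝ (f := χ)).trans hχs)
      exact closure_mono fun y hy => by simpa using hy
    have hFc : ∀ k, Continuous fun y => (1 - layer ρ k y) * ‖fderiv ℝ χ y‖ := by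
      intro k
      have h1 : Continuous fun y => ‖fderiv ℝ χ y‖ * layer ρ k y :=
        continuous_of_tsupport_subset hU
          (hdχ.continuousOn.mul (contDiffOn_layer hρ k).continuousOn)
          (tsupport_mul_subset_of_left _ hdχs)
      exact (hdχ.sub h1).congr fun y => by simp only [Pi.sub_apply]; ring
    have hJ : Tendsto (fun k => ∫ y in Ω, (1 - layer ρ k y) * ‖fderiv ℝ χ y‖) atTop (𝓝 0) := by
      have h0 : (0 : ℝ) = ∫ y in Ω, (0 : ℝ) := by simp
      rw [h0]
      refine tendsto_integral_of_dominated_convergence (fun y => ‖fderiv ℝ χ y‖)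
        (fun k => (hFc k).aestronglyMeasurable)
        (integrableOn_of_continuousOn_closure hb hdχ.continuousOn)
        (fun k => Eventually.of_forall fun y => ?_) ?_
      · have := hl0 k y
        have := hl1 k y
        rw [Real.norm_eq_abs, abs_mul, abs_norm, abs_of_nonneg (by linarith)]
        exact mul_le_of_le_one_left (norm_nonneg _) (by linarith)
      · refine (ae_restrict_iff' ho.measurableSet).2 (Eventually.of_forall fun y hy => ?_)
        by_cases hyU : y ∈ U
        · refine tendsto_const_nhds.congr' ?_
          filter_upwards [hlev y hyU hy] with k hk
          simp [hk]
        · have h1 : ‖fderiv ℝ χ y‖ = 0 := by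
            by_contra hne
            exact hyU (hdχs (subset_tsupport _ hne))
          simp [h1]
    have hJ' := (hJ.const_mul M').eventually (gt_mem_nhds
      (show M' * 0 < δ / 2 by rw [mul_zero]; positivity))
    -- The density vanishes unless `-2 ≤ k ρ`, so for `k > 2 / ε` the layer lies in `{-ε < ρ}`.
    obtain ⟨k₀, hk₀⟩ := exists_nat_gt (2 / ε)
    filter_upwards [hJ', eventually_ge_atTop k₀] with k hkJ hk τ hτ
    have hk' : (k₀ : ℝ) ≤ k := by exact_mod_cast hk
    obtain ⟨hint, hle⟩ := integral_layer_le hU hρ hc he hχ hχs hχc hχ0 k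
    have hVτ : ContinuousOn (fun y => V (τ, y)) (closure Ω) :=
      hV.comp (by fun_prop) fun y hy => ⟨hτ, hy⟩
    have hpt : ∀ y ∈ Ω, fderiv ℝ χ y (V (τ, y)) -
        fderiv ℝ (fun y => χ y * layer ρ k y) y (V (τ, y)) ≤
        M' * ((1 - layer ρ k y) * ‖fderiv ℝ χ y‖) +
          (C + δ') * (χ y * (layerDensity ρ k y * ‖fderiv ℝ ρ y‖)) := by
      intro y hyΩ
      have hd0 := layerDensity_nonneg ρ k y
      have hly0 := hl0 k y
      have hly1 := hl1 k y
      by_cases hy : y ∈ U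
      · have hd := (hχ.differentiable one_ne_zero y).hasFDerivAt.mul
          (hasFDerivAt_layer ((hρ.differentiableOn one_ne_zero).differentiableAt
            (hU.mem_nhds hy)) k)
        rw [show fderiv ℝ (fun y => χ y * layer ρ k y) y = _ from hd.fderiv]
        have e1 : fderiv ℝ χ y (V (τ, y)) ≤ M' * ‖fderiv ℝ χ y‖ := by
          calc _ ≤ ‖fderiv ℝ χ y (V (τ, y))‖ := le_abs_self _
            _ ≤ ‖fderiv ℝ χ y‖ * ‖V (τ, y)‖ := ContinuousLinearMap.le_opNorm _ _
            _ ≤ ‖fderiv ℝ χ y‖ * M' := mul_le_mul_of_nonneg_left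
                ((hM (τ, y) ⟨hτ, subset_closure hyΩ⟩).trans (le_max_left _ _)) (norm_nonneg _)
            _ = _ := mul_comm _ _
        have e2 : χ y * (layerDensity ρ k y * fderiv ℝ ρ y (V (τ, y))) ≤
            (C + δ') * (χ y * (layerDensity ρ k y * ‖fderiv ℝ ρ y‖)) := by
          by_cases hχy : χ y = 0
          · simp [hχy]
          by_cases hdy : layerDensity ρ k y = 0
          · simp [hdy]
          have hlow := lt_of_layerDensity_ne_zero hdy
          have : -ε < ρ y := by
            rw [div_lt_iff₀ hε] at hk₀
            have hkpos : 0 < (k : ℝ) := by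
              rcases (Nat.cast_nonneg k : (0 : ℝ) ≤ k).lt_or_eq with h | h
              · exact h
              · nlinarith
            by_contra hcon
            push Not at hcon
            nlinarith
          have := hεb τ hτ y ⟨subset_tsupport _ hχy, subset_closure hyΩ⟩ this
          have := mul_le_mul_of_nonneg_left (mul_le_mul_of_nonneg_left this hd0) (hχ0 y)
          linarith
        have e3 := mul_le_mul_of_nonneg_left e1 (show 0 ≤ 1 - layer ρ k y by linarith)
        simp
        linarith
      · have h1 : χ y = 0 := image_eq_zero_of_notMem_tsupport fun h => hy (hχs h)
        have h2 : fderiv ℝ (fun y => χ y * layer ρ k y) y = 0 :=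
          image_eq_zero_of_notMem_tsupport fun h =>
            hy (tsupport_mul_subset_of_left _ hχs (tsupport_fderiv_subset ℝ h))
        have h3 : fderiv ℝ χ y = 0 := image_eq_zero_of_notMem_tsupport fun h =>
          hy (hχs (tsupport_fderiv_subset ℝ h))
        simp [h1, h2, h3]
    have hi1 : IntegrableOn (fun y => fderiv ℝ χ y (V (τ, y)) -
        fderiv ℝ (fun y => χ y * layer ρ k y) y (V (τ, y))) Ω := by
      refine integrableOn_of_continuousOn_closure hb ?_
      exact ((hχ.continuous_fderiv one_ne_zero).continuousOn.clm_apply hVτ).sub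
        (((hgC k).continuous_fderiv one_ne_zero).continuousOn.clm_apply hVτ)
    have hi2 : IntegrableOn (fun y => (1 - layer ρ k y) * ‖fderiv ℝ χ y‖) Ω :=
      integrableOn_of_continuousOn_closure hb (hFc k).continuousOn
    calc _ ≤ ∫ y in Ω, (M' * ((1 - layer ρ k y) * ‖fderiv ℝ χ y‖) +
          (C + δ') * (χ y * (layerDensity ρ k y * ‖fderiv ℝ ρ y‖))) :=
          setIntegral_mono_on hi1 ((hi2.const_mul M').add (hint.integrableOn.const_mul _))
            ho.measurableSet hpt
      _ = M' * (∫ y in Ω, (1 - layer ρ k y) * ‖fderiv ℝ χ y‖) +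
          (C + δ') * ∫ y in Ω, χ y * (layerDensity ρ k y * ‖fderiv ℝ ρ y‖) := by
          rw [integral_add (hi2.const_mul M') (hint.integrableOn.const_mul _),
            integral_const_mul, integral_const_mul]
      _ ≤ δ / 2 + (C + δ') * P := by
          refine add_le_add hkJ.le (mul_le_mul_of_nonneg_left ?_ (by positivity))
          refine le_trans ?_ hle
          exact setIntegral_le_integral hint (Eventually.of_forall fun y =>
            mul_nonneg (hχ0 y) (mul_nonneg (layerDensity_nonneg ρ k y) (norm_nonneg _)))
      _ ≤ P * C + δ := by linarith

/-- A bounded domain of class `C¹` has compactly supported cut-offs whose gradients point, up to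
small errors, in the direction of the inward normal and have uniformly bounded mass. -/
lemma exists_cutoff {Ω : Set (EuclideanSpace ℝ (Fin n))} (hΩ : IsBoundedC1Domain Ω) :
    ∃ (P : ℝ) (φ : ℕ → EuclideanSpace ℝ (Fin n) → ℝ), 0 ≤ P ∧ (∀ k, ContDiff ℝ 1 (φ k)) ∧
      (∀ k, tsupport (φ k) ⊆ Ω) ∧ (∀ k x, 0 ≤ φ k x) ∧ (∀ k, ∀ x ∈ Ω, φ k x ≤ 1) ∧
      (∀ x ∈ Ω, Tendsto (fun k => φ k x) atTop (𝓝 1)) ∧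
      ∀ (K : Set ℝ) (V : ℝ × EuclideanSpace ℝ (Fin n) → EuclideanSpace ℝ (Fin n)) (C : ℝ),
        IsCompact K → ContinuousOn V (K ×ˢ closure Ω) → 0 ≤ C → NormalComponentLE Ω K V C →
        ∀ δ > 0, ∀ᶠ k in atTop, ∀ τ ∈ K,
          -∫ x in Ω, fderiv ℝ (φ k) x (V (τ, x)) ≤ P * C + δ := by
  have ho := hΩ.isOpen
  have hb := hΩ.bounded
  have hloc : ∀ x : EuclideanSpace ℝ (Fin n), ∃ U : Set (EuclideanSpace ℝ (Fin n)), IsOpen U ∧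
      x ∈ U ∧ (x ∈ frontier Ω → ∀ χ : EuclideanSpace ℝ (Fin n) → ℝ, ContDiff ℝ 1 χ →
        tsupport χ ⊆ U → (∀ y, 0 ≤ χ y) → ∃ P g, IsCutoffSeq Ω χ P g) := by
    intro x
    by_cases hx : x ∈ frontier Ω
    · obtain ⟨ρ, hρ⟩ := hΩ.boundary x hx
      obtain ⟨U, hU, hxU, h⟩ := exists_local_cutoff ho hb hρ
      exact ⟨U, hU, hxU, fun _ => h⟩
    · exact ⟨Set.univ, isOpen_univ, Set.mem_univ _, fun h => absurd h hx⟩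
  choose U hU hxU hUcut using hloc
  have hfc : IsCompact (frontier Ω) :=
    hb.isCompact_closure.of_isClosed_subset isClosed_frontier frontier_subset_closure
  obtain ⟨s, hcov⟩ := hfc.elim_nhds_subcover' (fun x _ => U x)
    fun x _ => (hU x).mem_nhds (hxU x)
  -- The index `none` stands for the interior, where nothing is cut off; the others are the boundary
  -- charts.
  let W : Option s → Set (EuclideanSpace ℝ (Fin n)) := fun o => o.elim Ω fun x => U x
  have hWo : ∀ o, IsOpen (W o) := by
    rintro (_ | x)
    · exact ho
    · exact hU _
  have hWcov : closure Ω ⊆ ⋃ o, W o := by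
    intro x hx
    rw [closure_eq_self_union_frontier] at hx
    rcases hx with hx | hx
    · exact Set.mem_iUnion.2 ⟨none, hx⟩
    · obtain ⟨y, hy, hxy⟩ := Set.mem_iUnion₂.1 (hcov hx)
      exact Set.mem_iUnion.2 ⟨some ⟨y, hy⟩, hxy⟩
  obtain ⟨f, hf⟩ := SmoothPartitionOfUnity.exists_isSubordinate
    (modelWithCornersSelf ℝ (EuclideanSpace ℝ (Fin n))) isClosed_closure W hWo hWcov
  have hfC : ∀ o, ContDiff ℝ 1 (f o) := fun o =>
    (f o).contMDiff.contDiff.of_le (by exact_mod_cast le_top)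
  have hcut : ∀ x : s, ∃ P g, IsCutoffSeq Ω (f (some x)) P g := fun x =>
    hUcut x x.1.2 _ (hfC _) (hf (some x)) (f.nonneg _)
  choose P g hg using hcut
  have hsum : ∀ x ∈ closure Ω, f none x + ∑ i : s, f (some i) x = 1 := by
    intro x hx
    rw [← f.sum_eq_one hx, finsum_eq_sum_of_fintype, Fintype.sum_option]
  refine ⟨∑ i, P i, fun k x => f none x + ∑ i : s, g i k x,
    Finset.sum_nonneg fun i _ => (hg i).const_nonneg,
    fun k => (hfC none).add (ContDiff.sum fun i _ => (hg i).contDiff k), fun k => ?_,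
    fun k x => add_nonneg (f.nonneg _ _) (Finset.sum_nonneg fun i _ => (hg i).nonneg k x),
    fun k x hx => ?_, fun x hx => ?_, fun K V C hK hV hC hbd δ hδ => ?_⟩
  · intro x hx
    by_contra hxΩ
    refine notMem_tsupport_iff_eventuallyEq.2 ?_ hx
    have h0 : (f none : EuclideanSpace ℝ (Fin n) → ℝ) =ᶠ[𝓝 x] 0 :=
      notMem_tsupport_iff_eventuallyEq.1 fun h => hxΩ (hf none h)
    have h1 : ∀ᶠ y in 𝓝 x, ∀ i, g i k y = 0 := eventually_all.2 fun i =>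
      notMem_tsupport_iff_eventuallyEq.1 fun h => hxΩ ((hg i).tsupport_subset k h)
    filter_upwards [h0, h1] with y hy0 hy1
    simp [hy0, hy1]
  · rw [← hsum x (subset_closure hx)]
    exact add_le_add le_rfl (Finset.sum_le_sum fun i _ => (hg i).le k x)
  · rw [← hsum x (subset_closure hx)]
    exact tendsto_const_nhds.add (tendsto_finsetSum _ fun i _ => (hg i).tendsto x hx)
  · have hev : ∀ᶠ k in atTop, ∀ i, ∀ τ ∈ K, ∫ x in Ω, (fderiv ℝ (f (some i)) x (V (τ, x)) -
        fderiv ℝ (g i k) x (V (τ, x))) ≤ P i * C + δ / (Fintype.card s + 1) :=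
      eventually_all.2 fun i => (hg i).integral_le K V C hK hV hC hbd _ (by positivity)
    filter_upwards [hev] with k hk τ hτ
    have hVτ : ContinuousOn (fun y => V (τ, y)) (closure Ω) :=
      hV.comp (by fun_prop) fun y hy => ⟨hτ, hy⟩
    -- The partition sums to `1` on `Ω`, so its gradients cancel and only the differences between
    -- each chart function and its cut-off remain.
    have hdiff : ∀ x ∈ Ω, -(fderiv ℝ (fun x => f none x + ∑ i : s, g i k x) x (V (τ, x))) =
        ∑ i : s, (fderiv ℝ (f (some i)) x (V (τ, x)) - fderiv ℝ (g i k) x (V (τ, x))) := by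
      intro x hx
      have hd0 := ((hfC none).differentiable one_ne_zero x).hasFDerivAt
      have hd1 := HasFDerivAt.fun_sum (u := Finset.univ) fun (i : s) _ =>
        ((hfC (some i)).differentiable one_ne_zero x).hasFDerivAt
      have hd2 := HasFDerivAt.fun_sum (u := Finset.univ) fun (i : s) _ =>
        (((hg i).contDiff k).differentiable one_ne_zero x).hasFDerivAt
      have hone : HasFDerivAt (fun x => f none x + ∑ i : s, f (some i) x)
          (0 : EuclideanSpace ℝ (Fin n) →L[ℝ] ℝ) x := by
        refine (hasFDerivAt_const (1 : ℝ) x).congr_of_eventuallyEq ?_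
        filter_upwards [ho.mem_nhds hx] with y hy using hsum y (subset_closure hy)
      have h0 := (hd0.add hd1).unique hone
      have h0' := congrArg (fun L : EuclideanSpace ℝ (Fin n) →L[ℝ] ℝ => L (V (τ, x))) h0
      rw [show fderiv ℝ (fun x => f none x + ∑ i : s, g i k x) x = _ from (hd0.add hd2).fderiv]
      simp only [_root_.add_apply, _root_.sum_apply, _root_.zero_apply] at h0' ⊢
      rw [Finset.sum_sub_distrib]
      linarith
    have hint : ∀ i, IntegrableOn (fun x => fderiv ℝ (f (some i)) x (V (τ, x)) -
        fderiv ℝ (g i k) x (V (τ, x))) Ω := fun i =>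
      integrableOn_of_continuousOn_closure hb
        ((((hfC _).continuous_fderiv one_ne_zero).continuousOn.clm_apply hVτ).sub
          ((((hg i).contDiff k).continuous_fderiv one_ne_zero).continuousOn.clm_apply hVτ))
    rw [← integral_neg, setIntegral_congr_fun ho.measurableSet hdiff,
      integral_finsetSum _ fun i _ => hint i]
    calc _ ≤ ∑ i, (P i * C + δ / (Fintype.card s + 1)) :=
          Finset.sum_le_sum fun i _ => hk i τ hτ
      _ = (∑ i, P i) * C + Fintype.card s * (δ / (Fintype.card s + 1)) := by
          rw [Finset.sum_add_distrib, Finset.sum_mul]; simp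
      _ ≤ _ := by
          gcongr
          rw [mul_div_assoc', div_le_iff₀ (by positivity)]
          nlinarith

end BoundaryCutoff

/-! ### Green's formula with a cut-off -/

section Green

variable {n : ℕ}

lemma laplacian_eq_sum_fderiv {v : EuclideanSpace ℝ (Fin n) → ℝ}
    {x : EuclideanSpace ℝ (Fin n)} (h : DifferentiableAt ℝ (fderiv ℝ v) x) :
    Laplacian.laplacian v x = ∑ i, fderiv ℝ
      (fun y => fderiv ℝ v y (EuclideanSpace.basisFun (Fin n) ℝ i)) x
        (EuclideanSpace.basisFun (Fin n) ℝ i) := by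
  rw [InnerProductSpace.laplacian_eq_iteratedFDeriv_orthonormalBasis v
    (EuclideanSpace.basisFun (Fin n) ℝ)]
  refine Finset.sum_congr rfl fun i _ => ?_
  rw [iteratedFDeriv_two_apply, fderiv_clm_apply h (differentiableAt_const _)]
  simp

lemma sum_fderiv_basis_mul (L : EuclideanSpace ℝ (Fin n) →L[ℝ] ℝ)
    (v : EuclideanSpace ℝ (Fin n) → ℝ) (x : EuclideanSpace ℝ (Fin n)) :
    ∑ i, L (EuclideanSpace.basisFun (Fin n) ℝ i) *
      fderiv ℝ v x (EuclideanSpace.basisFun (Fin n) ℝ i) = L (gradient v x) := by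
  conv_rhs => rw [← (EuclideanSpace.basisFun (Fin n) ℝ).sum_repr' (gradient v x)]
  rw [map_sum]
  refine Finset.sum_congr rfl fun i _ => ?_
  rw [map_smul, smul_eq_mul, inner_gradient_right]
  simp [mul_comm]

/-- Green's formula: `∫ φ f Δv = -∫ f ∇φ·∇v - ∫ φ ∇f·∇v` for `φ` compactly supported in `Ω`. -/
lemma integral_mul_laplacian {Ω : Set (EuclideanSpace ℝ (Fin n))} (ho : IsOpen Ω)
    (hb : Bornology.IsBounded Ω) {φ f v : EuclideanSpace ℝ (Fin n) → ℝ} (hφ : ContDiff ℝ 1 φ)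
    (hφs : tsupport φ ⊆ Ω) (hf : ContDiffOn ℝ 1 f Ω) (hv : ContDiffOn ℝ 2 v Ω) :
    IntegrableOn (fun x => φ x * (f x * Laplacian.laplacian v x)) Ω ∧
    IntegrableOn (fun x => f x * fderiv ℝ φ x (gradient v x)) Ω ∧
    IntegrableOn (fun x => φ x * fderiv ℝ f x (gradient v x)) Ω ∧
    ∫ x in Ω, φ x * (f x * Laplacian.laplacian v x) =
      -(∫ x in Ω, f x * fderiv ℝ φ x (gradient v x)) -
        ∫ x in Ω, φ x * fderiv ℝ f x (gradient v x) := by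
  have hφc : HasCompactSupport φ :=
    Metric.isCompact_of_isClosed_isBounded (isClosed_tsupport φ) (hb.subset hφs)
  have hdv : ContDiffOn ℝ 1 (fderiv ℝ v) Ω := hv.fderiv_of_isOpen ho (by norm_num)
  set e := EuclideanSpace.basisFun (Fin n) ℝ
  let a : Fin n → EuclideanSpace ℝ (Fin n) → ℝ := fun i y => fderiv ℝ v y (e i)
  have ha : ∀ i, ContDiffOn ℝ 1 (a i) Ω := fun i => hdv.clm_apply contDiffOn_const
  have hda : ∀ i, ContinuousOn (fun x => fderiv ℝ (a i) x (e i)) Ω := fun i =>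
    ((ha i).continuousOn_fderiv_of_isOpen ho le_rfl).clm_apply continuousOn_const
  have hdφs : ∀ i, tsupport (fun x => fderiv ℝ φ x (e i)) ⊆ tsupport φ := fun i =>
    (closure_mono fun x hx => by
      intro h0; exact hx (by simp [h0])).trans (tsupport_fderiv_subset ℝ)
  have hint : ∀ u g : EuclideanSpace ℝ (Fin n) → ℝ, Continuous u → tsupport u ⊆ tsupport φ →
      ContinuousOn g Ω → Integrable fun x => u x * g x := by
    intro u g hu hus hg
    have huc : HasCompactSupport u := hφc.of_isClosed_subset (isClosed_tsupport u) hus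
    exact (continuous_of_tsupport_subset ho (hu.continuousOn.mul hg)
      (tsupport_mul_subset_of_left _ (hus.trans hφs))).integrable_of_hasCompactSupport huc.mul_right
  have hdφ : ∀ i, Continuous fun x => fderiv ℝ φ x (e i) := fun i =>
    (hφ.continuous_fderiv one_ne_zero).clm_apply continuous_const
  have hdf : ∀ i, ContinuousOn (fun x => fderiv ℝ f x (e i)) Ω := fun i =>
    (hf.continuousOn_fderiv_of_isOpen ho le_rfl).clm_apply continuousOn_const
  have hI1 : ∀ i, Integrable fun x => φ x * (f x * fderiv ℝ (a i) x (e i)) := fun i =>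
    hint φ _ hφ.continuous le_rfl (hf.continuousOn.mul (hda i))
  have hI2 : ∀ i, Integrable fun x => fderiv ℝ φ x (e i) * (f x * a i x) := fun i =>
    hint _ _ (hdφ i) (hdφs i) (hf.continuousOn.mul (ha i).continuousOn)
  have hI3 : ∀ i, Integrable fun x => φ x * (fderiv ℝ f x (e i) * a i x) := fun i =>
    hint φ _ hφ.continuous le_rfl ((hdf i).mul (ha i).continuousOn)
  have hφf : ContDiff ℝ 1 fun x => φ x * f x :=
    contDiff_of_tsupport_subset ho (hφ.contDiffOn.mul hf) (tsupport_mul_subset_of_left _ hφs)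
  have hdφf : ∀ i x, fderiv ℝ (fun x => φ x * f x) x (e i) * a i x =
      fderiv ℝ φ x (e i) * (f x * a i x) + φ x * (fderiv ℝ f x (e i) * a i x) := by
    intro i x
    by_cases hx : x ∈ Ω
    · rw [show fderiv ℝ (fun x => φ x * f x) x = _ from
        ((hφ.differentiable one_ne_zero x).hasFDerivAt.mul
          ((hf.differentiableOn one_ne_zero).differentiableAt (ho.mem_nhds hx)).hasFDerivAt).fderiv]
      simp
      ring
    · have h0 : φ x = 0 := image_eq_zero_of_notMem_tsupport fun h => hx (hφs h)
      have h1 : fderiv ℝ φ x = 0 := image_eq_zero_of_notMem_tsupport fun h =>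
        hx (hφs (tsupport_fderiv_subset ℝ h))
      have h2 : fderiv ℝ (fun x => φ x * f x) x = 0 := image_eq_zero_of_notMem_tsupport fun h =>
        hx (tsupport_mul_subset_of_left _ hφs (tsupport_fderiv_subset ℝ h))
      simp [h0, h1, h2]
  have hparts : ∀ i, ∫ x, φ x * (f x * fderiv ℝ (a i) x (e i)) =
      -(∫ x, fderiv ℝ φ x (e i) * (f x * a i x)) -
        ∫ x, φ x * (fderiv ℝ f x (e i) * a i x) := by
    intro i
    -- Integration by parts over the whole space: `φ f` is globally `C¹`, and `a i` needs to be
    -- differentiable only on its support.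
    have h := integral_mul_fderiv_eq_neg_fderiv_mul_of_integrable (μ := volume)
      (f := fun x => φ x * f x) (g := a i) (v := e i) ?_ ?_ ?_
      (fun x _ => hφf.differentiable one_ne_zero x)
      (fun x hx => ((ha i).differentiableOn one_ne_zero).differentiableAt
        (ho.mem_nhds (tsupport_mul_subset_of_left _ hφs hx)))
    · simp only [hdφf] at h
      rw [integral_add (hI2 i) (hI3 i)] at h
      simp only [mul_assoc] at h
      rw [h]
      ring
    · simp only [hdφf]
      exact (hI2 i).add (hI3 i)
    · simpa only [mul_assoc] using hI1 i
    · simpa only [mul_assoc, Pi.mul_apply] using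
        hint φ _ hφ.continuous le_rfl (hf.continuousOn.mul (ha i).continuousOn)
  have hoff : ∀ u : EuclideanSpace ℝ (Fin n) → ℝ, (∀ x, x ∉ Ω → u x = 0) →
      ∫ x in Ω, u x = ∫ x, u x := fun u hu => setIntegral_eq_integral_of_forall_compl_eq_zero hu
  have hφ0 : ∀ x, x ∉ Ω → φ x = 0 := fun x hx =>
    image_eq_zero_of_notMem_tsupport fun h => hx (hφs h)
  have hdφ0 : ∀ x, x ∉ Ω → fderiv ℝ φ x = 0 := fun x hx =>
    image_eq_zero_of_notMem_tsupport fun h => hx (hφs (tsupport_fderiv_subset ℝ h))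
  have e1 : ∀ x, φ x * (f x * Laplacian.laplacian v x) =
      ∑ i, φ x * (f x * fderiv ℝ (a i) x (e i)) := by
    intro x
    by_cases hx : x ∈ Ω
    · rw [laplacian_eq_sum_fderiv ((hdv.differentiableOn one_ne_zero).differentiableAt
        (ho.mem_nhds hx)), Finset.mul_sum, Finset.mul_sum]
    · simp [hφ0 x hx]
  have e2 : ∀ x, f x * fderiv ℝ φ x (gradient v x) =
      ∑ i, fderiv ℝ φ x (e i) * (f x * a i x) := by
    intro x
    rw [← sum_fderiv_basis_mul, Finset.mul_sum]
    exact Finset.sum_congr rfl fun i _ => by ring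
  have e3 : ∀ x, φ x * fderiv ℝ f x (gradient v x) =
      ∑ i, φ x * (fderiv ℝ f x (e i) * a i x) := by
    intro x
    rw [← sum_fderiv_basis_mul, Finset.mul_sum]
  simp only [e1, e2, e3]
  refine ⟨(integrable_finsetSum _ fun i _ => hI1 i).integrableOn,
    (integrable_finsetSum _ fun i _ => hI2 i).integrableOn,
    (integrable_finsetSum _ fun i _ => hI3 i).integrableOn, ?_⟩
  rw [hoff _ fun x hx => by simp [hφ0 x hx], hoff _ fun x hx => by simp [hdφ0 x hx],
    hoff _ fun x hx => by simp [hφ0 x hx], integral_finsetSum _ fun i _ => hI1 i,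
    integral_finsetSum _ fun i _ => hI2 i, integral_finsetSum _ fun i _ => hI3 i,
    ← Finset.sum_neg_distrib, ← Finset.sum_sub_distrib]
  exact Finset.sum_congr rfl fun i _ => hparts i

end Green

/-! ### Densities of Lyapunov functionals -/

section Density

variable {n m : ℕ}

/-- `H` is a density of a Lyapunov functional for the diffusion coefficients `lam` and the reaction
`F`, with first and second partial derivatives `D` and `DD`. -/
structure IsLyapunovDensity (lam : Fin m → ℝ) (F : (Fin m → ℝ) → Fin m → ℝ) (K : ℝ)
    (H : (Fin m → ℝ) → ℝ) (D : Fin m → (Fin m → ℝ) → ℝ)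
    (DD : Fin m → Fin m → (Fin m → ℝ) → ℝ) : Prop where
  hasFDerivAt : ∀ w, HasFDerivAt H
    (∑ i, D i w • (ContinuousLinearMap.proj i : (Fin m → ℝ) →L[ℝ] ℝ)) w
  hasFDerivAt_grad : ∀ i w, HasFDerivAt (D i)
    (∑ k, DD i k w • (ContinuousLinearMap.proj k : (Fin m → ℝ) →L[ℝ] ℝ)) w
  continuous_hess : ∀ i k, Continuous (DD i k)
  nonneg : ∀ w, (∀ i, 0 ≤ w i) → 0 ≤ H w
  form_nonneg : ∀ w, (∀ i, 0 ≤ w i) → ∀ x : Fin m → ℝ,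
    0 ≤ ∑ i, ∑ k, lam i * DD i k w * (x i * x k)
  const_nonneg : 0 ≤ K
  reaction_le : ∀ w, (∀ i, 0 ≤ w i) → ∑ i, D i w * F w i ≤ K * (1 + H w)

variable {lam : Fin m → ℝ} {F : (Fin m → ℝ) → Fin m → ℝ} {K : ℝ} {H : (Fin m → ℝ) → ℝ}
  {D : Fin m → (Fin m → ℝ) → ℝ} {DD : Fin m → Fin m → (Fin m → ℝ) → ℝ}

lemma IsLyapunovDensity.continuous (h : IsLyapunovDensity lam F K H D DD) : Continuous H :=
  continuous_iff_continuousAt.2 fun w => (h.hasFDerivAt w).continuousAt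

lemma IsLyapunovDensity.continuous_grad (h : IsLyapunovDensity lam F K H D DD) (i : Fin m) :
    Continuous (D i) :=
  continuous_iff_continuousAt.2 fun w => (h.hasFDerivAt_grad i w).continuousAt

lemma IsLyapunovDensity.contDiff_grad (h : IsLyapunovDensity lam F K H D DD) (i : Fin m) :
    ContDiff ℝ 1 (D i) :=
  contDiff_one_iff_hasFDerivAt.2 ⟨_, continuous_finsetSum _ fun k _ =>
    (h.continuous_hess i k).smul continuous_const, h.hasFDerivAt_grad i⟩

/-- The diffusion term, tested with a cut-off, is at most the boundary-layer flux. -/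
lemma IsLyapunovDensity.integral_diffusion_le (h : IsLyapunovDensity lam F K H D DD)
    {Ω : Set (EuclideanSpace ℝ (Fin n))} (ho : IsOpen Ω) (hb : Bornology.IsBounded Ω)
    {φ : EuclideanSpace ℝ (Fin n) → ℝ} (hφ : ContDiff ℝ 1 φ) (hφs : tsupport φ ⊆ Ω)
    (hφ0 : ∀ x, 0 ≤ φ x) {u : EuclideanSpace ℝ (Fin n) → Fin m → ℝ}
    (hu : ∀ i, ContDiffOn ℝ 2 (fun x => u x i) Ω) (hu0 : ∀ x ∈ Ω, ∀ i, 0 ≤ u x i) :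
    IntegrableOn (fun x => φ x * ∑ i, lam i * D i (u x) *
      Laplacian.laplacian (fun y => u y i) x) Ω ∧
    ∫ x in Ω, φ x * ∑ i, lam i * D i (u x) * Laplacian.laplacian (fun y => u y i) x ≤
      -∫ x in Ω, fderiv ℝ φ x (∑ i, (lam i * D i (u x)) • gradient (fun y => u y i) x) := by
  have hu1 : ContDiffOn ℝ 1 u Ω := contDiffOn_pi.2 fun i => (hu i).of_le (by norm_num)
  have hDu : ∀ i, ContDiffOn ℝ 1 (fun x => D i (u x)) Ω := fun i =>
    (h.contDiff_grad i).comp_contDiffOn hu1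
  have hG := fun i => integral_mul_laplacian ho hb hφ hφs (hDu i) (hu i)
  have e1 : ∀ x, φ x * ∑ i, lam i * D i (u x) * Laplacian.laplacian (fun y => u y i) x =
      ∑ i, lam i * (φ x * (D i (u x) * Laplacian.laplacian (fun y => u y i) x)) := by
    intro x
    rw [Finset.mul_sum]
    exact Finset.sum_congr rfl fun i _ => by ring
  have e2 : ∀ x, fderiv ℝ φ x (∑ i, (lam i * D i (u x)) • gradient (fun y => u y i) x) =
      ∑ i, lam i * (D i (u x) * fderiv ℝ φ x (gradient (fun y => u y i) x)) := by
    intro x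
    rw [map_sum]
    exact Finset.sum_congr rfl fun i _ => by rw [map_smul, smul_eq_mul]; ring
  have e3 : ∀ x ∈ Ω, 0 ≤ ∑ i, lam i *
      (φ x * fderiv ℝ (fun x => D i (u x)) x (gradient (fun y => u y i) x)) := by
    intro x hx
    have hd : ∀ i, fderiv ℝ (fun x => D i (u x)) x =
        ∑ k, DD i k (u x) • fderiv ℝ (fun y => u y k) x := by
      intro i
      have hux : HasFDerivAt u (ContinuousLinearMap.pi fun k => fderiv ℝ (fun y => u y k) x) x :=
        hasFDerivAt_pi.2 fun k => (((hu k).differentiableOn two_ne_zero).differentiableAt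
          (ho.mem_nhds hx)).hasFDerivAt
      rw [show fderiv ℝ (fun x => D i (u x)) x = _ from
        ((h.hasFDerivAt_grad i (u x)).comp x hux).fderiv]
      ext y
      simp
    set e := EuclideanSpace.basisFun (Fin n) ℝ
    -- For each coordinate direction `e l`, the Hessian form is evaluated at the vector of the
    -- partial derivatives of the components along `e l`.
    have hs : ∑ i, lam i *
        (φ x * fderiv ℝ (fun x => D i (u x)) x (gradient (fun y => u y i) x)) =
        φ x * ∑ l, ∑ i, ∑ k, lam i * DD i k (u x) *
          (fderiv ℝ (fun y => u y i) x (e l) * fderiv ℝ (fun y => u y k) x (e l)) := by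
      rw [Finset.sum_comm, Finset.mul_sum]
      refine Finset.sum_congr rfl fun i _ => ?_
      rw [← sum_fderiv_basis_mul, hd, Finset.mul_sum, Finset.mul_sum, Finset.mul_sum]
      refine Finset.sum_congr rfl fun l _ => ?_
      simp only [_root_.sum_apply, _root_.smul_apply, smul_eq_mul, Finset.sum_mul, Finset.mul_sum]
      exact Finset.sum_congr rfl fun k _ => by ring
    rw [hs]
    exact mul_nonneg (hφ0 x) (Finset.sum_nonneg fun l _ => h.form_nonneg _ (hu0 x hx) _)
  simp only [e1, e2]
  refine ⟨integrable_finsetSum _ fun i _ => (hG i).1.const_mul _, ?_⟩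
  rw [integral_finsetSum _ fun i _ => (hG i).1.const_mul _,
    integral_finsetSum _ fun i _ => (hG i).2.1.const_mul _]
  have h3 : 0 ≤ ∑ i, lam i * ∫ x in Ω,
      φ x * fderiv ℝ (fun x => D i (u x)) x (gradient (fun y => u y i) x) := by
    have := setIntegral_nonneg (μ := volume) ho.measurableSet e3
    rw [integral_finsetSum _ fun i _ => (hG i).2.2.1.const_mul _] at this
    simpa only [integral_const_mul] using this
  simp only [integral_const_mul, (hG _).2.2.2, mul_sub, mul_neg, Finset.sum_sub_distrib,
    Finset.sum_neg_distrib]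
  linarith

end Density

/-! ### The differential inequality for the Lyapunov functional -/

section Evolution

variable {n m : ℕ} {lam : Fin m → ℝ} {F : (Fin m → ℝ) → Fin m → ℝ} {K : ℝ}
  {H : (Fin m → ℝ) → ℝ} {D : Fin m → (Fin m → ℝ) → ℝ} {DD : Fin m → Fin m → (Fin m → ℝ) → ℝ}
  {Ω : Set (EuclideanSpace ℝ (Fin n))} {α : ℝ} {κ Λ : Fin m → ℝ} {q : ℕ} {T : EReal}
  {w : ℝ → EuclideanSpace ℝ (Fin n) → Fin m → ℝ}

lemma IsClassicalSolution.continuousOn_slice (hw : IsClassicalSolution Ω lam F α κ Λ q T w)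
    {t : ℝ} (ht0 : 0 < t) (htT : (t : EReal) < T) : ContinuousOn (w t) (closure Ω) :=
  continuousOn_pi.2 fun i => (hw.continuous_closure i).comp (f := fun x => (t, x))
    (by fun_prop) fun _ hx => ⟨ht0, htT, hx⟩

lemma IsClassicalSolution.nonneg_closure (hw : IsClassicalSolution Ω lam F α κ Λ q T w)
    {t : ℝ} (ht0 : 0 < t) (htT : (t : EReal) < T) {x : EuclideanSpace ℝ (Fin n)}
    (hx : x ∈ closure Ω) (i : Fin m) : 0 ≤ w t x i := by
  have hc : ContinuousWithinAt (fun y => w t y i) Ω x :=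
    (continuousOn_pi.1 (hw.continuousOn_slice ht0 htT) i x hx).mono subset_closure
  exact ContinuousWithinAt.closure_le hx continuousWithinAt_const hc
    fun y hy => hw.nonneg t ht0 htT y hy i

lemma isOpen_timeInterval (T : EReal) : IsOpen {τ : ℝ | 0 < τ ∧ (τ : EReal) < T} :=
  (isOpen_lt continuous_const continuous_id).inter
    (isOpen_lt continuous_coe_real_ereal continuous_const)

/-- Differentiation of the Lyapunov functional, localized by a cut-off. -/
lemma IsLyapunovDensity.hasDerivAt_integral (h : IsLyapunovDensity lam F K H D DD)
    (ho : IsOpen Ω) (hb : Bornology.IsBounded Ω) (hw : IsClassicalSolution Ω lam F α κ Λ q T w)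
    {φ : EuclideanSpace ℝ (Fin n) → ℝ} (hφ : Continuous φ) (hφs : tsupport φ ⊆ Ω)
    {t : ℝ} (ht0 : 0 < t) (htT : (t : EReal) < T) :
    IntegrableOn (fun x => φ x * ∑ i, D i (w t x) * deriv (fun s => w s x i) t) Ω ∧
    HasDerivAt (fun τ => ∫ x in Ω, φ x * H (w τ x))
      (∫ x in Ω, φ x * ∑ i, D i (w t x) * deriv (fun s => w s x i) t) t := by
  have hφc : IsCompact (tsupport φ) :=
    Metric.isCompact_of_isClosed_isBounded (isClosed_tsupport φ) (hb.subset hφs)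
  obtain ⟨r, hr0, hr⟩ := Metric.nhds_basis_closedBall.mem_iff.1
    ((isOpen_timeInterval T).mem_nhds (show t ∈ {τ : ℝ | 0 < τ ∧ (τ : EReal) < T} from ⟨ht0, htT⟩))
  have hwcont : ContinuousOn (fun z : ℝ × EuclideanSpace ℝ (Fin n) => w z.1 z.2)
      (cylinder T Ω) := continuousOn_pi.2 fun i => (hw.continuous_closure i).mono
    fun z hz => ⟨hz.1, hz.2.1, subset_closure hz.2.2⟩
  have hF' : ContinuousOn (fun z : ℝ × EuclideanSpace ℝ (Fin n) =>
      φ z.2 * ∑ i, D i (w z.1 z.2) * deriv (fun s => w s z.2 i) z.1) (cylinder T Ω) :=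
    (hφ.comp continuous_snd).continuousOn.mul (continuousOn_finsetSum _ fun i _ =>
      ((h.continuous_grad i).comp_continuousOn hwcont).mul (hw.time_deriv_continuous i))
  -- The time derivative is continuous only inside `Ω`; the compact support of `φ` supplies a bound
  -- uniform in `x` and in nearby times.
  have hsub : Metric.closedBall t r ×ˢ tsupport φ ⊆ cylinder T Ω := fun z hz =>
    ⟨(hr hz.1).1, (hr hz.1).2, hφs hz.2⟩
  obtain ⟨B, hB⟩ := ((isCompact_closedBall t r).prod hφc).exists_bound_of_continuousOn
    (hF'.mono hsub)
  have hFcont : ∀ τ : ℝ, 0 < τ → (τ : EReal) < T →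
      ContinuousOn (fun x => φ x * H (w τ x)) (closure Ω) := fun τ h0 hT =>
    hφ.continuousOn.mul (h.continuous.comp_continuousOn (hw.continuousOn_slice h0 hT))
  refine hasDerivAt_integral_of_dominated_loc_of_deriv_le (μ := volume.restrict Ω)
    (F := fun τ x => φ x * H (w τ x))
    (F' := fun τ x => φ x * ∑ i, D i (w τ x) * deriv (fun s => w s x i) τ)
    (bound := fun _ => max B 0) (Metric.closedBall_mem_nhds t hr0) ?_ ?_ ?_ ?_ ?_ ?_
  · filter_upwards [(isOpen_timeInterval T).mem_nhds
      (show t ∈ {τ : ℝ | 0 < τ ∧ (τ : EReal) < T} from ⟨ht0, htT⟩)] with τ hτ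
    exact (integrableOn_of_continuousOn_closure hb (hFcont τ hτ.1 hτ.2)).aestronglyMeasurable
  · exact integrableOn_of_continuousOn_closure hb (hFcont t ht0 htT)
  · refine ContinuousOn.aestronglyMeasurable ?_ ho.measurableSet
    exact hF'.comp (f := fun x => (t, x)) (by fun_prop) fun x hx => ⟨ht0, htT, hx⟩
  · refine Eventually.of_forall fun x τ hτ => ?_
    by_cases hx : x ∈ tsupport φ
    · exact (hB (τ, x) ⟨hτ, hx⟩).trans (le_max_left _ _)
    · simp [image_eq_zero_of_notMem_tsupport hx]
  · exact integrableOn_of_continuousOn_closure hb continuousOn_const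
  · refine (ae_restrict_iff' ho.measurableSet).2 (Eventually.of_forall fun x hx τ hτ => ?_)
    have hd : HasDerivAt (fun s => w s x) (fun i => deriv (fun s => w s x i) τ) τ :=
      hasDerivAt_pi.2 fun i => (hw.time_differentiable i (τ, x) ⟨(hr hτ).1, (hr hτ).2, hx⟩).hasDerivAt
    have := ((h.hasFDerivAt (w τ x)).comp_hasDerivAt τ hd).const_mul (φ x)
    simpa using this

/-- The flux of the Lyapunov density. -/
noncomputable def flux (lam : Fin m → ℝ) (D : Fin m → (Fin m → ℝ) → ℝ)
    (w : ℝ → EuclideanSpace ℝ (Fin n) → Fin m → ℝ)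
    (G : Fin m → ℝ × EuclideanSpace ℝ (Fin n) → EuclideanSpace ℝ (Fin n))
    (z : ℝ × EuclideanSpace ℝ (Fin n)) : EuclideanSpace ℝ (Fin n) :=
  ∑ i, (lam i * D i (w z.1 z.2)) • G i z

/-- The equation splits the time derivative into diffusion, which leaves only the flux against `∇φ`,
and reaction, bounded by `K φ (1 + H)` with `φ ≤ 1`. -/
lemma IsLyapunovDensity.deriv_le (h : IsLyapunovDensity lam F K H D DD)
    (ho : IsOpen Ω) (hb : Bornology.IsBounded Ω) (hw : IsClassicalSolution Ω lam F α κ Λ q T w)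
    {G : Fin m → ℝ × EuclideanSpace ℝ (Fin n) → EuclideanSpace ℝ (Fin n)}
    (hGgrad : ∀ i, ∀ z ∈ cylinder T Ω, G i z = gradient (fun x => w z.1 x i) z.2)
    {φ : EuclideanSpace ℝ (Fin n) → ℝ} (hφ : ContDiff ℝ 1 φ) (hφs : tsupport φ ⊆ Ω)
    (hφ0 : ∀ x, 0 ≤ φ x) (hφ1 : ∀ x ∈ Ω, φ x ≤ 1)
    {t : ℝ} (ht0 : 0 < t) (htT : (t : EReal) < T) :
    ∫ x in Ω, φ x * ∑ i, D i (w t x) * deriv (fun s => w s x i) t ≤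
      K * (∫ x in Ω, φ x * H (w t x)) + K * volume.real Ω -
        ∫ x in Ω, fderiv ℝ φ x (flux lam D w G (t, x)) := by
  have hd := (h.hasDerivAt_integral ho hb hw hφ.continuous hφs ht0 htT).1
  have hdiff := h.integral_diffusion_le ho hb hφ hφs hφ0
    (u := w t) (fun i => hw.space_contDiff i t ht0 htT) (fun x hx i => hw.nonneg t ht0 htT x hx i)
  have hIH : IntegrableOn (fun x => φ x * H (w t x)) Ω := integrableOn_of_continuousOn_closure hb
    (hφ.continuous.continuousOn.mul (h.continuous.comp_continuousOn
      (hw.continuousOn_slice ht0 htT)))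
  have hIK : IntegrableOn (fun _ : EuclideanSpace ℝ (Fin n) => K) Ω :=
    integrableOn_of_continuousOn_closure hb continuousOn_const
  have hI2 : IntegrableOn (fun x => K * (φ x * H (w t x)) + K) Ω := (hIH.const_mul K).add hIK
  have hpt : ∀ x ∈ Ω, φ x * ∑ i, D i (w t x) * deriv (fun s => w s x i) t ≤
      φ x * (∑ i, lam i * D i (w t x) * Laplacian.laplacian (fun y => w t y i) x) +
        (K * (φ x * H (w t x)) + K) := by
    intro x hx
    have e : ∑ i, D i (w t x) * deriv (fun s => w s x i) t =
        ∑ i, lam i * D i (w t x) * Laplacian.laplacian (fun y => w t y i) x +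
          ∑ i, D i (w t x) * F (w t x) i := by
      rw [← Finset.sum_add_distrib]
      refine Finset.sum_congr rfl fun i _ => ?_
      rw [← hw.equation i t ht0 htT x hx]
      ring
    have hr := mul_le_mul_of_nonneg_left
      (h.reaction_le (w t x) (hw.nonneg t ht0 htT x hx)) (hφ0 x)
    have := mul_le_mul_of_nonneg_left (hφ1 x hx) h.const_nonneg
    rw [e, mul_add]
    linarith
  have hflux : ∫ x in Ω, fderiv ℝ φ x
      (∑ i, (lam i * D i (w t x)) • gradient (fun y => w t y i) x) =
      ∫ x in Ω, fderiv ℝ φ x (flux lam D w G (t, x)) := by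
    refine setIntegral_congr_fun ho.measurableSet fun x hx => ?_
    simp only [flux, hGgrad _ (t, x) ⟨ht0, htT, hx⟩]
  rw [hflux] at hdiff
  calc _ ≤ ∫ x in Ω, (φ x * (∑ i, lam i * D i (w t x) *
        Laplacian.laplacian (fun y => w t y i) x) + (K * (φ x * H (w t x)) + K)) :=
        setIntegral_mono_on hd (hdiff.1.add hI2) ho.measurableSet hpt
    _ = (∫ x in Ω, φ x * ∑ i, lam i * D i (w t x) *
        Laplacian.laplacian (fun y => w t y i) x) +
        (K * (∫ x in Ω, φ x * H (w t x)) + K * volume.real Ω) := by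
        rw [integral_add hdiff.1 hI2,
          integral_add (hIH.const_mul K) hIK, integral_const_mul, setIntegral_const,
          smul_eq_mul, mul_comm (volume.real Ω)]
    _ ≤ _ := by linarith [hdiff.2]

/-- Growth of the Lyapunov functional between two positive times. -/
lemma exists_lyapunov_gronwall (hΩ : IsBoundedC1Domain Ω)
    (h : IsLyapunovDensity lam F K H D DD) {C : ℝ} (hC : 0 ≤ C) :
    ∃ B : ℝ, 0 ≤ B ∧ ∀ (T : EReal) (w : ℝ → EuclideanSpace ℝ (Fin n) → Fin m → ℝ)
      (G : Fin m → ℝ × EuclideanSpace ℝ (Fin n) → EuclideanSpace ℝ (Fin n)),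
      IsClassicalSolution Ω lam F α κ Λ q T w →
      (∀ i, ContinuousOn (G i) (cylinder T (closure Ω))) →
      (∀ i, ∀ z ∈ cylinder T Ω, G i z = gradient (fun x => w z.1 x i) z.2) →
      ∀ s t : ℝ, 0 < s → s ≤ t → (t : EReal) < T →
      NormalComponentLE Ω (Set.Icc s t) (flux lam D w G) C →
      ∀ δ, ∫ x in Ω, H (w s x) ≤ δ → ∫ x in Ω, H (w t x) ≤ gronwallBound δ K B (t - s) := by
  obtain ⟨P, φ, hP, hφC, hφs, hφ0, hφ1, hφlim, hφint⟩ := exists_cutoff hΩ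
  have ho := hΩ.isOpen
  have hb := hΩ.bounded
  have hK := h.const_nonneg
  -- `K |Ω|` comes from the constant in the reaction bound, `P C` from the boundary flux, and `1` is
  -- the cut-off error `δ`.
  refine ⟨K * volume.real Ω + (P * C + 1), by positivity,
    fun T w G hw hGc hGgrad s t hs hst htT hbd δ hδ => ?_⟩
  have htime : ∀ τ ∈ Set.Icc s t, 0 < τ ∧ (τ : EReal) < T := fun τ hτ =>
    ⟨hs.trans_le hτ.1, lt_of_le_of_lt (EReal.coe_le_coe_iff.2 hτ.2) htT⟩
  have hV : ContinuousOn (flux lam D w G) (Set.Icc s t ×ˢ closure Ω) := by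
    have hsub : Set.Icc s t ×ˢ closure Ω ⊆ cylinder T (closure Ω) := fun z hz =>
      ⟨(htime _ hz.1).1, (htime _ hz.1).2, hz.2⟩
    have hwc : ContinuousOn (fun z : ℝ × EuclideanSpace ℝ (Fin n) => w z.1 z.2)
        (cylinder T (closure Ω)) := continuousOn_pi.2 hw.continuous_closure
    exact (continuousOn_finsetSum _ fun i _ => (continuousOn_const.mul
      ((h.continuous_grad i).comp_continuousOn hwc)).smul (hGc i)).mono hsub
  have hHc : ∀ τ ∈ Set.Icc s t, ContinuousOn (fun x => H (w τ x)) (closure Ω) := fun τ hτ =>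
    h.continuous.comp_continuousOn (hw.continuousOn_slice (htime τ hτ).1 (htime τ hτ).2)
  have hHint : ∀ τ ∈ Set.Icc s t, IntegrableOn (fun x => H (w τ x)) Ω := fun τ hτ =>
    integrableOn_of_continuousOn_closure hb (hHc τ hτ)
  have hH0 : ∀ τ ∈ Set.Icc s t, ∀ x ∈ Ω, 0 ≤ H (w τ x) := fun τ hτ x hx =>
    h.nonneg _ (hw.nonneg τ (htime τ hτ).1 (htime τ hτ).2 x hx)
  have hφHint : ∀ k, ∀ τ ∈ Set.Icc s t, IntegrableOn (fun x => φ k x * H (w τ x)) Ω :=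
    fun k τ hτ => integrableOn_of_continuousOn_closure hb
      ((hφC k).continuous.continuousOn.mul (hHc τ hτ))
  have hlim : Tendsto (fun k => ∫ x in Ω, φ k x * H (w t x)) atTop
      (𝓝 (∫ x in Ω, H (w t x))) := by
    have ht : t ∈ Set.Icc s t := ⟨hst, le_rfl⟩
    refine tendsto_integral_of_dominated_convergence (fun x => H (w t x))
      (fun k => (hφHint k t ht).aestronglyMeasurable) (hHint t ht) (fun k => ?_) ?_
    · refine (ae_restrict_iff' ho.measurableSet).2 (Eventually.of_forall fun x hx => ?_)
      rw [Real.norm_eq_abs, abs_of_nonneg (mul_nonneg (hφ0 k x) (hH0 t ht x hx))]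
      exact mul_le_of_le_one_left (hH0 t ht x hx) (hφ1 k x hx)
    · refine (ae_restrict_iff' ho.measurableSet).2 (Eventually.of_forall fun x hx => ?_)
      simpa using (hφlim x hx).mul_const (H (w t x))
  -- For all large `k`, uniformly over the compact time interval, the localized functional satisfies
  -- a Gronwall inequality with constants independent of `k`; this survives the limit.
  refine le_of_tendsto hlim ?_
  filter_upwards [hφint (Set.Icc s t) (flux lam D w G) C isCompact_Icc hV hC hbd 1 one_pos]
    with k hk
  have hderiv : ∀ τ ∈ Set.Icc s t, HasDerivAt (fun τ => ∫ x in Ω, φ k x * H (w τ x))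
      (∫ x in Ω, φ k x * ∑ i, D i (w τ x) * deriv (fun s => w s x i) τ) τ := fun τ hτ =>
    (h.hasDerivAt_integral ho hb hw (hφC k).continuous (hφs k) (htime τ hτ).1 (htime τ hτ).2).2
  refine le_gronwallBound_of_liminf_deriv_right_le
    (f := fun τ => ∫ x in Ω, φ k x * H (w τ x))
    (f' := fun τ => ∫ x in Ω, φ k x * ∑ i, D i (w τ x) * deriv (fun s => w s x i) τ)
    (a := s) (b := t)
    (fun τ hτ => (hderiv τ hτ).continuousAt.continuousWithinAt)
    (fun τ hτ r hr => ?_) ?_ (fun τ hτ => ?_) t ⟨hst, le_rfl⟩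
  · exact (hderiv τ ⟨hτ.1, hτ.2.le⟩).hasDerivWithinAt.liminf_right_slope_le hr
  · have hs' : s ∈ Set.Icc s t := ⟨le_rfl, hst⟩
    refine le_trans ?_ hδ
    exact setIntegral_mono_on (hφHint k s hs') (hHint s hs') ho.measurableSet fun x hx =>
      mul_le_of_le_one_left (hH0 s hs' x hx) (hφ1 k x hx)
  · have hτ' : τ ∈ Set.Icc s t := ⟨hτ.1, hτ.2.le⟩
    have := h.deriv_le ho hb hw hGgrad (hφC k) (hφs k) (hφ0 k) (hφ1 k)
      (htime τ hτ').1 (htime τ hτ').2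
    have := hk τ hτ'
    linarith

end Evolution

/-! ### The boundary flux -/

section Boundary

variable {n : ℕ}

/-- A nonnegative function that vanishes at a boundary point has a nonpositive outward normal
derivative there. -/
lemma normal_derivative_nonpos {Ω : Set (EuclideanSpace ℝ (Fin n))} (ho : IsOpen Ω)
    {v : EuclideanSpace ℝ (Fin n) → ℝ} {g : EuclideanSpace ℝ (Fin n) → EuclideanSpace ℝ (Fin n)}
    (hv : ContinuousOn v (closure Ω)) (hvd : DifferentiableOn ℝ v Ω)
    (hg : ContinuousOn g (closure Ω)) (hgv : ∀ y ∈ Ω, g y = gradient v y)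
    (hv0 : ∀ y ∈ Ω, 0 ≤ v y) {x η : EuclideanSpace ℝ (Fin n)} (hx : x ∈ frontier Ω)
    (hη : IsOutwardUnitNormal Ω x η) (hvx : v x = 0) : inner ℝ (g x) η ≤ 0 := by
  obtain ⟨ρ, ⟨U, hU, hxU, hρ, hgrad, hiff⟩, hηρ⟩ := hη
  have hxc : x ∈ closure Ω := frontier_subset_closure hx
  by_contra hpos
  push Not at hpos
  have hγ : Continuous fun s : ℝ => x - s • η := by fun_prop
  have hγ0 : x - (0 : ℝ) • η = x := by simp
  have hγU : ∀ᶠ s in 𝓝[>] (0 : ℝ), x - s • η ∈ U := by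
    refine nhdsWithin_le_nhds (hγ.continuousAt.eventually_mem (hU.mem_nhds ?_))
    rwa [hγ0]
  have hρx : ρ x ≤ 0 := by
    have hc : ContinuousWithinAt ρ (Ω ∩ U) x :=
      (hρ.continuousOn.continuousAt (hU.mem_nhds hxU)).continuousWithinAt
    refine ContinuousWithinAt.closure_le (f := ρ) (g := fun _ => 0) ?_ hc continuousWithinAt_const
      fun y hy => ((hiff y hy.2).1 hy.1).le
    exact mem_closure_iff_nhds.2 fun t ht => by
      obtain ⟨y, ⟨hyt, hyU⟩, hyΩ⟩ := mem_closure_iff_nhds.1 hxc _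
        (Filter.inter_mem ht (hU.mem_nhds hxU))
      exact ⟨y, hyt, hyΩ, hyU⟩
  have hslope : HasDerivAt (fun s : ℝ => ρ (x - s • η)) (-‖gradient ρ x‖) 0 := by
    have hdρ : HasFDerivAt ρ (fderiv ℝ ρ x) (x - (0 : ℝ) • η) := by
      rw [hγ0]
      exact ((hρ.differentiableOn one_ne_zero).differentiableAt (hU.mem_nhds hxU)).hasFDerivAt
    have hdγ : HasDerivAt (fun s : ℝ => x - s • η) (-((1 : ℝ) • η)) 0 :=
      ((hasDerivAt_id (0 : ℝ)).smul_const η).const_sub x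
    refine (hdρ.comp_hasDerivAt (0 : ℝ) hdγ).congr_deriv ?_
    have hn : ‖gradient ρ x‖ ≠ 0 := norm_ne_zero_iff.2 hgrad
    rw [one_smul, map_neg, ← inner_gradient_left, hηρ, inner_smul_right,
      real_inner_self_eq_norm_sq]
    field_simp
  -- Along the inward ray `ρ` starts at a value `≤ 0` with slope `-‖∇ρ(x)‖ < 0`, so the ray enters
  -- `Ω`.
  have hγΩ : ∀ᶠ s in 𝓝[>] (0 : ℝ), x - s • η ∈ Ω := by
    have hneg : -‖gradient ρ x‖ < 0 := neg_neg_of_pos (norm_pos_iff.2 hgrad)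
    filter_upwards [hγU, (hslope.hasDerivWithinAt (s := Set.Ioi 0)).limsup_slope_le'
      (by simp) hneg, self_mem_nhdsWithin] with s hsU hs hs0
    rw [hiff _ hsU]
    rw [slope_def_field, sub_zero, hγ0, div_neg_iff] at hs
    rcases hs with hs | hs
    · exact absurd hs.2 (not_lt.2 (le_of_lt hs0))
    · linarith [hs.1]
  obtain ⟨r, hr0, hr⟩ := mem_nhdsGT_iff_exists_Ioo_subset.1 hγΩ
  have hmap : ∀ s ∈ Set.Ico 0 r, x - s • η ∈ closure Ω := by
    intro s hs
    rcases hs.1.eq_or_lt with h | h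
    · rw [← h, hγ0]; exact hxc
    · exact subset_closure (hr ⟨h, hs.2⟩)
  have hgc : ContinuousOn (fun s : ℝ => inner ℝ (g (x - s • η)) η) (Set.Ico 0 r) :=
    (hg.comp hγ.continuousOn hmap).inner continuousOn_const
  have hev : ∀ᶠ s in 𝓝[Set.Ico 0 r] (0 : ℝ), 0 < inner ℝ (g (x - s • η)) η := by
    refine (hgc 0 ⟨le_rfl, hr0⟩).eventually (lt_mem_nhds ?_)
    change 0 < inner ℝ (g (x - (0 : ℝ) • η)) η
    rwa [hγ0]
  have hev' : ∀ᶠ s in 𝓝[>] (0 : ℝ), 0 < inner ℝ (g (x - s • η)) η := by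
    rw [← nhdsWithin_Ioo_eq_nhdsGT hr0]
    exact nhdsWithin_mono 0 Set.Ioo_subset_Ico_self hev
  obtain ⟨r', hr'0, hr'⟩ := mem_nhdsGT_iff_exists_Ioo_subset.1 hev'
  set a := min r r' / 2 with ha
  have hmin : 0 < min r r' := lt_min hr0 hr'0
  have ha0 : 0 < a := by positivity
  have har : a < r := by have := min_le_left r r'; linarith
  have har' : a < r' := by have := min_le_right r r'; linarith
  -- If the normal derivative were positive, `v` would decrease strictly from `0` along the ray and
  -- become negative inside `Ω`.
  have hanti : StrictAntiOn (fun s : ℝ => v (x - s • η)) (Set.Icc 0 a) := by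
    refine strictAntiOn_of_deriv_neg (convex_Icc 0 a)
      (hv.comp hγ.continuousOn fun s hs => hmap s ⟨hs.1, hs.2.trans_lt har⟩) fun s hs => ?_
    rw [interior_Icc] at hs
    have hsΩ : x - s • η ∈ Ω := hr ⟨hs.1, hs.2.trans har⟩
    have hdγ : HasDerivAt (fun s : ℝ => x - s • η) (-((1 : ℝ) • η)) s :=
      ((hasDerivAt_id s).smul_const η).const_sub x
    have hd := (hvd.differentiableAt (ho.mem_nhds hsΩ)).hasFDerivAt.comp_hasDerivAt s hdγ
    rw [show deriv (fun s : ℝ => v (x - s • η)) s = _ from hd.deriv, one_smul, map_neg,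
      ← inner_gradient_left, ← hgv _ hsΩ]
    exact neg_neg_of_pos (hr' ⟨hs.1, hs.2.trans har'⟩)
  have := hanti (Set.left_mem_Icc.2 ha0.le) (Set.right_mem_Icc.2 ha0.le) ha0
  simp only [hγ0, hvx] at this
  exact absurd (hv0 _ (hr ⟨ha0, har⟩)) (not_le.2 this)

/-- The outward flux of the Lyapunov density through the boundary is bounded from above. -/
lemma exists_flux_bound {j : ℕ} {Ω : Set (EuclideanSpace ℝ (Fin n))} (ho : IsOpen Ω)
    {θ : ℕ → ℝ} (hθ : ∀ k ∈ Finset.Ico 1 (j + 1), 0 < θ k) {pm : ℕ} (hpm : 1 ≤ pm)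
    {lam κ Λ : Fin (j + 1) → ℝ} (hlam : ∀ i, 0 < lam i) (hκ : ∀ i, 0 < κ i) {α : ℝ}
    (hbc : (0 < α ∧ α < 1) ∨ (α = 0 ∧ Λ = 0) ∨ (α = 1 ∧ Λ = 0))
    (F : (Fin (j + 1) → ℝ) → Fin (j + 1) → ℝ) (q : ℕ) :
    ∃ C : ℝ, 0 ≤ C ∧ ∀ (T : EReal) (w : ℝ → EuclideanSpace ℝ (Fin n) → Fin (j + 1) → ℝ)
      (G : Fin (j + 1) → ℝ × EuclideanSpace ℝ (Fin n) → EuclideanSpace ℝ (Fin n)),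
      IsClassicalSolution Ω lam F α κ Λ q T w →
      (∀ i, ContinuousOn (G i) (cylinder T (closure Ω))) →
      (∀ i, ∀ z ∈ cylinder T Ω, G i z = gradient (fun x => w z.1 x i) z.2) →
      (∀ i, ∀ z ∈ cylinder T (frontier Ω), ∀ η, IsOutwardUnitNormal Ω z.2 η →
        α * w z.1 z.2 i + (1 - α) * (κ i * inner ℝ (G i z) η) = Λ i) →
      ∀ s t : ℝ, 0 < s → (t : EReal) < T →
        NormalComponentLE Ω (Set.Icc s t) (flux lam (polyGrad θ (j + 1) pm) w G) C := by
  have hinner : ∀ (w : ℝ → EuclideanSpace ℝ (Fin n) → Fin (j + 1) → ℝ)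
      (G : Fin (j + 1) → ℝ × EuclideanSpace ℝ (Fin n) → EuclideanSpace ℝ (Fin n))
      (z : ℝ × EuclideanSpace ℝ (Fin n)) (η : EuclideanSpace ℝ (Fin n)),
      inner ℝ (flux lam (polyGrad θ (j + 1) pm) w G z) η =
        ∑ i, lam i * polyGrad θ (j + 1) pm i (w z.1 z.2) * inner ℝ (G i z) η := by
    intro w G z η
    rw [flux, sum_inner]
    exact Finset.sum_congr rfl fun i _ => by rw [real_inner_smul_left]
  rcases hbc with ⟨hα0, hα1⟩ | ⟨rfl, rfl⟩ | ⟨rfl, rfl⟩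
  · have h1α : 0 < 1 - α := by linarith
    -- The boundary condition gives `∂_η w_i = (Λ_i - α w_i) / ((1 - α) κ_i)`, which explains the
    -- factor `β`.
    obtain ⟨B, hB0, hB⟩ := exists_robin_bound hθ hpm hα0
      (β := fun i => lam i / ((1 - α) * κ i))
      (fun i => div_pos (hlam i) (mul_pos h1α (hκ i))) Λ
    refine ⟨B, hB0, fun T w G hw _ _ hGbc s t hs htT τ hτ x hx η hη => ?_⟩
    have hτ0 : 0 < τ := hs.trans_le hτ.1
    have hτT : (τ : EReal) < T := lt_of_le_of_lt (EReal.coe_le_coe_iff.2 hτ.2) htT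
    rw [hinner]
    refine le_trans (Finset.sum_congr rfl fun i _ => ?_).le
      (hB (w τ x) fun i => hw.nonneg_closure hτ0 hτT (frontier_subset_closure hx) i)
    rw [← hGbc i (τ, x) ⟨hτ0, hτT, hx⟩ η hη]
    have := (hκ i).ne'
    have := h1α.ne'
    field_simp
    ring
  · refine ⟨0, le_rfl, fun T w G hw _ _ hGbc s t hs htT τ hτ x hx η hη => ?_⟩
    have hτ0 : 0 < τ := hs.trans_le hτ.1
    have hτT : (τ : EReal) < T := lt_of_le_of_lt (EReal.coe_le_coe_iff.2 hτ.2) htT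
    rw [hinner]
    refine (Finset.sum_eq_zero fun i _ => ?_).le
    have := hGbc i (τ, x) ⟨hτ0, hτT, hx⟩ η hη
    have h0 : inner ℝ (G i (τ, x)) η = 0 := by simpa [(hκ i).ne'] using this
    rw [h0, mul_zero]
  · refine ⟨0, le_rfl, fun T w G hw hGc hGgrad hGbc s t hs htT τ hτ x hx η hη => ?_⟩
    have hτ0 : 0 < τ := hs.trans_le hτ.1
    have hτT : (τ : EReal) < T := lt_of_le_of_lt (EReal.coe_le_coe_iff.2 hτ.2) htT
    rw [hinner]
    refine Finset.sum_nonpos fun i _ => ?_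
    have h0 : w τ x i = 0 := by simpa using hGbc i (τ, x) ⟨hτ0, hτT, hx⟩ η hη
    refine mul_nonpos_of_nonneg_of_nonpos (mul_nonneg (hlam i).le (polyGrad_nonneg hθ pm i
      fun i => hw.nonneg_closure hτ0 hτT (frontier_subset_closure hx) i)) ?_
    refine normal_derivative_nonpos ho (v := fun y => w τ y i) (g := fun y => G i (τ, y))
      (continuousOn_pi.1 (hw.continuousOn_slice hτ0 hτT) i)
      ((hw.space_contDiff i τ hτ0 hτT).differentiableOn two_ne_zero)
      ((hGc i).comp (f := fun y => (τ, y)) (by fun_prop) fun y hy => ⟨hτ0, hτT, hy⟩)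
      (fun y hy => hGgrad i (τ, y) ⟨hτ0, hτT, hy⟩)
      (fun y hy => hw.nonneg τ hτ0 hτT y hy i) hx hη h0

end Boundary

/-! ### The Lyapunov functional near the initial time -/

section InitialTime

variable {n m : ℕ} {lam : Fin m → ℝ} {F : (Fin m → ℝ) → Fin m → ℝ}
  {Ω : Set (EuclideanSpace ℝ (Fin n))} {α : ℝ} {κ Λ : Fin m → ℝ} {q : ℕ} {T : EReal}
  {w : ℝ → EuclideanSpace ℝ (Fin n) → Fin m → ℝ}

lemma integral_norm_pow_eq_toReal_eLpNorm_pow {X : Type*} [MeasurableSpace X] {μ : Measure X}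
    {f : X → ℝ} (hq : q ≠ 0) (hf : MemLp f q μ) :
    ∫ x, ‖f x‖ ^ q ∂μ = (eLpNorm f q μ).toReal ^ q := by
  have h0 : 0 ≤ ∫ x, ‖f x‖ ^ q ∂μ := integral_nonneg fun x => by positivity
  rw [hf.eLpNorm_eq_integral_rpow_norm (by exact_mod_cast hq) (ENNReal.natCast_ne_top q)]
  simp only [ENNReal.toReal_natCast, Real.rpow_natCast]
  rw [ENNReal.toReal_ofReal (by positivity), Real.rpow_inv_natCast_pow h0 hq]

lemma eventually_time_lt (hT : 0 < T) : ∀ᶠ s : ℝ in 𝓝[>] 0, 0 < s ∧ (s : EReal) < T := by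
  have h : ∀ᶠ s : ℝ in 𝓝 0, (s : EReal) < T :=
    continuous_coe_real_ereal.continuousAt.eventually (gt_mem_nhds (by simpa using hT))
  filter_upwards [self_mem_nhdsWithin, nhdsWithin_le_nhds h] with s hs hs'
  exact ⟨hs, hs'⟩

/-- The initial value of a nonnegative solution is nonnegative. -/
lemma IsClassicalSolution.initial_nonneg (hw : IsClassicalSolution Ω lam F α κ Λ q T w)
    (ho : IsOpen Ω) (hq : q ≠ 0) (hT : 0 < T) :
    ∀ᵐ x ∂volume.restrict Ω, ∀ i, 0 ≤ w 0 x i := by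
  refine ae_all_iff.2 fun i => ?_
  have hm : AEStronglyMeasurable (fun x => min (w 0 x i) 0) (volume.restrict Ω) :=
    (hw.initial_memLp i).aestronglyMeasurable.inf aestronglyMeasurable_const
  -- Since `w s ≥ 0`, the negative part of `w 0` is at most `|w s - w 0|`, whose norm tends to zero.
  have hle : ∀ᶠ s in 𝓝[>] (0 : ℝ), eLpNorm (fun x => min (w 0 x i) 0) q (volume.restrict Ω) ≤
      eLpNorm (fun x => w s x i - w 0 x i) q (volume.restrict Ω) := by
    filter_upwards [eventually_time_lt hT] with s hs
    refine eLpNorm_mono_ae ((ae_restrict_iff' ho.measurableSet).2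
      (Eventually.of_forall fun x hx => ?_))
    have h0 := hw.nonneg s hs.1 hs.2 x hx i
    rw [Real.norm_eq_abs, Real.norm_eq_abs]
    rcases le_total (w 0 x i) 0 with h | h
    · rw [min_eq_left h, abs_of_nonpos h, abs_of_nonneg (by linarith)]
      linarith
    · rw [min_eq_right h, abs_zero]
      exact abs_nonneg _
  have hzero := nonpos_iff_eq_zero.1 (ge_of_tendsto (hw.initial_limit i) hle)
  filter_upwards [(eLpNorm_eq_zero_iff hm (by exact_mod_cast hq)).1 hzero] with x hx
  exact min_eq_right_iff.1 hx

/-- At positive times close to zero the total mass is controlled in `L^q` by the initial one. -/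
lemma IsClassicalSolution.eventually_integral_le (hw : IsClassicalSolution Ω lam F α κ Λ q T w)
    (ho : IsOpen Ω) (hq : q ≠ 0) (hT : 0 < T) {A : ℝ}
    (hA : ∫ x in Ω, ‖∑ i, w 0 x i‖ ^ q ≤ A) :
    ∀ᶠ s in 𝓝[>] (0 : ℝ), ∫ x in Ω, ‖∑ i, w s x i‖ ^ q ≤ (2 + A) ^ q := by
  have hq1 : (1 : ENNReal) ≤ q := by exact_mod_cast Nat.one_le_iff_ne_zero.2 hq
  have hM0 : MemLp (fun x => ∑ i, w 0 x i) q (volume.restrict Ω) :=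
    memLp_finsetSum _ fun i _ => hw.initial_memLp i
  set N := (eLpNorm (fun x => ∑ i, w 0 x i) q (volume.restrict Ω)).toReal with hN
  have hN0 : 0 ≤ N := ENNReal.toReal_nonneg
  -- A crude bound from `N ^ q ≤ A` that avoids `q`-th roots. The remaining `1` in `2 + A` is the
  -- eventual bound for the `L^q` distance to the initial value.
  have hNA : N ≤ 1 + A := by
    have h1 : N ^ q ≤ A := by rw [hN, ← integral_norm_pow_eq_toReal_eLpNorm_pow hq hM0]; exact hA
    rcases le_total N 1 with h | h
    · have := pow_nonneg hN0 q; linarith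
    · have := le_self_pow₀ h hq; linarith
  have hlim : Tendsto (fun s : ℝ => ∑ i, eLpNorm (fun x => w s x i - w 0 x i) q
      (volume.restrict Ω)) (𝓝[>] 0) (𝓝 0) := by
    simpa using tendsto_finsetSum (Finset.univ : Finset (Fin m)) fun i _ => hw.initial_limit i
  filter_upwards [eventually_time_lt hT, hlim.eventually (gt_mem_nhds zero_lt_one)] with s hs hs1
  have hcont : ∀ i, ContinuousOn (fun x => w s x i) (closure Ω) :=
    continuousOn_pi.1 (hw.continuousOn_slice hs.1 hs.2)
  have hmeas : ∀ i, AEStronglyMeasurable (fun x => w s x i) (volume.restrict Ω) := fun i =>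
    ((hcont i).mono subset_closure).aestronglyMeasurable ho.measurableSet
  have hdm : ∀ i, AEStronglyMeasurable (fun x => w s x i - w 0 x i) (volume.restrict Ω) :=
    fun i => (hmeas i).sub (hw.initial_memLp i).aestronglyMeasurable
  have hdL : ∀ i, MemLp (fun x => w s x i - w 0 x i) q (volume.restrict Ω) := fun i =>
    ⟨hdm i, ((Finset.single_le_sum (f := fun i => eLpNorm (fun x => w s x i - w 0 x i) q
      (volume.restrict Ω)) (fun _ _ => zero_le) (Finset.mem_univ i)).trans_lt hs1).trans
      ENNReal.one_lt_top⟩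
  have heq : (fun x => ∑ i, w s x i) =
      (fun x => ∑ i, w 0 x i) + ∑ i, fun x => w s x i - w 0 x i := by
    ext x
    simp
  have hMs : MemLp (fun x => ∑ i, w s x i) q (volume.restrict Ω) := by
    rw [heq]
    exact hM0.add (memLp_finsetSum' _ fun i _ => hdL i)
  have hle : eLpNorm (fun x => ∑ i, w s x i) q (volume.restrict Ω) ≤
      eLpNorm (fun x => ∑ i, w 0 x i) q (volume.restrict Ω) + 1 := by
    rw [heq]
    refine (eLpNorm_add_le hM0.aestronglyMeasurable
      (memLp_finsetSum' _ fun i _ => hdL i).aestronglyMeasurable hq1).trans ?_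
    exact add_le_add le_rfl ((eLpNorm_sum_le (fun i _ => hdm i) hq1).trans hs1.le)
  rw [integral_norm_pow_eq_toReal_eLpNorm_pow hq hMs]
  refine pow_le_pow_left₀ ENNReal.toReal_nonneg ?_ q
  have := ENNReal.toReal_mono (ENNReal.add_ne_top.2 ⟨hM0.eLpNorm_ne_top, ENNReal.one_ne_top⟩) hle
  rw [ENNReal.toReal_add hM0.eLpNorm_ne_top ENNReal.one_ne_top, ENNReal.toReal_one] at this
  linarith

end InitialTime

/-! ### Integrability of the density and control of the functional near time zero. -/

section LyapunovFunctional

variable {n j : ℕ} {lam : Fin (j + 1) → ℝ} {F : (Fin (j + 1) → ℝ) → Fin (j + 1) → ℝ}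
  {Ω : Set (EuclideanSpace ℝ (Fin n))} {α : ℝ} {κ Λ : Fin (j + 1) → ℝ} {q : ℕ} {T : EReal}
  {w : ℝ → EuclideanSpace ℝ (Fin n) → Fin (j + 1) → ℝ} {θ : ℕ → ℝ}

lemma continuous_weightedPoly (θ : ℕ → ℝ) (j q : ℕ) :
    Continuous fun w => weightedPoly θ (j + 1) w q :=
  continuous_iff_continuousAt.2 fun w => (hasFDerivAt_weightedPoly θ j q w).continuousAt

/-- At time zero there is neither continuity nor pointwise positivity, so everything rests on almost
everywhere nonnegativity and the comparison of `H` with `(∑ w_i) ^ q`. -/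
lemma IsClassicalSolution.integrableOn_initial (hw : IsClassicalSolution Ω lam F α κ Λ q T w)
    (ho : IsOpen Ω) (hθ : ∀ k ∈ Finset.Ico 1 (j + 1), 0 < θ k) (hq : q ≠ 0) (hT : 0 < T) :
    IntegrableOn (fun x => weightedPoly θ (j + 1) (w 0 x) q) Ω ∧
      0 ≤ lyapunov Ω θ q w 0 ∧
      ∀ b : ℝ, 0 < b → (∀ u : Fin (j + 1) → ℝ, (∀ i, 0 ≤ u i) →
        b * (∑ i, u i) ^ q ≤ weightedPoly θ (j + 1) u q) →
        ∫ x in Ω, ‖∑ i, w 0 x i‖ ^ q ≤ lyapunov Ω θ q w 0 / b := by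
  have hnn := hw.initial_nonneg ho hq hT
  obtain ⟨B, hB0, hB⟩ := exists_weightedPoly_le θ j q
  have hM0 : MemLp (fun x => ∑ i, w 0 x i) q (volume.restrict Ω) :=
    memLp_finsetSum _ fun i _ => hw.initial_memLp i
  have hpow := hM0.integrable_norm_pow hq
  have hmeas : AEStronglyMeasurable (fun x => weightedPoly θ (j + 1) (w 0 x) q)
      (volume.restrict Ω) :=
    (continuous_weightedPoly θ j q).comp_aestronglyMeasurable
      (aemeasurable_pi_lambda _ fun i =>
        (hw.initial_memLp i).aestronglyMeasurable.aemeasurable).aestronglyMeasurable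
  have hint : IntegrableOn (fun x => weightedPoly θ (j + 1) (w 0 x) q) Ω := by
    refine (hpow.const_mul B).mono' hmeas ?_
    filter_upwards [hnn] with x hx
    rw [Real.norm_eq_abs, abs_of_nonneg (weightedPoly_nonneg hθ q hx), Real.norm_eq_abs,
      abs_of_nonneg (Finset.sum_nonneg fun i _ => hx i)]
    exact hB _ hx
  refine ⟨hint, ?_, fun b hb hle => ?_⟩
  · refine integral_nonneg_of_ae ?_
    filter_upwards [hnn] with x hx using weightedPoly_nonneg hθ q hx
  · rw [le_div_iff₀ hb, mul_comm, ← integral_const_mul]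
    refine integral_mono_ae (hpow.const_mul b) hint ?_
    filter_upwards [hnn] with x hx
    rw [Real.norm_eq_abs, abs_of_nonneg (Finset.sum_nonneg fun i _ => hx i)]
    exact hle _ hx

lemma IsClassicalSolution.integrableOn_weightedPoly
    (hw : IsClassicalSolution Ω lam F α κ Λ q T w) (hb : Bornology.IsBounded Ω) (θ : ℕ → ℝ)
    {t : ℝ} (ht0 : 0 < t) (htT : (t : EReal) < T) :
    IntegrableOn (fun x => weightedPoly θ (j + 1) (w t x) q) Ω :=
  integrableOn_of_continuousOn_closure hb
    ((continuous_weightedPoly θ j q).comp_continuousOn (hw.continuousOn_slice ht0 htT))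

/-- Close to the initial time, the Lyapunov functional is bounded in terms of its initial value. -/
lemma exists_bound_near_initial (ho : IsOpen Ω) (hb : Bornology.IsBounded Ω)
    (hθ : ∀ k ∈ Finset.Ico 1 (j + 1), 0 < θ k) (hq : q ≠ 0)
    (lam : Fin (j + 1) → ℝ) (F : (Fin (j + 1) → ℝ) → Fin (j + 1) → ℝ)
    (α : ℝ) (κ Λ : Fin (j + 1) → ℝ) (R : ℝ) :
    ∃ A : ℝ, 0 ≤ A ∧ ∀ (T : EReal) (w : ℝ → EuclideanSpace ℝ (Fin n) → Fin (j + 1) → ℝ),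
      IsClassicalSolution Ω lam F α κ Λ q T w → 0 < T → lyapunov Ω θ q w 0 ≤ R →
      ∀ᶠ s in 𝓝[>] (0 : ℝ), lyapunov Ω θ q w s ≤ A := by
  obtain ⟨b, hb0, hble⟩ := exists_le_weightedPoly hθ q
  obtain ⟨B, hB0, hB⟩ := exists_weightedPoly_le θ j q
  -- `R` is an arbitrary real; the absolute value makes the constant nonnegative even when no
  -- solution satisfies the bound.
  refine ⟨B * |2 + R / b| ^ q, by positivity, fun T w hw hT hR => ?_⟩
  obtain ⟨-, h0, hA⟩ := hw.integrableOn_initial ho hθ hq hT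
  have hA' : ∫ x in Ω, ‖∑ i, w 0 x i‖ ^ q ≤ R / b :=
    (hA b hb0 hble).trans (div_le_div_of_nonneg_right hR hb0.le)
  filter_upwards [hw.eventually_integral_le ho hq hT hA', eventually_time_lt hT] with s hs hs0
  have hcont : ContinuousOn (fun x => ‖∑ i, w s x i‖ ^ q) (closure Ω) :=
    (continuousOn_finsetSum _ fun i _ =>
      continuousOn_pi.1 (hw.continuousOn_slice hs0.1 hs0.2) i).norm.pow q
  calc lyapunov Ω θ q w s ≤ ∫ x in Ω, B * ‖∑ i, w s x i‖ ^ q := by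
        refine setIntegral_mono_on (hw.integrableOn_weightedPoly hb θ hs0.1 hs0.2)
          ((integrableOn_of_continuousOn_closure hb hcont).const_mul B) ho.measurableSet
          fun x hx => ?_
        have hx0 := hw.nonneg s hs0.1 hs0.2 x hx
        rw [Real.norm_eq_abs, abs_of_nonneg (Finset.sum_nonneg fun i _ => hx0 i)]
        exact hB _ hx0
    _ = B * ∫ x in Ω, ‖∑ i, w s x i‖ ^ q := integral_const_mul _ _
    _ ≤ B * (2 + R / b) ^ q := mul_le_mul_of_nonneg_left hs hB0
    _ ≤ B * |2 + R / b| ^ q := by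
        rw [← abs_pow]
        exact mul_le_mul_of_nonneg_left (le_abs_self _) hB0

end LyapunovFunctional

/-- The weighted polynomial is the density of a Lyapunov functional. -/
lemma exists_isLyapunovDensity {j : ℕ} (hj : 1 ≤ j) {lam θ : ℕ → ℝ}
    (hlam : ∀ k ∈ Finset.Icc 1 (j + 1), 0 < lam k)
    (hθ : ∀ k ∈ Finset.Ico 1 (j + 1), 0 < θ k) {pm : ℕ} (hpm : 1 ≤ pm)
    {F : (Fin (j + 1) → ℝ) → Fin (j + 1) → ℝ} {dbar : ℕ → ℝ} (hS : OneSidedBound F dbar)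
    (hθd : ∀ ℓ ∈ Finset.Ico 1 (j + 1), dbar ℓ ≤ ∏ k ∈ Finset.Ico ℓ (j + 1), θ k)
    (hK : ∀ p : ℕ → ℕ, (∀ k ∈ Finset.Ico 1 j, p k ≤ p (k + 1)) → p j + 2 ≤ pm →
      ∀ l ∈ Finset.Icc 2 (j + 1), 0 < Kdet (entry (j + 1) lam θ p) l l) :
    ∃ K : ℝ, IsLyapunovDensity (fun i : Fin (j + 1) => lam (i + 1)) F K
      (fun w => weightedPoly θ (j + 1) w pm) (polyGrad θ (j + 1) pm)
      (polyHess θ (j + 1) pm) := by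
  have hform : ∀ p : ℕ → ℕ, (∀ k ∈ Finset.Ico 1 j, p k ≤ p (k + 1)) → p j + 2 ≤ pm →
      ∀ x : Fin (j + 1) → ℝ, 0 ≤ ∑ i : Fin (j + 1), ∑ k : Fin (j + 1),
        entry (j + 1) lam θ p ((i : ℕ) + 1) ((k : ℕ) + 1) * (x i * x k) := by
    intro p hp1 hp2 x
    refine quadraticForm_nonneg_of_Kdet (entry_symm _ _ _ _) ?_ (hK p hp1 hp2) x
    have h1 := hlam 1 (by simp)
    have h2 : 0 < ∏ k ∈ Finset.Ico 1 (j + 1), θ k ^ ((p k + 2) ^ 2) :=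
      Finset.prod_pos fun k hk => pow_pos (hθ k hk) _
    simp only [entry, min_self, max_self, Finset.Ico_self, Finset.prod_empty, one_mul]
    positivity
  -- For `pm ≥ 2` the index `p = 0` is admissible, and its matrix already yields `θ_k ≥ 1`.
  obtain ⟨K, hK0, hKle⟩ := exists_reaction_bound hS hθ hθd hpm fun h2 k hk =>
    one_le_weight hθ hlam (hform 0 (by simp) (by simpa using h2)) hk
  exact ⟨K, hasFDerivAt_weightedPoly θ j pm, hasFDerivAt_polyGrad θ j pm,
    continuous_polyHess θ j pm, fun w hw => weightedPoly_nonneg hθ pm hw,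
    fun w hw x => polyHess_form_nonneg hj hform hw x, hK0, hKle⟩

end ToeplitzRD

/-! ### The main theorem. -/

theorem theorem1
    {n m : ℕ} (hn : 1 ≤ n) (hm : 2 ≤ m)
    -- the domain
    (Ω : Set (EuclideanSpace ℝ (Fin n))) (hΩ : ToeplitzRD.IsBoundedC1Domain Ω)
    -- the entries of the tri-diagonal Toeplitz matrix, with the parabolicity condition
    (a b c : ℝ) (ha : 0 < a) (hb : 0 < b) (hc : 0 < c)
    (hpar : Real.cos (Real.pi / ((m : ℝ) + 1)) < a / (b + c))
    -- the boundary data: Robin, homogeneous Neumann or homogeneous Dirichlet conditions,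
    -- with the normal derivative or with the conormal one
    (α : ℝ) (κ Λ : Fin m → ℝ)
    (hbc : (0 < α ∧ α < 1) ∨ (α = 0 ∧ Λ = 0) ∨ (α = 1 ∧ Λ = 0))
    (hκ : (∀ i, κ i = 1) ∨ (∀ i, κ i = ToeplitzRD.eigenvalue a b c m ((i : ℕ) + 1)))
    -- the weights and the degree of the polynomial
    (θ : ℕ → ℝ) (hθ : ∀ k ∈ Finset.Ico 1 m, 0 < θ k) (pm : ℕ) (hpm : 1 ≤ pm)
    -- the reaction terms
    (F : (Fin m → ℝ) → Fin m → ℝ) (hgrowth : ToeplitzRD.PolynomialGrowth F)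
    (dbar : ℕ → ℝ) (hdbar : ∀ ℓ ∈ Finset.Ico 1 m, 0 < dbar ℓ)
    (hS : ToeplitzRD.OneSidedBound F dbar)
    (hθd : ∀ ℓ ∈ Finset.Ico 1 m, dbar ℓ ≤ ∏ k ∈ Finset.Ico ℓ m, θ k)
    -- positivity of the determinant-type quantities, for all `p_1 ≤ ⋯ ≤ p_{m-1} ≤ p_m - 2`
    (hK : ∀ p : ℕ → ℕ, (∀ k ∈ Finset.Ico 1 (m - 1), p k ≤ p (k + 1)) → p (m - 1) + 2 ≤ pm →
      ∀ l ∈ Finset.Icc 2 m,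
        0 < ToeplitzRD.Kdet
          (ToeplitzRD.entry m (ToeplitzRD.eigenvalue a b c m) θ p) l l) :
    -- a bound depending on the solution only through a bound `R` for `L(0)` and a bound `T` for `Tstar`
    ∀ T R : ℝ, ∃ M : ℝ, ∀ (Tmax : EReal) (w : ℝ → EuclideanSpace ℝ (Fin n) → Fin m → ℝ),
      ToeplitzRD.IsClassicalSolution Ω
        (fun i => ToeplitzRD.eigenvalue a b c m ((i : ℕ) + 1)) F α κ Λ pm Tmax w →
      ToeplitzRD.lyapunov Ω θ pm w 0 ≤ R →
      ∀ Tstar : ℝ, Tstar ≤ T → (Tstar : EReal) < Tmax →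
        ∀ t ∈ Set.Icc 0 Tstar,
          IntegrableOn (fun x => ToeplitzRD.weightedPoly θ m (w t x) pm) Ω ∧
          |ToeplitzRD.lyapunov Ω θ pm w t| ≤ M := by
  intro T R
  obtain ⟨j, rfl⟩ : ∃ j, m = j + 1 := ⟨m - 1, by omega⟩
  have ho := hΩ.isOpen
  have hb' := hΩ.bounded
  have hpm0 : pm ≠ 0 := by omega
  have hlam : ∀ k ∈ Finset.Icc 1 (j + 1), 0 < ToeplitzRD.eigenvalue a b c (j + 1) k := by
    intro k hk
    rw [Finset.mem_Icc] at hk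
    exact ToeplitzRD.eigenvalue_pos hb hc (by omega) hpar hk.1 hk.2
  have hlam' : ∀ i : Fin (j + 1), 0 < ToeplitzRD.eigenvalue a b c (j + 1) ((i : ℕ) + 1) :=
    fun i => hlam _ (by rw [Finset.mem_Icc]; omega)
  have hκ0 : ∀ i, 0 < κ i := by
    intro i
    rcases hκ with h | h
    · rw [h i]; exact one_pos
    · rw [h i]; exact hlam' i
  obtain ⟨K, hD⟩ := ToeplitzRD.exists_isLyapunovDensity (by omega) hlam hθ hpm hS hθd hK
  obtain ⟨C, hC0, hC⟩ := ToeplitzRD.exists_flux_bound ho hθ hpm hlam' hκ0 hbc F pm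
  obtain ⟨B, hB0, hB⟩ := ToeplitzRD.exists_lyapunov_gronwall (α := α) (κ := κ) (Λ := Λ) (q := pm)
    hΩ hD hC0
  obtain ⟨A, hA0, hA⟩ := ToeplitzRD.exists_bound_near_initial ho hb' hθ hpm0
    (fun i : Fin (j + 1) => ToeplitzRD.eigenvalue a b c (j + 1) ((i : ℕ) + 1)) F α κ Λ R
  -- `R` serves at `t = 0`; for `t > 0` the Gronwall bound is monotone in time, and `t - s ≤ T`.
  refine ⟨max R (gronwallBound A K B T), fun Tmax w hw hR Tstar hTstar hTmax t ht => ?_⟩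
  have htmax : (t : EReal) < Tmax := lt_of_le_of_lt (EReal.coe_le_coe_iff.2 ht.2) hTmax
  have hTmax0 : 0 < Tmax := lt_of_le_of_lt (by exact_mod_cast ht.1) htmax
  rcases ht.1.eq_or_lt with h0 | h0
  · subst h0
    obtain ⟨hint, hnn, -⟩ := hw.integrableOn_initial ho hθ hpm0 hTmax0
    refine ⟨hint, ?_⟩
    rw [abs_of_nonneg hnn]
    exact hR.trans (le_max_left _ _)
  · refine ⟨hw.integrableOn_weightedPoly hb' θ h0 htmax, ?_⟩
    have hnn : 0 ≤ ToeplitzRD.lyapunov Ω θ pm w t :=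
      setIntegral_nonneg ho.measurableSet fun x hx => hD.nonneg _ (hw.nonneg t h0 htmax x hx)
    rw [abs_of_nonneg hnn]
    choose G hGc hGgrad hGbc using hw.boundary_condition
    -- The starting time depends on the solution, but the bound `A` at that time does not.
    obtain ⟨s, hs, hs0, hst⟩ :=
      ((hA Tmax w hw hTmax0 hR).and (Ioo_mem_nhdsGT h0)).exists
    have hle := hB Tmax w G hw hGc hGgrad s t hs0 hst.le htmax
      (hC Tmax w G hw hGc hGgrad hGbc s t hs0 htmax) A hs
    refine hle.trans (le_trans ?_ (le_max_right _ _))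
    exact gronwallBound_mono hA0 hB0 hD.const_nonneg (by linarith [ht.2])
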